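/- **Setting.** Let $\Omega\subseteq\mathbb R^2$ be a bounded open polygonal set with $\Omega=\operatorname{int}\overline\Omega$ (for instance with Lipschitz boundary), let $\Omega_B\subseteq\Omega$ be open, let $\partial_N\Omega\subseteq\partial\Omega$ be closed, $\partial_D\Omega:=\partial\Omega\setminus\partial_N\Omega$, and let $\partial_S\Omega\subseteq\partial_N\Omega$ be closed with $\overline\Omega_B\cap\partial_S\Omega=\emptyset$. Let $T>0$, $p>1$, $q>1$, $1\le\dot q<q$, $r\ge p$, and $r\le p/(2-p)$ if $p<2$; $s'$ denotes the conjugate exponent of $s$. *Bulk energy.* $W:\Omega\times M^{2\times2}\to[0,\infty)$ is measurable in $x$; $W(x,\cdot)$ is $C^1$ and quasiconvex, i.e. $|\Omega|\,W(x,\xi)\le\int_\Omega W(x,\xi+\nabla\varphi(y))\,dy$ for $\varphi\in C_c^\infty(\Omega;\mathbb R^2)$; and $a_0^W|\xi|^p-b_0^W(x)\le W(x,\xi)\le a_1^W|\xi|^p+b_1^W(x)$ with $a_0^W,a_1^W>0$ and $0\le b_0^W,b_1^W\in L^1(\Omega)$. *Forces.* $F:[0,T]\times\Omega\times\mathbb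 R^2\to\mathbb R$ is measurable in $(t,x)$ and $C^1$ in $z$, with $$a_0^F|z|^q-b_0^F(t,x)\le-F(t,x,z)\le a_1^F|z|^q+b_1^F(t,x),\qquad |\partial_zF(t,x,z)|\le a_2^F|z|^{q-1}+b_2^F(t,x),$$ $a_0^F>0$, $a_1^F,a_2^F\ge0$, $0\le b_0^F,b_1^F\in C^0([0,T];L^1(\Omega))$, $0\le b_2^F\in C^0([0,T];L^{q'}(\Omega))$. There is $\dot F$, measurable in $(t,x)$ and $C^1$ in $z$, such that for all $(t,z)$ and a.e. $x$: $F(t,x,z)=F(0,x,z)+\int_0^t\dot F(s,x,z)\,ds$ and $\partial_zF(t,x,z)=\partial_zF(0,x,z)+\int_0^t\partial_z\dot F(s,x,z)\,ds$, with $|\dot F|\le a_3^F(t)|z|^{\dot q}+b_3^F(t,x)$ and $|\partial_z\dot F|\le a_4^F(t)|z|^{\dot q-1}+b_4^F(t,x)$, where $0\le a_3^F,a_4^F\in L^1([0,T])$, $0\le b_3^F\in L^1([0,T];L^1(\Omega))$, $0\le b_4^F\in L^1([0,T];L^{\dot q'}(\Omega))$. The function $G:[0,T]\times\partial_S\Omega\times\mathbb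 R^2\to\mathbb R$ satisfies the same conditions with $(\Omega,dx)$ replaced by $(\partial_S\Omega,\mathcal H^1)$ and both exponents $q,\dot q$ replaced by $r$, except that the lower bound is replaced by $-a_0^G(t,x)|z|-b_0^G(t,x)\le-G(t,x,z)$ with $0\le a_0^G\in L^\infty([0,T];L^{r'}(\partial_S\Omega))$ and $0\le b_0^G\in C^0([0,T];L^1(\partial_S\Omega))$. *Surface energy.* Let $X$ be closed with $\overline\Omega_B\subseteq X\subseteq\overline\Omega$ (for instance $X=\overline\Omega_B$), and let $k:X\times\mathbb R^2\to\mathbb R$ be continuous, each $k(x,\cdot)$ a norm, with $K_1|\nu|\le k(x,\nu)\le K_2|\nu|$ for some $K_1,K_2>0$. For a rectifiable set $\Gamma$ with unit normal field $\nu$ put $\mathcal E^s(\Gamma):=\int_\Gamma k(x,\nu(x))\,d\mathcal H^1$ if $\mathcal H^1(\Gamma\setminus X)=0$, and $\mathcal E^s(\Gamma):=+\infty$ otherwise. *Finite elements.* Let $0<c_1<c_2$, $\varepsilon>0$, $a\in\,]0,\frac12[$, and let $\mathbf R_\varepsilon$ be a regular triangulation of $\Omega$ of size $\varepsilon$: a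 finite family of closed triangles with union $\overline\Omega$, any two distinct ones being disjoint or meeting in a common vertex or a common edge, each containing a ball of diameter $c_1\varepsilon$ and contained in a ball of diameter $c_2\varepsilon$. Suppose that $\overline\Omega_B$ is a union of triangles of $\mathbf R_\varepsilon$, and that $\partial_D\Omega$ and $\partial_S\Omega$ are unions of edges of $\mathbf R_\varepsilon$ up to finitely many points. An adaptive triangulation $\mathbf T\in\mathcal T_{\varepsilon,a}(\Omega)$ is obtained by choosing on every edge $[x,y]$ of $\mathbf R_\varepsilon$ a knot $tx+(1-t)y$, $t\in[a,1-a]$, and dividing every triangle of $\mathbf R_\varepsilon$ into the four triangles determined by its vertices and its three knots. Let $\mathcal A_{\varepsilon,a}$ be the set of functions $u:\Omega\to\mathbb R^2$ (defined up to their values on edges) that are affine in the interior of every triangle of some $\mathbf T(u)\in\mathcal T_{\varepsilon,a}(\Omega)$; $S(u)$ is the union of the edges of $\mathbf T(u)$ inside $\Omega$ across which $u$ is discontinuous, and $\mathcal A^B_{\varepsilon,a}:=\{u\in\mathcal A_{\varepsilon,a}:S(u)\subseteq\overline\Omega_B\}$. Let $\mathcal{AF}_\varepsilon$ be the set of continuous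 functions on $\overline\Omega$ that are affine on every triangle of $\mathbf R_\varepsilon$. For $g\in\mathcal{AF}_\varepsilon$ let $S^g(u):=S(u)\cup\{x\in\partial_D\Omega: u(x)\ne g(x)\}$, in the sense of traces. For $u\in\mathcal A^B_{\varepsilon,a}$ let $$\mathcal E^{el}(t)(u):=\int_\Omega W(x,\nabla u)\,dx-\int_\Omega F(t,x,u)\,dx-\int_{\partial_S\Omega}G(t,x,u)\,d\mathcal H^1 .$$ *Data.* Let $g_\varepsilon(t)\in\mathcal{AF}_\varepsilon$ for all $t\in[0,T]$, let $\delta>0$, let $N_\delta$ be the largest integer with $\delta(N_\delta-1)<T$, $t_i^\delta:=i\delta$ for $0\le i\le N_\delta-1$, $t^\delta_{N_\delta}:=T$, $g_\varepsilon^{\delta,i}:=g_\varepsilon(t_i^\delta)$. Let $\Gamma^0$ be a preexisting crack, i.e. $\Gamma^0=S^0(z)$ (the set $S^g(z)$ with $g=0$) for some $z\in\mathcal A^B_{\varepsilon,a}$, with $\mathcal H^1(\Gamma^0)<\infty$ and $\mathcal H^1(\Gamma^0\setminus\overline\Omega_B)=0$. **Proposition 5.2.** For all $i=0,\dots,N_\delta$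 there exists $u^{\delta,i}_{\varepsilon,a}\in\mathcal A^B_{\varepsilon,a}$ such that, setting $$\Gamma^{\delta,i}_{\varepsilon,a}:=\Gamma^0\cup\bigcup_{r=0}^iS^{g_\varepsilon^{\delta,r}}(u^{\delta,r}_{\varepsilon,a}),$$ one has $\Gamma^0\subseteq\Gamma^{\delta,i}_{\varepsilon,a}\subseteq\Gamma^{\delta,j}_{\varepsilon,a}$ for $0\le i\le j\le N_\delta$, and for all $v\in\mathcal A^B_{\varepsilon,a}$ $$\mathcal E^{el}(0)(u^{\delta,0}_{\varepsilon,a})+\mathcal E^s\big(S^{g_\varepsilon^{\delta,0}}(u^{\delta,0}_{\varepsilon,a})\setminus\Gamma^0\big)\le\mathcal E^{el}(0)(v)+\mathcal E^s\big(S^{g_\varepsilon^{\delta,0}}(v)\setminus\Gamma^0\big),$$ and, for $1\le i\le N_\delta$, $$\mathcal E^{el}(t_i^\delta)(u^{\delta,i}_{\varepsilon,a})+\mathcal E^s\big(S^{g_\varepsilon^{\delta,i}}(u^{\delta,i}_{\varepsilon,a})\setminus\Gamma^{\delta,i-1}_{\varepsilon,a}\big)\le\mathcal E^{el}(t_i^\delta)(v)+\mathcal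 E^s\big(S^{g_\varepsilon^{\delta,i}}(v)\setminus\Gamma^{\delta,i-1}_{\varepsilon,a}\big).$$ -/

import Mathlib

open Set Filter Topology MeasureTheory
open scoped ENNReal ContDiff

namespace CrackFE

noncomputable section

/-- The Euclidean plane. -/
abbrev E2 : Type := EuclideanSpace ℝ (Fin 2)

/-- The `2 × 2` matrices, as linear maps of the plane. -/
abbrev M22 : Type := E2 →L[ℝ] E2

/-- One-dimensional Hausdorff measure in the plane. -/
abbrev H1 : Measure E2 := Measure.hausdorffMeasure 1

/-! ### Reference configuration -/

/-- The reference configuration `Ω`, its brittle part `ΩB`, the Neumann part `bdryN` of the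
boundary and the part `bdryS` of it on which the surface forces act. The condition
`interior (closure Ω) = Ω` holds for every open set with Lipschitz boundary. -/
structure Body where
  Ω : Set E2
  ΩB : Set E2
  bdryN : Set E2
  bdryS : Set E2
  isOpen_Ω : IsOpen Ω
  interior_closure_Ω : interior (closure Ω) = Ω
  isOpen_ΩB : IsOpen ΩB
  ΩB_subset : ΩB ⊆ Ω
  isClosed_bdryN : IsClosed bdryN
  bdryN_subset : bdryN ⊆ frontier Ω
  isClosed_bdryS : IsClosed bdryS
  bdryS_subset : bdryS ⊆ bdryN
  disjoint_bdryS : Disjoint (closure ΩB) bdryS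

/-- The Dirichlet part of the boundary. -/
def Body.bdryD (B : Body) : Set E2 := frontier B.Ω \ B.bdryN

/-! ### Time-dependent functions -/

/-- `b ∈ C⁰([0,T]; L^m(μ))`. -/
def IsContLp (T : ℝ) (μ : Measure E2) (m : ℝ≥0∞) (b : ℝ → E2 → ℝ) : Prop :=
  (∀ t ∈ Icc 0 T, MemLp (b t) m μ) ∧
    ∀ t ∈ Icc 0 T, Tendsto (fun s => eLpNorm (b s - b t) m μ) (𝓝[Icc 0 T] t) (𝓝 0)

/-- `b ∈ L^s([0,T]; L^m(μ))`, for a function `b` of two variables. -/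
def IsLpLp (T : ℝ) (μ : Measure E2) (s m : ℝ≥0∞) (b : ℝ → E2 → ℝ) : Prop :=
  AEStronglyMeasurable (fun y : ℝ × E2 => b y.1 y.2) ((volume.restrict (Icc 0 T)).prod μ) ∧
    (∀ᵐ t ∂(volume.restrict (Icc 0 T)), MemLp (b t) m μ) ∧
    MemLp (fun t => (eLpNorm (b t) m μ).toReal) s (volume.restrict (Icc 0 T))

/-- `b ≥ 0` on `[0,T] × X`. -/
def NonnegOn (T : ℝ) (X : Set E2) (b : ℝ → E2 → ℝ) : Prop :=
  ∀ t ∈ Icc 0 T, ∀ x ∈ X, 0 ≤ b t x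

/-- The conjugate exponent `s' = s / (s - 1)`, equal to `∞` for `s = 1`. -/
def conjExp (s : ℝ) : ℝ≥0∞ := ENNReal.conjExponent (ENNReal.ofReal s)

/-! ### Energy densities -/

/-- Quasiconvexity of `f : M^{2×2} → ℝ`, tested on `Ω`. -/
def IsQuasiconvex (Ω : Set E2) (f : M22 → ℝ) : Prop :=
  ∀ (ξ : M22) (φ : E2 → E2), ContDiff ℝ ∞ φ → HasCompactSupport φ → tsupport φ ⊆ Ω →
    (volume Ω).toReal * f ξ ≤ ∫ y in Ω, f (ξ + fderiv ℝ φ y)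

/-- The assumptions on the bulk energy density `W`. -/
structure IsBulkDensity (Ω : Set E2) (p : ℝ) (W : E2 → M22 → ℝ) : Prop where
  measurable : ∀ ξ, AEStronglyMeasurable (fun x => W x ξ) (volume.restrict Ω)
  nonneg : ∀ x ∈ Ω, ∀ ξ, 0 ≤ W x ξ
  quasiconvex : ∀ x ∈ Ω, IsQuasiconvex Ω (W x)
  contDiff : ∀ x ∈ Ω, ContDiff ℝ 1 (W x)
  growth : ∃ (a₀ a₁ : ℝ) (b₀ b₁ : E2 → ℝ), 0 < a₀ ∧ 0 < a₁ ∧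
    IntegrableOn b₀ Ω ∧ IntegrableOn b₁ Ω ∧ (∀ x ∈ Ω, 0 ≤ b₀ x) ∧ (∀ x ∈ Ω, 0 ≤ b₁ x) ∧
    ∀ x ∈ Ω, ∀ ξ, a₀ * ‖ξ‖ ^ p - b₀ x ≤ W x ξ ∧ W x ξ ≤ a₁ * ‖ξ‖ ^ p + b₁ x

/-- `Hd` is the time derivative of the potential `H` on `[0,T] × X`, with growth of order `s`. -/
structure IsRate (T : ℝ) (X : Set E2) (μ : Measure E2) (s : ℝ)
    (H Hd : ℝ → E2 → E2 → ℝ) : Prop where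
  measurable : ∀ z, AEStronglyMeasurable (fun y : ℝ × E2 => Hd y.1 y.2 z)
    ((volume.restrict (Icc 0 T)).prod (μ.restrict X))
  contDiff : ∀ t ∈ Icc 0 T, ∀ x ∈ X, ContDiff ℝ 1 (Hd t x)
  growth : ∃ (a₃ : ℝ → ℝ) (b₃ : ℝ → E2 → ℝ), IntegrableOn a₃ (Icc 0 T) ∧
    (∀ t ∈ Icc 0 T, 0 ≤ a₃ t) ∧ IsLpLp T (μ.restrict X) 1 1 b₃ ∧ NonnegOn T X b₃ ∧
    ∀ t ∈ Icc 0 T, ∀ x ∈ X, ∀ z, |Hd t x z| ≤ a₃ t * ‖z‖ ^ s + b₃ t x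
  deriv_growth : ∃ (a₄ : ℝ → ℝ) (b₄ : ℝ → E2 → ℝ), IntegrableOn a₄ (Icc 0 T) ∧
    (∀ t ∈ Icc 0 T, 0 ≤ a₄ t) ∧ IsLpLp T (μ.restrict X) 1 (conjExp s) b₄ ∧ NonnegOn T X b₄ ∧
    ∀ t ∈ Icc 0 T, ∀ x ∈ X, ∀ z, ‖fderiv ℝ (Hd t x) z‖ ≤ a₄ t * ‖z‖ ^ (s - 1) + b₄ t x
  integral_eq : ∀ t ∈ Icc 0 T, ∀ z, ∀ᵐ x ∂(μ.restrict X),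
    H t x z = H 0 x z + ∫ τ in (0 : ℝ)..t, Hd τ x z
  deriv_integral_eq : ∀ t ∈ Icc 0 T, ∀ z, ∀ᵐ x ∂(μ.restrict X),
    fderiv ℝ (H t x) z = fderiv ℝ (H 0 x) z + ∫ τ in (0 : ℝ)..t, fderiv ℝ (Hd τ x) z

/-- The assumptions that are common to the potentials of the body and of the surface forces:
growth of order `s` of the potential, of order `sd` of its time derivative. -/
structure IsPotential (T : ℝ) (X : Set E2) (μ : Measure E2) (s sd : ℝ)
    (H : ℝ → E2 → E2 → ℝ) : Prop where
  measurable : ∀ z, AEStronglyMeasurable (fun y : ℝ × E2 => H y.1 y.2 z)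
    ((volume.restrict (Icc 0 T)).prod (μ.restrict X))
  contDiff : ∀ t ∈ Icc 0 T, ∀ x ∈ X, ContDiff ℝ 1 (H t x)
  upper : ∃ (a₁ : ℝ) (b₁ : ℝ → E2 → ℝ), 0 ≤ a₁ ∧ IsContLp T (μ.restrict X) 1 b₁ ∧
    NonnegOn T X b₁ ∧ ∀ t ∈ Icc 0 T, ∀ x ∈ X, ∀ z, -H t x z ≤ a₁ * ‖z‖ ^ s + b₁ t x
  deriv_growth : ∃ (a₂ : ℝ) (b₂ : ℝ → E2 → ℝ), 0 ≤ a₂ ∧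
    IsContLp T (μ.restrict X) (conjExp s) b₂ ∧ NonnegOn T X b₂ ∧
    ∀ t ∈ Icc 0 T, ∀ x ∈ X, ∀ z, ‖fderiv ℝ (H t x) z‖ ≤ a₂ * ‖z‖ ^ (s - 1) + b₂ t x
  rate : ∃ Hd : ℝ → E2 → E2 → ℝ, IsRate T X μ sd H Hd

/-- The assumptions on the potential `F` of the body forces. -/
structure IsBodyPotential (T : ℝ) (Ω : Set E2) (q qd : ℝ) (F : ℝ → E2 → E2 → ℝ) : Prop
    extends IsPotential T Ω volume q qd F where
  lower : ∃ (a₀ : ℝ) (b₀ : ℝ → E2 → ℝ), 0 < a₀ ∧ IsContLp T (volume.restrict Ω) 1 b₀ ∧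
    NonnegOn T Ω b₀ ∧ ∀ t ∈ Icc 0 T, ∀ x ∈ Ω, ∀ z, a₀ * ‖z‖ ^ q - b₀ t x ≤ -F t x z

/-- The assumptions on the potential `G` of the surface forces, acting on `X`. -/
structure IsSurfacePotential (T : ℝ) (X : Set E2) (r : ℝ) (G : ℝ → E2 → E2 → ℝ) : Prop
    extends IsPotential T X H1 r r G where
  lower : ∃ a₀ b₀ : ℝ → E2 → ℝ, IsLpLp T (H1.restrict X) ⊤ (conjExp r) a₀ ∧ NonnegOn T X a₀ ∧
    IsContLp T (H1.restrict X) 1 b₀ ∧ NonnegOn T X b₀ ∧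
    ∀ t ∈ Icc 0 T, ∀ x ∈ X, ∀ z, -(a₀ t x * ‖z‖) - b₀ t x ≤ -G t x z

/-- The assumptions on the surface energy density `k` on `X`: it is continuous, and
`k x` is a norm, uniformly equivalent to the Euclidean one. -/
structure IsSurfaceDensity (X : Set E2) (k : E2 → E2 → ℝ) : Prop where
  continuousOn : ContinuousOn (fun y : E2 × E2 => k y.1 y.2) (X ×ˢ univ)
  smul : ∀ x ∈ X, ∀ (c : ℝ) (ν : E2), k x (c • ν) = |c| * k x ν
  add_le : ∀ x ∈ X, ∀ ν ν' : E2, k x (ν + ν') ≤ k x ν + k x ν'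
  bounds : ∃ K₁ K₂ : ℝ, 0 < K₁ ∧ 0 < K₂ ∧
    ∀ x ∈ X, ∀ ν : E2, K₁ * ‖ν‖ ≤ k x ν ∧ k x ν ≤ K₂ * ‖ν‖

/-! ### Surface energy of a rectifiable set -/

/-- Near `x`, the set `M` is the zero set of the `C¹` function `f`, and `∇f(x) ≠ 0`. -/
def IsLocalEquation (M : Set E2) (x : E2) (f : E2 → ℝ) : Prop :=
  fderiv ℝ f x ≠ 0 ∧ ∃ U : Set E2, IsOpen U ∧ x ∈ U ∧ ContDiffOn ℝ 1 f U ∧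
    M ∩ U = {y ∈ U | f y = 0}

/-- `M` is a one-dimensional `C¹` submanifold of the plane. -/
def IsC1Curve (M : Set E2) : Prop := ∀ x ∈ M, ∃ f, IsLocalEquation M x f

/-- `n` is a unit normal vector at `x` to the `C¹` curve `M`. -/
def IsUnitNormal (M : Set E2) (x n : E2) : Prop :=
  ‖n‖ = 1 ∧ ∃ f, IsLocalEquation M x f ∧ ∀ w : E2, inner ℝ n w = 0 → fderiv ℝ f x w = 0

/-- `Γ` is rectifiable and `ν` is a unit normal vector field on `Γ`: `Γ` is the disjoint union of
sets `Γᵢ` that are `H¹`-almost contained in `C¹` curves `Mᵢ`, and `ν` is normal to `Mᵢ` on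
`Γᵢ`. Any two such fields on `Γ` coincide up to the sign `H¹`-almost everywhere. -/
def IsUnitNormalField (Γ : Set E2) (ν : E2 → E2) : Prop :=
  ∃ M P : ℕ → Set E2, (∀ i, IsC1Curve (M i)) ∧ Γ = ⋃ i, P i ∧
    Pairwise (fun i j => Disjoint (P i) (P j)) ∧ (∀ i, H1 (P i \ M i) = 0) ∧
    ∀ i, ∀ x ∈ P i ∩ M i, IsUnitNormal (M i) x (ν x)

open Classical in
/-- The density `k`, given on `X`, extended by `+∞`. -/
def extDensity (X : Set E2) (k : E2 → E2 → ℝ) (x n : E2) : ℝ≥0∞ :=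
  if x ∈ X then ENNReal.ofReal (k x n) else ⊤

/-- The surface energy `∫_Γ k(x, ν(x)) dH¹(x)` of a rectifiable set `Γ`, where `ν` is a unit normal
field on `Γ`. The integral does not depend on `ν`, so that the infimum is its common value.
Cracks are possible in `X` only: the energy is `+∞` if `H¹(Γ \ X) > 0`. -/
def surfaceEnergy (X : Set E2) (k : E2 → E2 → ℝ) (Γ : Set E2) : ℝ≥0∞ :=
  ⨅ (ν : E2 → E2) (_ : IsUnitNormalField Γ ν), ∫⁻ x in Γ, extDensity X k x (ν x) ∂H1

/-! ### Triangulations -/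

/-- A regular triangulation of `Ω` of size `ε` with constants `c₁`, `c₂`. Triangles are given by
their sets of vertices; distinct triangles have at most two common vertices, so that `inter_eq` says
that they are disjoint or meet in a common vertex or in a common edge. -/
structure RegularTriangulation (Ω : Set E2) (c₁ c₂ ε : ℝ) where
  tris : Finset (Finset E2)
  card_eq : ∀ τ ∈ tris, τ.card = 3
  indep : ∀ τ ∈ tris, AffineIndependent ℝ (fun x : τ => (x : E2))
  cover : closure Ω = ⋃ τ ∈ tris, convexHull ℝ (τ : Set E2)
  inter_eq : ∀ τ ∈ tris, ∀ σ ∈ tris, τ ≠ σ →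
    convexHull ℝ (τ : Set E2) ∩ convexHull ℝ (σ : Set E2) = convexHull ℝ ((τ : Set E2) ∩ σ)
  contains_ball : ∀ τ ∈ tris, ∃ x, Metric.closedBall x (c₁ * ε / 2) ⊆ convexHull ℝ (τ : Set E2)
  in_ball : ∀ τ ∈ tris, ∃ x, convexHull ℝ (τ : Set E2) ⊆ Metric.closedBall x (c₂ * ε / 2)

variable {Ω : Set E2} {c₁ c₂ ε : ℝ}

/-- The edges of a triangulation. -/
def RegularTriangulation.edges (R : RegularTriangulation Ω c₁ c₂ ε) : Set (Set E2) :=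
  {e | ∃ τ ∈ R.tris, ∃ x ∈ τ, ∃ y ∈ τ, x ≠ y ∧ e = segment ℝ x y}

/-- `X` is composed of edges of `R`, up to a finite number of points. -/
def RegularTriangulation.ComposedOfEdges (R : RegularTriangulation Ω c₁ c₂ ε) (X : Set E2) : Prop :=
  ∃ 𝓔 ⊆ R.edges, (symmDiff X (⋃₀ 𝓔)).Finite

/-- `X` is composed of triangles of `R`. -/
def RegularTriangulation.ComposedOfTriangles (R : RegularTriangulation Ω c₁ c₂ ε)
    (X : Set E2) : Prop :=
  ∃ 𝓑 ⊆ R.tris, closure X = ⋃ τ ∈ 𝓑, convexHull ℝ (τ : Set E2)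

/-- `z` gives a knot on every edge `[x,y]` of `R`, at relative distance at least `a` from
the endpoints. -/
def RegularTriangulation.IsKnotChoice (R : RegularTriangulation Ω c₁ c₂ ε) (a : ℝ)
    (z : Sym2 E2 → E2) : Prop :=
  ∀ τ ∈ R.tris, ∀ x ∈ τ, ∀ y ∈ τ, x ≠ y → ∃ t ∈ Icc a (1 - a), z s(x, y) = t • x + (1 - t) • y

/-- The adaptive triangulation nested in `R` with the knots `z`: every triangle of `R` is divided into
three triangles at its vertices and the triangle of the three knots. Triangles are
given by their sets of vertices. -/
def RegularTriangulation.adaptive (R : RegularTriangulation Ω c₁ c₂ ε) (z : Sym2 E2 → E2) :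
    Set (Set E2) :=
  {V | ∃ τ ∈ R.tris, ∃ x ∈ τ, ∃ y ∈ τ, ∃ w ∈ τ, x ≠ y ∧ x ≠ w ∧ y ≠ w ∧
    (V = {x, z s(x, y), z s(x, w)} ∨ V = {z s(x, y), z s(x, w), z s(y, w)})}

/-- The continuous functions that are affine on every triangle of `R`. They are taken with their
continuous extension to the closure of `Ω`; values elsewhere are irrelevant. -/
def RegularTriangulation.affineFE (R : RegularTriangulation Ω c₁ c₂ ε) : Set (E2 → E2) :=
  {g | ContinuousOn g (closure Ω) ∧
    ∀ τ ∈ R.tris, ∃ A : E2 →ᵃ[ℝ] E2, EqOn g A (convexHull ℝ (τ : Set E2))}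

/-! ### The discontinuous finite element space -/

/-- A function `u` that is affine in every triangle of some adaptive triangulation `T(u)`. The values
on the edges (a null set) and outside `Ω` are irrelevant. -/
structure FEFun (R : RegularTriangulation Ω c₁ c₂ ε) (a : ℝ) where
  knot : Sym2 E2 → E2
  isKnotChoice : R.IsKnotChoice a knot
  toFun : E2 → E2
  affine : ∀ V ∈ R.adaptive knot, ∃ A : E2 →ᵃ[ℝ] E2,
    EqOn toFun A (interior (convexHull ℝ V))

variable {R : RegularTriangulation Ω c₁ c₂ ε} {a : ℝ}

/-- The jump set `S(u)`: the union of the edges `[x,y]` of `T(u)`, common to two triangles `V ≠ V'` of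
`T(u)`, such that the limits of `u` from the two triangles do not agree on `[x,y]`. -/
def FEFun.jumpSet (u : FEFun R a) : Set E2 :=
  {s | ∃ V ∈ R.adaptive u.knot, ∃ V' ∈ R.adaptive u.knot, V ≠ V' ∧
    ∃ x ∈ V ∩ V', ∃ y ∈ V ∩ V', x ≠ y ∧ s ∈ segment ℝ x y ∧
      ∃ b ∈ segment ℝ x y, extendFrom (interior (convexHull ℝ V)) u.toFun b ≠
        extendFrom (interior (convexHull ℝ V')) u.toFun b}

/-- The trace of `u` on the boundary of `Ω`: the limit of `u` from inside `Ω`, which exists at all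
boundary points that are not vertices of `T(u)`. -/
def FEFun.trace (u : FEFun R a) : E2 → E2 := extendFrom Ω u.toFun

/-- `S^g(u) = S(u) ∪ {x ∈ D : u(x) ≠ g(x)}`, in the sense of traces. -/
def FEFun.jumpSetBC (u : FEFun R a) (D : Set E2) (g : E2 → E2) : Set E2 :=
  u.jumpSet ∪ {x ∈ D | u.trace x ≠ g x}

/-- The functions that jump in the closure of `ΩB` only. -/
def brittleFE (R : RegularTriangulation Ω c₁ c₂ ε) (a : ℝ) (ΩB : Set E2) : Set (FEFun R a) :=
  {u | u.jumpSet ⊆ closure ΩB}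

/-- The admissible preexisting cracks. -/
def initialCracks (R : RegularTriangulation Ω c₁ c₂ ε) (a : ℝ) (ΩB D : Set E2) : Set (Set E2) :=
  {Γ | H1 (Γ \ closure ΩB) = 0 ∧ H1 Γ < ⊤ ∧ ∃ z ∈ brittleFE R a ΩB, Γ = z.jumpSetBC D 0}

/-- The elastic energy
`∫_Ω W(x,∇u) dx - ∫_Ω F(t,x,u) dx - ∫_X G(t,x,u) dH¹`. -/
def FEFun.elasticEnergy (u : FEFun R a) (X : Set E2) (W : E2 → M22 → ℝ)
    (F G : ℝ → E2 → E2 → ℝ) (t : ℝ) : ℝ :=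
  (∫ x in Ω, W x (fderiv ℝ u.toFun x)) - (∫ x in Ω, F t x (u.toFun x))
    - ∫ x in X, G t x (u.trace x) ∂H1

/-- The energy that is minimized in one time step: the elastic energy at time `t` plus the surface energy
of the part of `S^g(u)` outside the previous crack `Γ`. Here `k` is given on `X`. -/
def FEFun.stepEnergy (u : FEFun R a) (B : Body) (W : E2 → M22 → ℝ) (F G : ℝ → E2 → E2 → ℝ)
    (X : Set E2) (k : E2 → E2 → ℝ) (t : ℝ) (g : E2 → E2) (Γ : Set E2) : EReal :=
  (u.elasticEnergy B.bdryS W F G t : EReal) +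
    (surfaceEnergy X k (u.jumpSetBC B.bdryD g \ Γ) : EReal)

/-! ### Discrete evolutions -/

/-- The time nodes: `iδ` for `i < N`, and `T` for `i = N`. -/
def timeNode (T δ : ℝ) (N i : ℕ) : ℝ := if i < N then i * δ else T

/-- The crack `Γ^i = Γ⁰ ∪ ⋃_{r ≤ i} S^{g^r}(u^r)`. -/
def crack (D : Set E2) (Γ₀ : Set E2) (g : ℕ → E2 → E2) (u : ℕ → FEFun R a) (i : ℕ) : Set E2 :=
  Γ₀ ∪ ⋃ r ≤ i, (u r).jumpSetBC D (g r)

end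

end CrackFE

open CrackFE

/-! Each time step is a minimum problem in finitely many parameters, solved by the direct method;
the evolution then follows by recursion.

An adaptive function is described by its knots, which range over compact segments, and by the affine
coefficients on each triangle. The vertices are labelled (`pos`, `cells`) so that the combinatorics
is the same for every choice of knots and only the positions move. Since `a > 0`, the knots stay
away from the ends of their edges, so the triangles do not degenerate and the limit of a sequence of
adaptive triangulations is again one (`RegularTriangulation.isComplex`). Convergence (`FEConverges`)
means convergence of the positions and of the coefficients.

Compactness: `-F` grows like `|z|^q` with `q > 1`, while the work of the surface forces is at most
linear in the size of the coefficients. Knots converge along a subsequence; afterwards a fixed ball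
lies in every triangle with a given label, and the integral of `|u|^q` over it controls the
coefficients (`exists_feConverges_of_elasticEnergy_le`).

Elastic energy: functions, gradients and traces converge pointwise almost everywhere and are
uniformly bounded, so the energy converges by dominated convergence
(`FEConverges.tendsto_elasticEnergy`).

Surface energy: to have a jump across an edge, or a trace different from `g`, is an open condition.
Hence a jump edge of the limit is a jump edge of the sequence eventually, and lengths, normals and
positions of the edges converge. Fatou's lemma on each edge, and on the boundary, gives lower
semicontinuity (`FEConverges.surfaceEnergy_le_liminf`). The previous crack must be relatively closed
in `Ω` for this: a point of an edge outside it must be a limit of points outside it. This property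
(`IsCrackSet`) holds for the initial crack and is preserved when the crack grows, so the recursion
(`exists_evolution`) can carry it along. -/

namespace CrackFE

noncomputable section

/-! ### Triangles in the plane -/

/-- Twice the signed area of the triangle `p q r`. -/
def area (p q r : E2) : ℝ := (q 0 - p 0) * (r 1 - p 1) - (q 1 - p 1) * (r 0 - p 0)

theorem area_rotate (p q r : E2) : area q r p = area p q r := by
  unfold area; ring

theorem area_add_area_add_area (p q r x : E2) :
    area x q r + area p x r + area p q x = area p q r := by
  unfold area; ring

theorem area_smul_eq (p q r x : E2) :
    area p q r • x = area x q r • p + area p x r • q + area p q x • r := by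
  ext i
  fin_cases i <;> simp [area] <;> ring

theorem area_combination (p q r : E2) {a b c : ℝ} (h : a + b + c = 1) (y z : E2) :
    area (a • p + b • q + c • r) y z = a * area p y z + b * area q y z + c * area r y z := by
  have : c = 1 - a - b := by linarith
  subst this
  simp [area]; ring

theorem area_self_left (p q : E2) : area p p q = 0 := by unfold area; ring

theorem area_self_outer (p q : E2) : area p q p = 0 := by unfold area; ring

@[fun_prop]
theorem continuous_area {α : Type*} [TopologicalSpace α] {f g h : α → E2}
    (hf : Continuous f) (hg : Continuous g) (hh : Continuous h) :
    Continuous fun x => area (f x) (g x) (h x) := by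
  unfold area
  fun_prop

/-- Three points without affine relations span a triangle of non-zero area. -/
theorem area_ne_zero_of_relation {p q r : E2}
    (h : ∀ a b c : ℝ, a + b + c = 0 → a • p + b • q + c • r = 0 → a = 0 ∧ b = 0 ∧ c = 0) :
    area p q r ≠ 0 := by
  intro h0
  have key : ∀ s t : ℝ, s • (q - p) + t • (r - p) = 0 → s = 0 ∧ t = 0 := by
    intro s t hst
    exact (h (-(s + t)) s t (by ring) (by rw [← hst]; module)).2
  unfold area at h0
  have e0 := key (r 0 - p 0) (-(q 0 - p 0)) (by
    ext l; fin_cases l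
    · simp; ring
    · simp; linarith)
  have e1 := key (r 1 - p 1) (-(q 1 - p 1)) (by
    ext l; fin_cases l
    · simp; linarith
    · simp; ring)
  have hkey := key 1 0 (by
    ext l; fin_cases l
    · simp; linarith [e0.2]
    · simp; linarith [e1.2])
  exact one_ne_zero hkey.1

theorem mem_convexHull_triple {p q r x : E2} :
    x ∈ convexHull ℝ {p, q, r} ↔
      ∃ a b c : ℝ, 0 ≤ a ∧ 0 ≤ b ∧ 0 ≤ c ∧ a + b + c = 1 ∧ a • p + b • q + c • r = x := by
  constructor
  · intro hx
    rw [convexHull_insert (by simp)] at hx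
    simp only [convexHull_pair, convexJoin_singleton_left, mem_iUnion] at hx
    obtain ⟨y, ⟨b, c, hb, hc, hbc, rfl⟩, ⟨s, t, hs, ht, hst, rfl⟩⟩ := hx
    refine ⟨s, t * b, t * c, hs, by positivity, by positivity, ?_, ?_⟩
    · rw [add_assoc, ← mul_add, hbc, mul_one, hst]
    · rw [smul_add, smul_smul, smul_smul, add_assoc]
  · rintro ⟨a, b, c, ha, hb, hc, h, rfl⟩
    have hconv := convex_convexHull ℝ ({p, q, r} : Set E2)
    have hp : p ∈ convexHull ℝ ({p, q, r} : Set E2) := subset_convexHull ℝ _ (by simp)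
    have hq : q ∈ convexHull ℝ ({p, q, r} : Set E2) := subset_convexHull ℝ _ (by simp)
    have hr : r ∈ convexHull ℝ ({p, q, r} : Set E2) := subset_convexHull ℝ _ (by simp)
    have := hconv.sum_mem (t := Finset.univ) (w := ![a, b, c]) (z := ![p, q, r])
      (by intro i _; fin_cases i <;> simpa) (by simp [Fin.sum_univ_three, h])
      (by intro i _; fin_cases i <;> simpa)
    simpa [Fin.sum_univ_three] using this

/-- The barycentric coordinate of `x` with respect to the vertex `p` of the triangle `p q r`. -/
def bary (p q r x : E2) : ℝ := area x q r / area p q r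

theorem bary_sum {p q r : E2} (h : area p q r ≠ 0) (x : E2) :
    bary p q r x + bary q r p x + bary r p q x = 1 := by
  have h1 : area q r p = area p q r := area_rotate _ _ _
  have h2 : area r p q = area p q r := by unfold area; ring
  unfold bary
  rw [h1, h2, ← add_div, ← add_div, div_eq_one_iff_eq h, ← area_add_area_add_area p q r x]
  unfold area; ring

theorem bary_smul_sum {p q r : E2} (h : area p q r ≠ 0) (x : E2) :
    bary p q r x • p + bary q r p x • q + bary r p q x • r = x := by
  have h1 : area q r p = area p q r := area_rotate _ _ _
  have h2 : area r p q = area p q r := by unfold area; ring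
  have h3 : area x r p = area p x r := by unfold area; ring
  have h4 : area x p q = area p q x := by unfold area; ring
  have := area_smul_eq p q r x
  unfold bary
  rw [h1, h2, h3, h4]
  have h5 : x = (area p q r)⁻¹ • (area p q r • x) := by rw [smul_smul, inv_mul_cancel₀ h, one_smul]
  conv_rhs => rw [h5, this]
  simp only [smul_add, smul_smul, div_eq_inv_mul]

theorem bary_combination {p q r : E2} (h : area p q r ≠ 0) {a b c : ℝ} (habc : a + b + c = 1) :
    bary p q r (a • p + b • q + c • r) = a := by
  unfold bary
  rw [area_combination p q r habc, area_self_left, div_eq_iff h]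
  have : area r q r = 0 := area_self_outer _ _
  rw [this]; ring

theorem area_ne_zero_rotate {p q r : E2} (h : area p q r ≠ 0) : area q r p ≠ 0 := by
  rwa [area_rotate]

theorem bary_combination_all {p q r : E2} (h : area p q r ≠ 0) {a b c : ℝ} (habc : a + b + c = 1) :
    bary p q r (a • p + b • q + c • r) = a ∧ bary q r p (a • p + b • q + c • r) = b ∧
      bary r p q (a • p + b • q + c • r) = c := by
  refine ⟨bary_combination h habc, ?_, ?_⟩
  · rw [add_assoc, add_comm]
    exact bary_combination (area_ne_zero_rotate h) (by linarith)
  · rw [add_comm, ← add_assoc]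
    exact bary_combination (area_ne_zero_rotate (area_ne_zero_rotate h)) (by linarith)

theorem mem_convexHull_iff_bary {p q r x : E2} (h : area p q r ≠ 0) :
    x ∈ convexHull ℝ {p, q, r} ↔ 0 ≤ bary p q r x ∧ 0 ≤ bary q r p x ∧ 0 ≤ bary r p q x := by
  rw [mem_convexHull_triple]
  constructor
  · rintro ⟨a, b, c, ha, hb, hc, habc, rfl⟩
    obtain ⟨h1, h2, h3⟩ := bary_combination_all h habc
    rw [h1, h2, h3]
    exact ⟨ha, hb, hc⟩
  · rintro ⟨h1, h2, h3⟩
    exact ⟨_, _, _, h1, h2, h3, bary_sum h x, bary_smul_sum h x⟩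

@[fun_prop]
theorem continuous_bary (p q r : E2) : Continuous (bary p q r) := by
  unfold bary
  fun_prop

/-- Motion in the direction of an edge lowers the coordinate at its starting vertex at unit speed.
This excludes a zero coordinate at an interior point. -/
theorem bary_add_smul {p q r : E2} (h : area p q r ≠ 0) (x : E2) (s : ℝ) :
    bary p q r (x + s • (q - p)) = bary p q r x - s := by
  unfold bary
  rw [div_sub' h, div_left_inj' h]
  simp [area]; ring

theorem mem_interior_convexHull_iff_bary {p q r x : E2} (h : area p q r ≠ 0) :
    x ∈ interior (convexHull ℝ {p, q, r}) ↔
      0 < bary p q r x ∧ 0 < bary q r p x ∧ 0 < bary r p q x := by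
  constructor
  · have key : ∀ {p q r : E2}, area p q r ≠ 0 → x ∈ interior (convexHull ℝ {p, q, r}) →
        0 < bary p q r x := by
      intro p q r h hx
      by_contra hle
      have hcont : Tendsto (fun s : ℝ => x + s • (q - p)) (𝓝[>] 0) (𝓝 x) := by
        have : Continuous fun s : ℝ => x + s • (q - p) := by fun_prop
        have h0 := this.tendsto 0
        simp only [zero_smul, add_zero] at h0
        exact h0.mono_left nhdsWithin_le_nhds
      have hev := hcont.eventually (mem_interior_iff_mem_nhds.mp hx)
      obtain ⟨s, hs, hs0⟩ := (hev.and self_mem_nhdsWithin).exists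
      have := ((mem_convexHull_iff_bary h).mp hs).1
      rw [bary_add_smul h] at this
      have : (0 : ℝ) < s := hs0
      linarith
    intro hx
    refine ⟨key h hx, key (area_ne_zero_rotate h) ?_,
      key (area_ne_zero_rotate (area_ne_zero_rotate h)) ?_⟩
    · convert hx using 3
      ext y; simp only [mem_insert_iff, mem_singleton_iff]; tauto
    · convert hx using 3
      ext y; simp only [mem_insert_iff, mem_singleton_iff]; tauto
  · rintro ⟨h1, h2, h3⟩
    refine mem_interior.mpr ⟨{y | 0 < bary p q r y} ∩ ({y | 0 < bary q r p y} ∩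
      {y | 0 < bary r p q y}), ?_, ?_, h1, h2, h3⟩
    · rintro y ⟨h1, h2, h3⟩
      exact (mem_convexHull_iff_bary h).mpr ⟨le_of_lt h1, le_of_lt h2, le_of_lt h3⟩
    · exact (isOpen_lt continuous_const (continuous_bary _ _ _)).inter
        ((isOpen_lt continuous_const (continuous_bary _ _ _)).inter
          (isOpen_lt continuous_const (continuous_bary _ _ _)))

theorem interior_convexHull_triple_nonempty {p q r : E2} (h : area p q r ≠ 0) :
    (interior (convexHull ℝ {p, q, r})).Nonempty := by
  refine ⟨(1 / 3 : ℝ) • p + (1 / 3 : ℝ) • q + (1 / 3 : ℝ) • r, ?_⟩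
  rw [mem_interior_convexHull_iff_bary h]
  obtain ⟨h1, h2, h3⟩ := bary_combination_all (a := 1 / 3) (b := 1 / 3) (c := 1 / 3) h (by norm_num)
  rw [h1, h2, h3]
  norm_num

/-- Points in the interior of a triangle stay there, together with a neighbourhood, if the triangle
is moved slightly. -/
theorem eventually_mem_interior_convexHull {α : Type*} {l : Filter α} {P Q S : α → E2} {p q r : E2}
    (hP : Tendsto P l (𝓝 p)) (hQ : Tendsto Q l (𝓝 q)) (hS : Tendsto S l (𝓝 r))
    (h : area p q r ≠ 0) {K : Set E2} (hK : IsCompact K)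
    (hKi : K ⊆ interior (convexHull ℝ {p, q, r})) :
    ∀ᶠ n in l, K ⊆ interior (convexHull ℝ {P n, Q n, S n}) := by
  have hT : Tendsto (fun n => (P n, Q n, S n)) l (𝓝 (p, q, r)) := hP.prodMk_nhds (hQ.prodMk_nhds hS)
  have hev : ∀ x ∈ K, ∀ᶠ y : (E2 × E2 × E2) × E2 in 𝓝 ((p, q, r), x),
      y.2 ∈ interior (convexHull ℝ {y.1.1, y.1.2.1, y.1.2.2}) := by
    intro x hx
    have hx' := (mem_interior_convexHull_iff_bary h).mp (hKi hx)
    have c0 : ContinuousAt (fun y : (E2 × E2 × E2) × E2 => area y.1.1 y.1.2.1 y.1.2.2)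
      ((p, q, r), x) := by fun_prop
    have e0 := c0.eventually_ne (y := 0) (by exact h)
    have cb : ∀ f g k : (E2 × E2 × E2) × E2 → E2, Continuous f → Continuous g → Continuous k →
        area (f ((p, q, r), x)) (g ((p, q, r), x)) (k ((p, q, r), x)) ≠ 0 →
        0 < bary (f ((p, q, r), x)) (g ((p, q, r), x)) (k ((p, q, r), x)) x →
        ∀ᶠ y : (E2 × E2 × E2) × E2 in 𝓝 ((p, q, r), x), 0 < bary (f y) (g y) (k y) y.2 := by
      intro f g k hf hg hk hne hpos
      have : ContinuousAt (fun y => bary (f y) (g y) (k y) y.2) ((p, q, r), x) := by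
        unfold bary
        refine ContinuousAt.div ?_ ?_ hne <;> fun_prop
      exact this.eventually_const_lt hpos
    have e1 := cb (fun y => y.1.1) (fun y => y.1.2.1) (fun y => y.1.2.2) (by fun_prop) (by fun_prop)
      (by fun_prop) h hx'.1
    have e2 := cb (fun y => y.1.2.1) (fun y => y.1.2.2) (fun y => y.1.1) (by fun_prop) (by fun_prop)
      (by fun_prop) (area_ne_zero_rotate h) hx'.2.1
    have e3 := cb (fun y => y.1.2.2) (fun y => y.1.1) (fun y => y.1.2.1) (by fun_prop) (by fun_prop)
      (by fun_prop) (area_ne_zero_rotate (area_ne_zero_rotate h)) hx'.2.2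
    filter_upwards [e0, e1, e2, e3] with y h0 h1 h2 h3
    exact (mem_interior_convexHull_iff_bary h0).mpr ⟨h1, h2, h3⟩
  -- The condition is open in the vertices and the point jointly; compactness of `K` makes the
  -- neighbourhood of the vertices uniform in the point.
  have := hK.eventually_forall_of_forall_eventually
    (P := fun (y : E2 × E2 × E2) x => x ∈ interior (convexHull ℝ {y.1, y.2.1, y.2.2})) hev
  exact hT.eventually this

end

end CrackFE

namespace CrackFE

noncomputable section

/-! ### Labelled triangulations -/

section Complex

variable {ι : Type*}

/-- The coefficients of a convex combination of points that are labelled by `V`. -/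
structure IsWeight (V : Finset ι) (c : ι → ℝ) : Prop where
  nonneg : ∀ i, 0 ≤ c i
  eq_zero : ∀ i ∉ V, c i = 0
  sum_eq : ∑ i ∈ V, c i = 1

/-- The weights sit on labels and not on points, so that the same weight can be used for different
positions `P` of the vertices. -/
theorem mem_convexHull_image_iff {V : Finset ι} {P : ι → E2} {x : E2} :
    x ∈ convexHull ℝ (P '' V) ↔ ∃ c, IsWeight V c ∧ ∑ i ∈ V, c i • P i = x := by
  classical
  constructor
  · intro hx
    refine convexHull_min (t := {x | ∃ c, IsWeight V c ∧ ∑ i ∈ V, c i • P i = x}) ?_ ?_ hx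
    · rintro _ ⟨i, hi, rfl⟩
      have hi : i ∈ V := hi
      refine ⟨Pi.single i 1, ⟨fun j => ?_, fun j hj => ?_, ?_⟩, ?_⟩
      · by_cases h : j = i
        · subst h; simp
        · simp [h]
      · exact Pi.single_eq_of_ne (by rintro rfl; exact hj hi) _
      · simp [Finset.sum_pi_single', hi]
      · rw [Finset.sum_eq_single_of_mem i hi]
        · simp
        · intro j _ hj; simp [hj]
    · rintro _ ⟨c, hc, rfl⟩ _ ⟨d, hd, rfl⟩ s t hs ht hst
      refine ⟨fun i => s * c i + t * d i, ⟨fun i => ?_, fun i hi => ?_, ?_⟩, ?_⟩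
      · have := hc.nonneg i
        have := hd.nonneg i
        positivity
      · simp [hc.eq_zero i hi, hd.eq_zero i hi]
      · rw [Finset.sum_add_distrib, ← Finset.mul_sum, ← Finset.mul_sum, hc.sum_eq, hd.sum_eq,
          mul_one, mul_one, hst]
      · simp only [add_smul, mul_smul, Finset.sum_add_distrib, Finset.smul_sum]
  · rintro ⟨c, hc, rfl⟩
    exact (convex_convexHull ℝ _).sum_mem (fun i _ => hc.nonneg i) hc.sum_eq
      fun i hi => subset_convexHull ℝ _ (mem_image_of_mem _ hi)

/-- `𝒞` is a finite family of triples of labels and `P` gives the positions of the vertices such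
that
the triangles with these vertices form a triangulation of `Ω`: they cover `closure Ω`, and a
point has the same barycentric coordinates in all triangles to which it belongs. -/
structure IsComplex (Ω : Set E2) (𝒞 : Finset (Finset ι)) (P : ι → E2) : Prop where
  card_eq : ∀ V ∈ 𝒞, V.card = 3
  unique : ∀ V ∈ 𝒞, ∀ V' ∈ 𝒞, ∀ c c' : ι → ℝ, IsWeight V c → IsWeight V' c' →
    ∑ i ∈ V, c i • P i = ∑ i ∈ V', c' i • P i → c = c'
  cover : closure Ω = ⋃ V ∈ 𝒞, convexHull ℝ (P '' V)
  interior_closure : interior (closure Ω) = Ω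

open Classical in
/-- The function with the values `a`, `b`, `c` at `i`, `j`, `k`, and zero elsewhere. -/
def tripleWeight (i j k : ι) (a b c : ℝ) : ι → ℝ := fun l =>
  if l = i then a else if l = j then b else if l = k then c else 0

variable {i j k : ι} {a b c : ℝ}

theorem tripleWeight_fst : tripleWeight i j k a b c i = a := by simp [tripleWeight]

theorem tripleWeight_snd (hij : i ≠ j) : tripleWeight i j k a b c j = b := by
  simp [tripleWeight, hij.symm]

theorem tripleWeight_trd (hik : i ≠ k) (hjk : j ≠ k) : tripleWeight i j k a b c k = c := by
  simp [tripleWeight, hik.symm, hjk.symm]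

theorem sum_triple {M : Type*} [AddCommMonoid M] [DecidableEq ι] (hij : i ≠ j) (hik : i ≠ k)
    (hjk : j ≠ k) (f : ι → M) : ∑ l ∈ {i, j, k}, f l = f i + f j + f k := by
  rw [Finset.sum_insert (by simp [hij, hik]), Finset.sum_insert (by simp [hjk]),
    Finset.sum_singleton, add_assoc]

theorem isWeight_tripleWeight [DecidableEq ι] (hij : i ≠ j) (hik : i ≠ k) (hjk : j ≠ k)
    (ha : 0 ≤ a) (hb : 0 ≤ b) (hc : 0 ≤ c) (habc : a + b + c = 1) :
    IsWeight {i, j, k} (tripleWeight i j k a b c) := by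
  refine ⟨fun l => ?_, fun l hl => ?_, ?_⟩
  · unfold tripleWeight
    split_ifs <;> first | assumption | exact le_rfl
  · simp only [Finset.mem_insert, Finset.mem_singleton, not_or] at hl
    simp [tripleWeight, hl]
  · rw [sum_triple hij hik hjk, tripleWeight_fst, tripleWeight_snd hij, tripleWeight_trd hik hjk,
      habc]

theorem sum_tripleWeight_smul [DecidableEq ι] (hij : i ≠ j) (hik : i ≠ k) (hjk : j ≠ k)
    (P : ι → E2) : ∑ l ∈ {i, j, k}, tripleWeight i j k a b c l • P l =
      a • P i + b • P j + c • P k := by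
  rw [sum_triple hij hik hjk, tripleWeight_fst, tripleWeight_snd hij, tripleWeight_trd hik hjk]

/-! ### Edges, interior points and boundary points of a labelled triangulation. -/

namespace IsComplex

variable {Ω : Set E2} {𝒞 : Finset (Finset ι)} {P : ι → E2}

theorem convexHull_subset (h : IsComplex Ω 𝒞 P) {V : Finset ι} (hV : V ∈ 𝒞) :
    convexHull ℝ (P '' V) ⊆ closure Ω := by
  rw [h.cover]
  exact subset_biUnion_of_mem (u := fun V : Finset ι => convexHull ℝ (P '' V)) hV

theorem interior_convexHull_subset (h : IsComplex Ω 𝒞 P) {V : Finset ι} (hV : V ∈ 𝒞) :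
    interior (convexHull ℝ (P '' V)) ⊆ Ω := by
  rw [← h.interior_closure]
  exact interior_mono (h.convexHull_subset hV)

theorem isCompact_closure (h : IsComplex Ω 𝒞 P) : IsCompact (closure Ω) := by
  rw [h.cover]
  refine 𝒞.isCompact_biUnion fun V _ => ?_
  exact (V.finite_toSet.image P).isCompact_convexHull (𝕜 := ℝ)

/-- Uniqueness of barycentric coordinates, in two labelled triangles. -/
theorem tripleWeight_eq (h : IsComplex Ω 𝒞 P) [DecidableEq ι] {i' j' k' : ι} {a' b' c' : ℝ}
    (hV : {i, j, k} ∈ 𝒞) (hij : i ≠ j) (hik : i ≠ k) (hjk : j ≠ k)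
    (hV' : {i', j', k'} ∈ 𝒞) (hij' : i' ≠ j') (hik' : i' ≠ k') (hjk' : j' ≠ k')
    (ha : 0 ≤ a) (hb : 0 ≤ b) (hc : 0 ≤ c) (habc : a + b + c = 1)
    (ha' : 0 ≤ a') (hb' : 0 ≤ b') (hc' : 0 ≤ c') (habc' : a' + b' + c' = 1)
    (heq : a • P i + b • P j + c • P k = a' • P i' + b' • P j' + c' • P k') :
    tripleWeight i j k a b c = tripleWeight i' j' k' a' b' c' :=
  h.unique _ hV _ hV' _ _ (isWeight_tripleWeight hij hik hjk ha hb hc habc)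
    (isWeight_tripleWeight hij' hik' hjk' ha' hb' hc' habc')
    (by rw [sum_tripleWeight_smul hij hik hjk, sum_tripleWeight_smul hij' hik' hjk', heq])

/-- There are no affine relations between the vertices of a triangle. -/
theorem eq_zero_of_relation (h : IsComplex Ω 𝒞 P) [DecidableEq ι] (hV : {i, j, k} ∈ 𝒞) (hij : i ≠ j)
    (hik : i ≠ k)
    (hjk : j ≠ k) (habc : a + b + c = 0) (hrel : a • P i + b • P j + c • P k = 0) :
    a = 0 ∧ b = 0 ∧ c = 0 := by
  -- The barycentre perturbed by `η` times the relation is the same point. This `η` is small enough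
  -- to keep the perturbed weights nonnegative, so uniqueness applies.
  set η : ℝ := 1 / (3 * (1 + |a| + |b| + |c|)) with hη
  have hpos : 0 < 1 + |a| + |b| + |c| := by positivity
  have hη0 : 0 < η := by positivity
  have key : ∀ x : ℝ, |x| ≤ 1 + |a| + |b| + |c| → 0 ≤ 1 / 3 + η * x := by
    intro x hx
    have h1 : η * (1 + |a| + |b| + |c|) = 1 / 3 := by rw [hη]; field_simp
    have h2 : η * (-x) ≤ η * (1 + |a| + |b| + |c|) :=
      mul_le_mul_of_nonneg_left ((neg_le_abs x).trans hx) hη0.le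
    linarith
  have hw := h.tripleWeight_eq hV hij hik hjk hV hij hik hjk
    (a := 1 / 3) (b := 1 / 3) (c := 1 / 3)
    (a' := 1 / 3 + η * a) (b' := 1 / 3 + η * b) (c' := 1 / 3 + η * c)
    (by norm_num) (by norm_num) (by norm_num) (by norm_num)
    (key a (by linarith [abs_nonneg b, abs_nonneg c]))
    (key b (by linarith [abs_nonneg a, abs_nonneg c]))
    (key c (by linarith [abs_nonneg a, abs_nonneg b])) (by linear_combination η * habc)
    (by
      have : η • (a • P i + b • P j + c • P k) = 0 := by rw [hrel, smul_zero]
      simp only [smul_add, smul_smul] at this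
      simp only [add_smul]
      rw [← sub_eq_zero, ← neg_eq_zero, ← this]
      abel)
  have e1 := congrFun hw i
  have e2 := congrFun hw j
  have e3 := congrFun hw k
  simp only [tripleWeight_fst] at e1
  simp only [tripleWeight_snd hij] at e2
  simp only [tripleWeight_trd hik hjk] at e3
  have z : ∀ x, 1 / 3 = 1 / 3 + η * x → x = 0 := fun x hx => by
    have : η * x = 0 := by linarith
    exact (mul_eq_zero.mp this).resolve_left hη0.ne'
  exact ⟨z a e1, z b e2, z c e3⟩

theorem area_ne_zero (h : IsComplex Ω 𝒞 P) [DecidableEq ι] (hV : {i, j, k} ∈ 𝒞) (hij : i ≠ j)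
    (hik : i ≠ k) (hjk : j ≠ k) : area (P i) (P j) (P k) ≠ 0 :=
  area_ne_zero_of_relation fun _ _ _ habc hrel =>
    h.eq_zero_of_relation hV hij hik hjk habc hrel

theorem exists_triple (h : IsComplex Ω 𝒞 P) [DecidableEq ι] {V : Finset ι} (hV : V ∈ 𝒞) :
    ∃ i j k, i ≠ j ∧ i ≠ k ∧ j ≠ k ∧ V = {i, j, k} := Finset.card_eq_three.mp (h.card_eq V hV)

theorem exists_triple_of_mem (h : IsComplex Ω 𝒞 P) [DecidableEq ι] {V : Finset ι} (hV : V ∈ 𝒞)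
    {i j : ι} (hi : i ∈ V)
    (hj : j ∈ V) (hij : i ≠ j) : ∃ k, i ≠ k ∧ j ≠ k ∧ V = {i, j, k} := by
  have h3 := h.card_eq V hV
  have hsub : ({i, j} : Finset ι) ⊆ V := by
    intro l hl
    rcases Finset.mem_insert.mp hl with rfl | hl
    · exact hi
    · rw [Finset.mem_singleton.mp hl]; exact hj
  have hc : (V \ {i, j}).card = 1 := by
    rw [Finset.card_sdiff_of_subset hsub, h3, Finset.card_pair hij]
  obtain ⟨k, hk⟩ := Finset.card_eq_one.mp hc
  have hkm : k ∈ V \ {i, j} := by rw [hk]; simp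
  simp only [Finset.mem_sdiff, Finset.mem_insert, Finset.mem_singleton, not_or] at hkm
  refine ⟨k, fun e => hkm.2.1 e.symm, fun e => hkm.2.2 e.symm, ?_⟩
  rw [← Finset.sdiff_union_of_subset hsub, hk]
  ext l; simp only [Finset.mem_union, Finset.mem_insert, Finset.mem_singleton]; tauto

theorem convexHull_image_nonempty_interior (h : IsComplex Ω 𝒞 P) {V : Finset ι} (hV : V ∈ 𝒞) :
    (interior (convexHull ℝ (P '' V))).Nonempty := by
  classical
  obtain ⟨i, j, k, hij, hik, hjk, rfl⟩ := h.exists_triple hV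
  have := interior_convexHull_triple_nonempty (h.area_ne_zero hV hij hik hjk)
  simpa [image_insert_eq] using this

theorem closure_interior_convexHull (h : IsComplex Ω 𝒞 P) {V : Finset ι} (hV : V ∈ 𝒞) :
    closure (interior (convexHull ℝ (P '' V))) = convexHull ℝ (P '' V) := by
  rw [(convex_convexHull ℝ _).closure_interior_eq_closure_of_nonempty_interior
    (h.convexHull_image_nonempty_interior hV)]
  exact ((V.finite_toSet.image P).isClosed_convexHull (𝕜 := ℝ)).closure_eq

/-- The Dirac weights at two labels with the same position represent the same point, so uniqueness
of the weights identifies them. -/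
theorem injOn (h : IsComplex Ω 𝒞 P) {V V' : Finset ι} (hV : V ∈ 𝒞) (hV' : V' ∈ 𝒞) {i j : ι}
    (hi : i ∈ V) (hj : j ∈ V')
    (hP : P i = P j) : i = j := by
  classical
  have w : ∀ {W : Finset ι} {l : ι}, l ∈ W → IsWeight W (Pi.single l 1) := by
    intro W l hl
    refine ⟨fun m => ?_, fun m hm => Pi.single_eq_of_ne (by rintro rfl; exact hm hl) _, ?_⟩
    · by_cases e : m = l
      · subst e; simp
      · simp [e]
    · simp [Finset.sum_pi_single', hl]
  have s : ∀ {W : Finset ι} {l : ι}, l ∈ W →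
      ∑ m ∈ W, (Pi.single l 1 : ι → ℝ) m • P m = P l := by
    intro W l hl
    rw [Finset.sum_eq_single_of_mem l hl]
    · simp
    · intro m _ hm; simp [hm]
  have := congrFun (h.unique V hV V' hV' _ _ (w hi) (w hj) (by rw [s hi, s hj, hP])) i
  by_contra hne
  simp [hne] at this

/-- The coordinates of a point of an open edge. -/
theorem weight_of_mem_openSegment (h : IsComplex Ω 𝒞 P) {V V' : Finset ι} (hV : V ∈ 𝒞)
    (hV' : V' ∈ 𝒞) {i j : ι}
    (hi : i ∈ V) (hj : j ∈ V) (hij : i ≠ j) {x : E2} (hx : x ∈ openSegment ℝ (P i) (P j))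
    {c : ι → ℝ} (hc : IsWeight V' c) (hcx : ∑ l ∈ V', c l • P l = x) :
    ∀ l, c l ≠ 0 ↔ l = i ∨ l = j := by
  classical
  obtain ⟨k, hik, hjk, rfl⟩ := h.exists_triple_of_mem hV hi hj hij
  obtain ⟨s, t, hs, ht, hst, rfl⟩ := hx
  have hw := h.unique _ hV _ hV' _ c (isWeight_tripleWeight hij hik hjk hs.le ht.le le_rfl
    (by rw [add_zero, hst])) hc (by
      rw [sum_tripleWeight_smul hij hik hjk, hcx, zero_smul, add_zero])
  intro l
  rw [← hw]
  unfold tripleWeight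
  split_ifs with h1 h2 h3 <;> simp_all [hs.ne', ht.ne']

/-- The weights of such a point are non-zero exactly at the two ends, whichever triangle is used to
compute them. -/
theorem mem_of_mem_openSegment (h : IsComplex Ω 𝒞 P) {V V' : Finset ι} (hV : V ∈ 𝒞) (hV' : V' ∈ 𝒞)
    {i j : ι}
    (hi : i ∈ V) (hj : j ∈ V) (hij : i ≠ j) {x : E2} (hx : x ∈ openSegment ℝ (P i) (P j))
    (hxV' : x ∈ convexHull ℝ (P '' V')) : i ∈ V' ∧ j ∈ V' := by
  obtain ⟨c, hc, hcx⟩ := mem_convexHull_image_iff.mp hxV'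
  have := h.weight_of_mem_openSegment hV hV' hi hj hij hx hc hcx
  constructor
  · by_contra hn
    exact (this i).mpr (Or.inl rfl) (hc.eq_zero i hn)
  · by_contra hn
    exact (this j).mpr (Or.inr rfl) (hc.eq_zero j hn)

/-- Different edges have disjoint relative interiors. -/
theorem openSegment_eq_of_mem (h : IsComplex Ω 𝒞 P) {V V' : Finset ι} (hV : V ∈ 𝒞) (hV' : V' ∈ 𝒞)
    {i j i' j' : ι}
    (hi : i ∈ V) (hj : j ∈ V) (hij : i ≠ j) (hi' : i' ∈ V') (hj' : j' ∈ V') (hij' : i' ≠ j')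
    {x : E2} (hx : x ∈ openSegment ℝ (P i) (P j)) (hx' : x ∈ openSegment ℝ (P i') (P j')) :
    s(i, j) = s(i', j') := by
  have hsub : openSegment ℝ (P i') (P j') ⊆ convexHull ℝ (P '' V') :=
    (openSegment_subset_segment ℝ _ _).trans (segment_subset_convexHull
      (mem_image_of_mem _ hi') (mem_image_of_mem _ hj'))
  obtain ⟨c, hc, hcx⟩ := mem_convexHull_image_iff.mp (hsub hx')
  have h1 := h.weight_of_mem_openSegment hV hV' hi hj hij hx hc hcx
  have h2 := h.weight_of_mem_openSegment hV' hV' hi' hj' hij' hx' hc hcx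
  have e1 := (h2 i).mp ((h1 i).mpr (Or.inl rfl))
  have e2 := (h2 j).mp ((h1 j).mpr (Or.inr rfl))
  rw [Sym2.eq_iff]
  rcases e1 with rfl | rfl <;> rcases e2 with rfl | rfl <;> simp_all

/-- The relative interior of an edge that belongs to two triangles is inside `Ω`. -/
theorem openSegment_subset (h : IsComplex Ω 𝒞 P) {V V' : Finset ι} (hV : V ∈ 𝒞) (hV' : V' ∈ 𝒞)
    (hne : V ≠ V') {i j : ι}
    (hi : i ∈ V) (hj : j ∈ V) (hi' : i ∈ V') (hj' : j ∈ V') (hij : i ≠ j) :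
    openSegment ℝ (P i) (P j) ⊆ Ω := by
  classical
  intro x hx
  obtain ⟨k, hik, hjk, rfl⟩ := h.exists_triple_of_mem hV hi hj hij
  obtain ⟨k', hik', hjk', rfl⟩ := h.exists_triple_of_mem hV' hi' hj' hij
  have hkk : k ≠ k' := by rintro rfl; exact hne rfl
  have hA := h.area_ne_zero hV hij hik hjk
  have hA' := h.area_ne_zero hV' hij hik' hjk'
  have hkV' : k ∉ ({i, j, k'} : Finset ι) := by simp [hik.symm, hjk.symm, hkk]
  obtain ⟨s, t, hs, ht, hst, hx⟩ := hx
  have hx0 : s • P i + t • P j + (0 : ℝ) • P k = x := by rw [zero_smul, add_zero, hx]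
  have hx0' : s • P i + t • P j + (0 : ℝ) • P k' = x := by rw [zero_smul, add_zero, hx]
  have hb := bary_combination_all hA (a := s) (b := t) (c := 0) (by rw [add_zero, hst])
  have hb' := bary_combination_all hA' (a := s) (b := t) (c := 0) (by rw [add_zero, hst])
  rw [hx0] at hb
  rw [hx0'] at hb'
  have ev : ∀ᶠ y in 𝓝 x, 0 < bary (P i) (P j) (P k) y ∧ 0 < bary (P j) (P k) (P i) y ∧
      0 < bary (P i) (P j) (P k') y ∧ 0 < bary (P j) (P k') (P i) y := by
    refine ((continuous_bary _ _ _).continuousAt.eventually_const_lt (by rw [hb.1]; exact hs)).and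
      (((continuous_bary _ _ _).continuousAt.eventually_const_lt (by rw [hb.2.1]; exact ht)).and
      (((continuous_bary _ _ _).continuousAt.eventually_const_lt (by rw [hb'.1]; exact hs)).and
      ((continuous_bary _ _ _).continuousAt.eventually_const_lt (by rw [hb'.2.1]; exact ht))))
  -- Up to the factor of the area, the coordinates opposite to the common edge are one function: the
  -- signed area of `y` and the edge.
  have hrel : ∀ y, bary (P k') (P i) (P j) y * area (P i) (P j) (P k') =
      bary (P k) (P i) (P j) y * area (P i) (P j) (P k) := by
    intro y
    have h1 : area (P k) (P i) (P j) = area (P i) (P j) (P k) := by rw [area_rotate, area_rotate]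
    have h2 : area (P k') (P i) (P j) = area (P i) (P j) (P k') := by rw [area_rotate, area_rotate]
    unfold bary
    rw [h1, h2, div_mul_cancel₀ _ hA, div_mul_cancel₀ _ hA']
  -- The triangles lie on opposite sides of the edge. Otherwise a point slightly moved from `x`
  -- towards `P k` belongs to both, with weight `r > 0` at `k` in the first and weight zero in the
  -- second, where `k` is not a label.
  have hopp : area (P i) (P j) (P k) * area (P i) (P j) (P k') < 0 := by
    by_contra hge
    have hpos : 0 < area (P i) (P j) (P k) * area (P i) (P j) (P k') :=
      lt_of_le_of_ne (not_lt.mp hge) (mul_ne_zero hA hA').symm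
    have htend : Tendsto (fun r : ℝ => x + r • (P k - x)) (𝓝[>] 0) (𝓝 x) := by
      have : Continuous fun r : ℝ => x + r • (P k - x) := by fun_prop
      have h0 := this.tendsto 0
      simp only [zero_smul, add_zero] at h0
      exact h0.mono_left nhdsWithin_le_nhds
    have h1 : ∀ᶠ r : ℝ in 𝓝[>] 0, r < 1 := nhdsWithin_le_nhds (gt_mem_nhds one_pos)
    obtain ⟨r, ⟨hr, hr0⟩, hr1⟩ :=
      (((htend.eventually ev).and self_mem_nhdsWithin).and h1).exists
    have hr0 : 0 < r := hr0
    set y := x + r • (P k - x) with hy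
    have hy' : ((1 - r) * s) • P i + ((1 - r) * t) • P j + r • P k = y := by
      rw [hy, ← hx]; module
    have hs1 : (1 - r) * s + (1 - r) * t + r = 1 := by
      rw [← mul_add, hst]; ring
    have hby := (bary_combination_all hA hs1).2.2
    rw [hy'] at hby
    have hby' : 0 ≤ bary (P k') (P i) (P j) y := by
      have e := hrel y
      rw [hby] at e
      have : bary (P k') (P i) (P j) y = r * (area (P i) (P j) (P k) * area (P i) (P j) (P k')) /
          (area (P i) (P j) (P k')) ^ 2 := by
        rw [eq_div_iff (pow_ne_zero 2 hA')]
        linear_combination area (P i) (P j) (P k') * e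
      rw [this]
      positivity
    have hw := h.tripleWeight_eq hV hij hik hjk hV' hij hik' hjk'
      (mul_nonneg (by linarith) hs.le) (mul_nonneg (by linarith) ht.le) hr0.le hs1
      hr.2.2.1.le hr.2.2.2.le hby' (bary_sum hA' y) (by rw [hy', bary_smul_sum hA'])
    have := congrFun hw k
    rw [tripleWeight_trd hik hjk, (isWeight_tripleWeight hij hik' hjk' hr.2.2.1.le hr.2.2.2.le hby'
      (bary_sum hA' y)).eq_zero k hkV'] at this
    exact hr0.ne' this
  -- Near `x`, the side of the edge decides which of the two triangles contains `y`; together they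
  -- fill a neighbourhood of `x` inside `closure Ω`.
  rw [← h.interior_closure, mem_interior_iff_mem_nhds]
  filter_upwards [ev] with y hy
  by_cases hk0 : 0 ≤ bary (P k) (P i) (P j) y
  · refine h.convexHull_subset hV ?_
    simp only [Finset.coe_insert, Finset.coe_singleton, image_insert_eq, image_singleton]
    exact (mem_convexHull_iff_bary hA).mpr ⟨hy.1.le, hy.2.1.le, hk0⟩
  · refine h.convexHull_subset hV' ?_
    simp only [Finset.coe_insert, Finset.coe_singleton, image_insert_eq, image_singleton]
    refine (mem_convexHull_iff_bary hA').mpr ⟨hy.2.2.1.le, hy.2.2.2.le, ?_⟩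
    have e := hrel y
    have hk0 := not_le.mp hk0
    have : bary (P k') (P i) (P j) y = bary (P k) (P i) (P j) y *
        (area (P i) (P j) (P k) * area (P i) (P j) (P k')) / (area (P i) (P j) (P k')) ^ 2 := by
      rw [eq_div_iff (pow_ne_zero 2 hA')]
      linear_combination area (P i) (P j) (P k') * e
    rw [this]
    exact div_nonneg (mul_nonneg_of_nonpos_of_nonpos hk0.le hopp.le) (sq_nonneg _)

/-- A point of the boundary that is not a vertex is inside an edge of exactly one triangle. -/
theorem exists_unique_of_mem_frontier (h : IsComplex Ω 𝒞 P) {x : E2} (hx : x ∈ frontier Ω)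
    (hxP : ∀ V ∈ 𝒞, x ∉ P '' V) :
    ∃ V ∈ 𝒞, (∃ i ∈ V, ∃ j ∈ V, i ≠ j ∧ x ∈ openSegment ℝ (P i) (P j)) ∧
      ∀ V' ∈ 𝒞, x ∈ convexHull ℝ (P '' V') → V' = V := by
  classical
  have hxc : x ∈ closure Ω := frontier_subset_closure hx
  have hΩ : IsOpen Ω := by rw [← h.interior_closure]; exact isOpen_interior
  have hxn : x ∉ Ω := by
    rw [hΩ.frontier_eq] at hx
    exact hx.2
  rw [h.cover] at hxc
  simp only [mem_iUnion] at hxc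
  obtain ⟨V, hV, hxV⟩ := hxc
  have hedge : ∃ i ∈ V, ∃ j ∈ V, i ≠ j ∧ x ∈ openSegment ℝ (P i) (P j) := by
    have hxi : x ∉ interior (convexHull ℝ (P '' V)) := fun hi =>
      hxn (h.interior_convexHull_subset hV hi)
    have hxv := hxP V hV
    obtain ⟨i, j, k, hij, hik, hjk, rfl⟩ := h.exists_triple hV
    have hA := h.area_ne_zero hV hij hik hjk
    simp only [Finset.coe_insert, Finset.coe_singleton, image_insert_eq, image_singleton]
      at hxV hxi hxv
    rw [mem_convexHull_triple] at hxV
    obtain ⟨a, b, c, ha, hb, hc, habc, rfl⟩ := hxV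
    rw [mem_interior_convexHull_iff_bary hA] at hxi
    obtain ⟨e1, e2, e3⟩ := bary_combination_all hA habc
    rw [e1, e2, e3] at hxi
    have seg : ∀ {p q : E2} {s t : ℝ}, 0 ≤ s → 0 ≤ t → s + t = 1 → s • p + t • q ≠ p →
        s • p + t • q ≠ q → s • p + t • q ∈ openSegment ℝ p q := by
      intro p q s t hs ht hst hp hq
      refine ⟨s, t, lt_of_le_of_ne hs ?_, lt_of_le_of_ne ht ?_, hst, rfl⟩
      · rintro rfl
        apply hq
        rw [zero_add] at hst
        simp [hst]
      · rintro rfl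
        apply hp
        rw [add_zero] at hst
        simp [hst]
    simp only [mem_insert_iff, mem_singleton_iff, not_or] at hxv
    rcases ha.eq_or_lt with rfl | ha'
    · refine ⟨j, by simp, k, by simp, hjk, ?_⟩
      simp only [zero_smul, zero_add] at hxv habc ⊢
      exact seg hb hc habc hxv.2.1 hxv.2.2
    rcases hb.eq_or_lt with rfl | hb'
    · refine ⟨i, by simp, k, by simp, hik, ?_⟩
      simp only [zero_smul, add_zero] at hxv habc ⊢
      exact seg ha hc habc hxv.1 hxv.2.2
    rcases hc.eq_or_lt with rfl | hc'
    · refine ⟨i, by simp, j, by simp, hij, ?_⟩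
      simp only [zero_smul, add_zero] at hxv habc ⊢
      exact seg ha hb habc hxv.1 hxv.2.1
    exact absurd ⟨ha', hb', hc'⟩ hxi
  refine ⟨V, hV, hedge, fun V' hV' hxV' => ?_⟩
  obtain ⟨i, hi, j, hj, hij, hx'⟩ := hedge
  obtain ⟨hi', hj'⟩ := h.mem_of_mem_openSegment hV hV' hi hj hij hx' hxV'
  -- A second triangle containing `x` would share the whole edge, which would put `x` inside `Ω`.
  by_contra hne
  exact hxn (h.openSegment_subset hV' hV hne hi' hj' hi hj hij hx')

/-- The other triangles form a closed set that misses `x`. This reduces a limit from inside `Ω` to a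
limit from inside one triangle, which is how traces are computed. -/
theorem nhdsWithin_eq_of_unique (h : IsComplex Ω 𝒞 P) {V : Finset ι} (hV : V ∈ 𝒞) {x : E2}
    (hx : ∀ V' ∈ 𝒞, x ∈ convexHull ℝ (P '' V') → V' = V) :
    𝓝[Ω] x = 𝓝[interior (convexHull ℝ (P '' V))] x := by
  classical
  set K : Set E2 := ⋃ V' ∈ 𝒞.erase V, convexHull ℝ (P '' V') with hK
  have hKc : IsClosed K := by
    refine (𝒞.erase V).finite_toSet.isClosed_biUnion fun V' _ => ?_
    exact (V'.finite_toSet.image P).isClosed_convexHull (𝕜 := ℝ)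
  have hxK : x ∉ K := by
    simp only [hK, mem_iUnion, not_exists]
    intro V' hV' hxV'
    exact (Finset.mem_erase.mp hV').1 (hx V' (Finset.mem_erase.mp hV').2 hxV')
  have hU : Kᶜ ∈ 𝓝 x := hKc.isOpen_compl.mem_nhds hxK
  have heq : Ω ∩ Kᶜ = interior (convexHull ℝ (P '' V)) ∩ Kᶜ := by
    have hsub : closure Ω ∩ Kᶜ ⊆ convexHull ℝ (P '' V) := by
      rintro y ⟨hy, hyK⟩
      rw [h.cover] at hy
      simp only [mem_iUnion] at hy
      obtain ⟨V', hV', hyV'⟩ := hy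
      by_cases e : V' = V
      · rwa [← e]
      · refine absurd ?_ hyK
        simp only [hK, mem_iUnion]
        exact ⟨V', Finset.mem_erase.mpr ⟨e, hV'⟩, hyV'⟩
    have hΩ : IsOpen Ω := by rw [← h.interior_closure]; exact isOpen_interior
    refine Subset.antisymm (fun y hy => ⟨?_, hy.2⟩)
      (inter_subset_inter_left _ (h.interior_convexHull_subset hV))
    refine mem_interior.mpr ⟨Ω ∩ Kᶜ, ?_, hΩ.inter hKc.isOpen_compl, hy⟩
    exact (inter_subset_inter_left _ subset_closure).trans hsub
  rw [nhdsWithin_eq_nhdsWithin' hU heq]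

end IsComplex

end Complex

end

end CrackFE

namespace CrackFE

noncomputable section

/-! ### Adaptive triangulations as labelled triangulations -/

/-- The vertex with the label `l` of an adaptive triangulation with the knots `z`: the label
`s(x, x)`
stands for the vertex `x`, and `s(x, y)` with `x ≠ y` for the knot on the edge `[x, y]`. -/
def pos (z : Sym2 E2 → E2) (l : Sym2 E2) : E2 :=
  -- `midpoint` serves only as a symmetric function of two points whose value at `(x, x)` is `x`.
  open Classical in if l.IsDiag then l.lift ⟨fun x y => midpoint ℝ x y, midpoint_comm⟩ else z l

theorem pos_diag (z : Sym2 E2 → E2) (x : E2) : pos z s(x, x) = x := by simp [pos]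

theorem pos_of_ne (z : Sym2 E2 → E2) {x y : E2} (h : x ≠ y) : pos z s(x, y) = z s(x, y) := by
  simp [pos, h]

open Classical in
/-- The labels of the vertices of the small triangle at the vertex `x` of `τ`. -/
def corner (τ : Finset E2) (x : E2) : Finset (Sym2 E2) := τ.image fun v => s(x, v)

open Classical in
/-- The labels of the knots on the edges of `τ`. -/
def knots (τ : Finset E2) : Finset (Sym2 E2) := τ.offDiag.image fun v => s(v.1, v.2)

variable {Ω : Set E2} {c₁ c₂ ε : ℝ}

open Classical in
/-- The labelled triangles of the adaptive triangulations nested in `R`. -/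
def RegularTriangulation.cells (R : RegularTriangulation Ω c₁ c₂ ε) : Finset (Finset (Sym2 E2)) :=
  R.tris.biUnion fun τ => insert (knots τ) (τ.image (corner τ))

theorem RegularTriangulation.mem_cells {R : RegularTriangulation Ω c₁ c₂ ε}
    {V : Finset (Sym2 E2)} :
    V ∈ R.cells ↔ ∃ τ ∈ R.tris, V = knots τ ∨ ∃ x ∈ τ, V = corner τ x := by
  simp [RegularTriangulation.cells, eq_comm]

theorem mem_corner {τ : Finset E2} {x : E2} {l : Sym2 E2} :
    l ∈ corner τ x ↔ ∃ v ∈ τ, l = s(x, v) := by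
  simp [corner, eq_comm]

theorem mem_knots {τ : Finset E2} {l : Sym2 E2} :
    l ∈ knots τ ↔ ∃ u ∈ τ, ∃ v ∈ τ, u ≠ v ∧ l = s(u, v) := by
  simp only [knots, Finset.mem_image, Finset.mem_offDiag, Prod.exists]
  constructor
  · rintro ⟨u, v, ⟨hu, hv, huv⟩, rfl⟩; exact ⟨u, hu, v, hv, huv, rfl⟩
  · rintro ⟨u, hu, v, hv, huv, rfl⟩; exact ⟨u, v, ⟨hu, hv, huv⟩, rfl⟩

section Triple

variable {x y w : E2}

open Classical in
theorem corner_triple : corner {x, y, w} x = {s(x, x), s(x, y), s(x, w)} := by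
  simp [corner, Finset.image_insert]

open Classical in
theorem knots_triple (hxy : x ≠ y) (hxw : x ≠ w) (hyw : y ≠ w) :
    knots {x, y, w} = {s(x, y), s(x, w), s(y, w)} := by
  ext l
  simp only [mem_knots, Finset.mem_insert, Finset.mem_singleton]
  constructor
  · rintro ⟨u, hu, v, hv, huv, rfl⟩
    rcases hu with rfl | rfl | rfl <;> rcases hv with rfl | rfl | rfl <;>
      first | exact absurd rfl huv | simp [Sym2.eq_swap]
  · rintro (rfl | rfl | rfl)
    · exact ⟨x, by simp, y, by simp, hxy, rfl⟩
    · exact ⟨x, by simp, w, by simp, hxw, rfl⟩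
    · exact ⟨y, by simp, w, by simp, hyw, rfl⟩

open Classical in
theorem sum_sym2_triple {M : Type*} [AddCommMonoid M] (hxy : x ≠ y) (hxw : x ≠ w) (hyw : y ≠ w)
    (f : Sym2 E2 → M) : ∑ l ∈ ({x, y, w} : Finset E2).sym2, f l =
      f s(x, x) + f s(y, y) + f s(w, w) + f s(x, y) + f s(x, w) + f s(y, w) := by
  have : ({x, y, w} : Finset E2).sym2 =
      {s(x, x), s(y, y), s(w, w), s(x, y), s(x, w), s(y, w)} := by
    ext l
    induction l with
    | _ u v =>
      simp only [Finset.mk_mem_sym2_iff, Finset.mem_insert, Finset.mem_singleton, Sym2.eq_iff]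
      constructor
      · rintro ⟨rfl | rfl | rfl, rfl | rfl | rfl⟩ <;> simp
      · rintro (⟨rfl, rfl⟩ | ⟨rfl, rfl⟩) <;> tauto
  rw [this, Finset.sum_insert, Finset.sum_insert, Finset.sum_insert, Finset.sum_insert,
    Finset.sum_insert, Finset.sum_singleton]
  · simp only [add_assoc]
  all_goals simp [hxy, hxw, hyw, hxy.symm, hxw.symm, hyw.symm]

end Triple

theorem knots_subset_sym2 (τ : Finset E2) : knots τ ⊆ τ.sym2 := by
  intro l hl
  obtain ⟨u, hu, v, hv, -, rfl⟩ := mem_knots.mp hl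
  simp [hu, hv]

theorem corner_subset_sym2 {τ : Finset E2} {x : E2} (hx : x ∈ τ) : corner τ x ⊆ τ.sym2 := by
  intro l hl
  obtain ⟨v, hv, rfl⟩ := mem_corner.mp hl
  simp [hx, hv]

/-! ### Coordinates with respect to the four parts of a divided triangle. -/

/-- The coefficients of a convex combination of the vertices of one of the four parts of a triangle
`x y w`. -/
def IsSubWeight (cx cy cw cxy cxw cyw : ℝ) : Prop :=
  (0 ≤ cx ∧ 0 ≤ cy ∧ 0 ≤ cw ∧ 0 ≤ cxy ∧ 0 ≤ cxw ∧ 0 ≤ cyw) ∧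
    cx + cy + cw + cxy + cxw + cyw = 1 ∧
    ((cx = 0 ∧ cy = 0 ∧ cw = 0) ∨ (cy = 0 ∧ cw = 0 ∧ cyw = 0) ∨ (cx = 0 ∧ cw = 0 ∧ cxw = 0) ∨
      (cx = 0 ∧ cy = 0 ∧ cxy = 0))

/-- Here `L` and `M` are the barycentric coordinates of the point at `y` and `w` in the big
triangle. In the corner at `x` the weight of `x` is `1 - L / α - M / β`; in the other three parts it
is zero and this expression is not positive. So the weight depends on the point alone, whichever
part is used. -/
theorem IsSubWeight.fst_eq {α β γ cx cy cw cxy cxw cyw L M : ℝ}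
    (h : IsSubWeight cx cy cw cxy cxw cyw) (hα : α ∈ Ioo (0 : ℝ) 1) (hβ : β ∈ Ioo (0 : ℝ) 1)
    (hγ : γ ∈ Ioo (0 : ℝ) 1) (hL : cy + α * cxy + (1 - γ) * cyw = L)
    (hM : cw + β * cxw + γ * cyw = M) : cx = max 0 (1 - L / α - M / β) := by
  obtain ⟨hα0, hα1⟩ := hα
  obtain ⟨hβ0, hβ1⟩ := hβ
  obtain ⟨hγ0, hγ1⟩ := hγ
  obtain ⟨⟨h1, h2, h3, h4, h5, h6⟩, hs, hc⟩ := h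
  have hL' : L / α = cy / α + cxy + (1 - γ) * (cyw / α) := by rw [← hL]; field_simp
  have hM' : M / β = cw / β + cxw + γ * (cyw / β) := by rw [← hM]; field_simp
  have k1 : cy ≤ cy / α := le_div_self h2 hα0 hα1.le
  have k2 : cw ≤ cw / β := le_div_self h3 hβ0 hβ1.le
  have k3 : cyw ≤ cyw / α := le_div_self h6 hα0 hα1.le
  have k4 : cyw ≤ cyw / β := le_div_self h6 hβ0 hβ1.le
  have k5 := mul_le_mul_of_nonneg_left k3 (by linarith : 0 ≤ 1 - γ)
  have k6 := mul_le_mul_of_nonneg_left k4 hγ0.le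
  rw [hL', hM']
  by_cases hx : cx = 0
  · subst hx
    rw [max_eq_left]
    linarith
  · rcases hc with ⟨e, -⟩ | ⟨rfl, rfl, rfl⟩ | ⟨e, -⟩ | ⟨e, -⟩
    · exact absurd e hx
    · rw [max_eq_right] <;> simp <;> linarith
    · exact absurd e hx
    · exact absurd e hx

theorem IsSubWeight.swap {cx cy cw cxy cxw cyw : ℝ} (h : IsSubWeight cx cy cw cxy cxw cyw) :
    IsSubWeight cy cx cw cxy cyw cxw := by
  obtain ⟨⟨h1, h2, h3, h4, h5, h6⟩, hs, hc⟩ := h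
  refine ⟨⟨h2, h1, h3, h4, h6, h5⟩, by linarith, ?_⟩
  rcases hc with ⟨e, f, g⟩ | ⟨e, f, g⟩ | ⟨e, f, g⟩ | ⟨e, f, g⟩
  · exact Or.inl ⟨f, e, g⟩
  · exact Or.inr (Or.inr (Or.inl ⟨e, f, g⟩))
  · exact Or.inr (Or.inl ⟨e, f, g⟩)
  · exact Or.inr (Or.inr (Or.inr ⟨f, e, g⟩))

theorem IsSubWeight.rotate {cx cy cw cxy cxw cyw : ℝ} (h : IsSubWeight cx cy cw cxy cxw cyw) :
    IsSubWeight cw cx cy cxw cyw cxy := by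
  obtain ⟨⟨h1, h2, h3, h4, h5, h6⟩, hs, hc⟩ := h
  refine ⟨⟨h3, h1, h2, h5, h6, h4⟩, by linarith, ?_⟩
  rcases hc with ⟨e, f, g⟩ | ⟨e, f, g⟩ | ⟨e, f, g⟩ | ⟨e, f, g⟩
  · exact Or.inl ⟨g, e, f⟩
  · exact Or.inr (Or.inr (Or.inl ⟨f, e, g⟩))
  · exact Or.inr (Or.inr (Or.inr ⟨f, e, g⟩))
  · exact Or.inr (Or.inl ⟨e, f, g⟩)

/-- The weights of the three vertices are determined by `fst_eq` and its images under the symmetries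
of the triangle; those of the knots then solve a linear system. -/
theorem IsSubWeight.unique {α β γ cx cy cw cxy cxw cyw dx dy dw dxy dxw dyw : ℝ}
    (h : IsSubWeight cx cy cw cxy cxw cyw) (h' : IsSubWeight dx dy dw dxy dxw dyw)
    (hα : α ∈ Ioo (0 : ℝ) 1) (hβ : β ∈ Ioo (0 : ℝ) 1) (hγ : γ ∈ Ioo (0 : ℝ) 1)
    (h1 : cx + (1 - α) * cxy + (1 - β) * cxw = dx + (1 - α) * dxy + (1 - β) * dxw)
    (h2 : cy + α * cxy + (1 - γ) * cyw = dy + α * dxy + (1 - γ) * dyw)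
    (h3 : cw + β * cxw + γ * cyw = dw + β * dxw + γ * dyw) :
    cx = dx ∧ cy = dy ∧ cw = dw ∧ cxy = dxy ∧ cxw = dxw ∧ cyw = dyw := by
  have compl : ∀ {t : ℝ}, t ∈ Ioo (0 : ℝ) 1 → 1 - t ∈ Ioo (0 : ℝ) 1 := fun {t} ht =>
    ⟨by linarith [ht.2], by linarith [ht.1]⟩
  have ex : cx = dx := by
    rw [h.fst_eq hα hβ hγ h2 h3, h'.fst_eq hα hβ hγ rfl rfl]
  have ey : cy = dy := by
    rw [h.swap.fst_eq (compl hα) hγ hβ h1 (M := dw + β * dxw + γ * dyw) (by linarith),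
      h'.swap.fst_eq (compl hα) hγ hβ rfl (M := dw + β * dxw + γ * dyw) (by linarith)]
  have ew : cw = dw := by
    rw [h.rotate.fst_eq (compl hβ) (compl hγ) hα
        (L := dx + (1 - α) * dxy + (1 - β) * dxw) (M := dy + α * dxy + (1 - γ) * dyw)
        (by linarith) (by linarith),
      h'.rotate.fst_eq (compl hβ) (compl hγ) hα
        (L := dx + (1 - α) * dxy + (1 - β) * dxw) (M := dy + α * dxy + (1 - γ) * dyw)
        (by linarith) (by linarith)]
  have hs : cxy + cxw + cyw = dxy + dxw + dyw := by
    have := h.2.1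
    have := h'.2.1
    linarith
  obtain ⟨hα0, hα1⟩ := hα
  obtain ⟨hβ0, hβ1⟩ := hβ
  obtain ⟨hγ0, hγ1⟩ := hγ
  subst ex ey ew
  -- Up to the sign, this is the determinant of the barycentric coordinates of the three knots, that
  -- is, the ratio of the area of their triangle to that of the big one.
  have hΔ : (1 - α) * β * (1 - γ) + α * (1 - β) * γ ≠ 0 := by
    have : 0 < (1 - α) * β * (1 - γ) := mul_pos (mul_pos (by linarith) hβ0) (by linarith)
    have : 0 < α * (1 - β) * γ := mul_pos (mul_pos hα0 (by linarith)) hγ0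
    linarith
  refine ⟨rfl, rfl, rfl, mul_left_cancel₀ hΔ ?_, mul_left_cancel₀ hΔ ?_, mul_left_cancel₀ hΔ ?_⟩
  · linear_combination (1 - γ) * h1 + (1 - β) * h2 - (1 - β) * (1 - γ) * hs
  · linear_combination γ * h1 + (1 - α) * h3 - (1 - α) * γ * hs
  · linear_combination β * h2 + α * h3 - α * β * hs

variable {R : RegularTriangulation Ω c₁ c₂ ε} {a : ℝ} {z : Sym2 E2 → E2}

open Classical in
theorem RegularTriangulation.area_ne_zero {x y w : E2} (hτ : {x, y, w} ∈ R.tris) (hxy : x ≠ y)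
    (hxw : x ≠ w) (hyw : y ≠ w) : area x y w ≠ 0 := by
  refine area_ne_zero_of_relation fun a b c habc hrel => ?_
  have hi := affineIndependent_iff.mp (R.indep _ hτ) Finset.univ
    (fun v => tripleWeight x y w a b c v)
  rw [Finset.sum_coe_sort _ (tripleWeight x y w a b c), sum_triple hxy hxw hyw,
    Finset.sum_coe_sort _ (fun v => tripleWeight x y w a b c v • v), sum_triple hxy hxw hyw,
    tripleWeight_fst, tripleWeight_snd hxy, tripleWeight_trd hxw hyw] at hi
  have hi := hi habc hrel
  refine ⟨?_, ?_, ?_⟩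
  · simpa [tripleWeight_fst] using hi ⟨x, by simp⟩ (Finset.mem_univ _)
  · simpa [tripleWeight_snd hxy] using hi ⟨y, by simp⟩ (Finset.mem_univ _)
  · simpa [tripleWeight_trd hxw hyw] using hi ⟨w, by simp⟩ (Finset.mem_univ _)

open Classical in
theorem RegularTriangulation.exists_vertices {τ : Finset E2} (hτ : τ ∈ R.tris) {x : E2}
    (hx : x ∈ τ) : ∃ y w, x ≠ y ∧ x ≠ w ∧ y ≠ w ∧ τ = {x, y, w} := by
  have h2 : (τ.erase x).card = 2 := by rw [Finset.card_erase_of_mem hx, R.card_eq τ hτ]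
  obtain ⟨y, w, hyw, he⟩ := Finset.card_eq_two.mp h2
  have hy : y ∈ τ.erase x := by simp [he]
  have hw : w ∈ τ.erase x := by simp [he]
  refine ⟨y, w, (Finset.ne_of_mem_erase hy).symm, (Finset.ne_of_mem_erase hw).symm, hyw, ?_⟩
  rw [← Finset.insert_erase hx, he]

theorem RegularTriangulation.IsKnotChoice.exists_param (hz : R.IsKnotChoice a z) (ha : 0 < a)
    {τ : Finset E2} (hτ : τ ∈ R.tris) {x y : E2} (hx : x ∈ τ) (hy : y ∈ τ) (hxy : x ≠ y) :
    ∃ α ∈ Ioo (0 : ℝ) 1, pos z s(x, y) = (1 - α) • x + α • y := by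
  obtain ⟨t, ht, h⟩ := hz τ hτ x hx y hy hxy
  refine ⟨1 - t, ⟨by linarith [ht.2], by linarith [ht.1]⟩, ?_⟩
  rw [pos_of_ne z hxy, h, sub_sub_cancel]

theorem isWeight_of_support {ι : Type*} {V V' : Finset ι} {c : ι → ℝ} (h : IsWeight V c)
    (h' : ∀ l, c l ≠ 0 → l ∈ V') : IsWeight V' c := by
  classical
  have hz : ∀ l ∉ V', c l = 0 := fun l hl => by
    by_contra hne
    exact hl (h' l hne)
  refine ⟨h.nonneg, hz, ?_⟩
  rw [← h.sum_eq]
  trans ∑ l ∈ V ∪ V', c l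
  · exact Finset.sum_subset Finset.subset_union_right fun l _ hl => hz l hl
  · exact (Finset.sum_subset Finset.subset_union_left fun l _ hl => h.eq_zero l hl).symm

theorem sum_smul_of_support {ι : Type*} {V V' : Finset ι} {c : ι → ℝ} (h : IsWeight V c)
    (h' : IsWeight V' c) (P : ι → E2) : ∑ l ∈ V, c l • P l = ∑ l ∈ V', c l • P l := by
  classical
  trans ∑ l ∈ V ∪ V', c l • P l
  · exact Finset.sum_subset Finset.subset_union_left fun l _ hl => by rw [h.eq_zero l hl, zero_smul]
  · exact (Finset.sum_subset Finset.subset_union_right fun l _ hl => by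
      rw [h'.eq_zero l hl, zero_smul]).symm

/-- The cells that belong to the triangle `τ`. -/
def IsCellOf (τ : Finset E2) (V : Finset (Sym2 E2)) : Prop := V = knots τ ∨ ∃ x ∈ τ, V = corner τ x

theorem IsCellOf.subset_sym2 {τ : Finset E2} {V : Finset (Sym2 E2)} (h : IsCellOf τ V) :
    V ⊆ τ.sym2 := by
  rcases h with rfl | ⟨x, hx, rfl⟩
  · exact knots_subset_sym2 τ
  · exact corner_subset_sym2 hx

open Classical in
/-- The barycentric coordinates in `τ` of a convex combination of vertices and knots. -/
theorem sum_smul_pos {x y w : E2} (hxy : x ≠ y) (hxw : x ≠ w) (hyw : y ≠ w) {α β γ : ℝ}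
    (hα : pos z s(x, y) = (1 - α) • x + α • y) (hβ : pos z s(x, w) = (1 - β) • x + β • w)
    (hγ : pos z s(y, w) = (1 - γ) • y + γ • w) (c : Sym2 E2 → ℝ) :
    ∑ l ∈ ({x, y, w} : Finset E2).sym2, c l • pos z l =
      (c s(x, x) + (1 - α) * c s(x, y) + (1 - β) * c s(x, w)) • x +
      (c s(y, y) + α * c s(x, y) + (1 - γ) * c s(y, w)) • y +
      (c s(w, w) + β * c s(x, w) + γ * c s(y, w)) • w := by
  rw [sum_sym2_triple hxy hxw hyw, pos_diag, pos_diag, pos_diag, hα, hβ, hγ]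
  module

open Classical in
theorem IsWeight.isSubWeight {x y w : E2} (hxy : x ≠ y) (hxw : x ≠ w) (hyw : y ≠ w)
    {V : Finset (Sym2 E2)} (hV : IsCellOf {x, y, w} V) {c : Sym2 E2 → ℝ} (hc : IsWeight V c) :
    IsSubWeight (c s(x, x)) (c s(y, y)) (c s(w, w)) (c s(x, y)) (c s(x, w)) (c s(y, w)) := by
  refine ⟨⟨hc.nonneg _, hc.nonneg _, hc.nonneg _, hc.nonneg _, hc.nonneg _, hc.nonneg _⟩, ?_, ?_⟩
  · rw [← sum_sym2_triple hxy hxw hyw]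
    exact (isWeight_of_support hc fun l hl => hV.subset_sym2 (by
      by_contra hn; exact hl (hc.eq_zero l hn))).sum_eq
  · have hz := hc.eq_zero
    rcases hV with rfl | ⟨v, hv, rfl⟩
    · left
      refine ⟨hz _ ?_, hz _ ?_, hz _ ?_⟩ <;>
        (rw [knots_triple hxy hxw hyw]; simp [hxy, hxw, hyw, hxy.symm, hxw.symm, hyw.symm])
    · right
      simp only [Finset.mem_insert, Finset.mem_singleton] at hv
      rcases hv with rfl | rfl | rfl
      · left
        refine ⟨hz _ ?_, hz _ ?_, hz _ ?_⟩ <;>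
          simp [corner, hyw, hxy.symm, hxw.symm, hyw.symm]
      · right; left
        refine ⟨hz _ ?_, hz _ ?_, hz _ ?_⟩ <;>
          simp [corner, hxy, hxw, hxw.symm, hyw.symm]
      · right; right
        refine ⟨hz _ ?_, hz _ ?_, hz _ ?_⟩ <;>
          simp [corner, hxy, hxw, hyw, hxy.symm]

/-- A point that is a convex combination of vertices of a cell and belongs to `τ` is a convex
combination of vertices of a cell of `τ`, with the same coefficients. -/
theorem RegularTriangulation.exists_cellOf (hz : R.IsKnotChoice a z) (ha : 0 < a)
    {τ σ : Finset E2} (hτ : τ ∈ R.tris) (hσ : σ ∈ R.tris) {V : Finset (Sym2 E2)}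
    (hV : IsCellOf σ V) {c : Sym2 E2 → ℝ} (hc : IsWeight V c)
    (hmem : ∑ l ∈ V, c l • pos z l ∈ convexHull ℝ (τ : Set E2)) :
    ∃ V', IsCellOf τ V' ∧ IsWeight V' c := by
  classical
  have hsupp : ∀ l, c l ≠ 0 → l ∈ V := fun l hl => by
    by_contra hn; exact hl (hc.eq_zero l hn)
  have hσw := isWeight_of_support hc fun l hl => hV.subset_sym2 (hsupp l hl)
  -- If the vertex `v` of `σ` is not in `τ`, the point lies on the edge of `σ` opposite to `v`. Its
  -- coordinate at `v` is zero and is a sum of nonnegative terms, so no label that involves `v`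
  -- carries weight.
  have hcτ : ∀ v ∈ σ, v ∉ τ → ∀ u ∈ σ, c s(v, u) = 0 := by
    intro v hvσ hvτ
    obtain ⟨y, w, hvy, hvw, hyw, rfl⟩ := R.exists_vertices hσ hvσ
    obtain ⟨α, hα, eα⟩ := hz.exists_param ha hσ (x := v) (y := y) (by simp) (by simp) hvy
    obtain ⟨β, hβ, eβ⟩ := hz.exists_param ha hσ (x := v) (y := w) (by simp) (by simp) hvw
    obtain ⟨γ, hγ, eγ⟩ := hz.exists_param ha hσ (x := y) (y := w) (by simp) (by simp) hyw
    have hA := R.area_ne_zero hσ hvy hvw hyw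
    have hsub := hc.isSubWeight hvy hvw hyw hV
    have hne : {v, y, w} ≠ τ := by rintro rfl; simp at hvτ
    have hσmem : ∑ l ∈ V, c l • pos z l ∈ convexHull ℝ (({v, y, w} : Finset E2) : Set E2) := by
      rw [sum_smul_of_support hc hσw, sum_smul_pos hvy hvw hyw eα eβ eγ, Finset.coe_insert,
        Finset.coe_insert, Finset.coe_singleton, mem_convexHull_triple]
      obtain ⟨⟨h1, h2, h3, h4, h5, h6⟩, hs, -⟩ := hsub
      have := hα.1; have := hα.2; have := hβ.1; have := hβ.2; have := hγ.1; have := hγ.2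
      have i1 : 0 ≤ 1 - α := by linarith
      have i2 : 0 ≤ 1 - β := by linarith
      have i3 : 0 ≤ 1 - γ := by linarith
      exact ⟨_, _, _, by positivity, by positivity, by positivity, by linear_combination hs, rfl⟩
    have hInt : ∑ l ∈ V, c l • pos z l ∈ convexHull ℝ ({y, w} : Set E2) := by
      refine convexHull_mono ?_ ((R.inter_eq _ hσ τ hτ hne).subset ⟨hσmem, hmem⟩)
      rintro u ⟨hu, huτ⟩
      simp only [Finset.coe_insert, Finset.coe_singleton, mem_insert_iff, mem_singleton_iff] at hu
      rcases hu with rfl | hu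
      · exact absurd huτ hvτ
      · exact hu
    rw [convexHull_pair] at hInt
    obtain ⟨s, t, hs, ht, hst, heq⟩ := hInt
    rw [sum_smul_of_support hc hσw, sum_smul_pos hvy hvw hyw eα eβ eγ] at heq
    obtain ⟨⟨h1, h2, h3, h4, h5, h6⟩, hsum, -⟩ := hsub
    have b1 := (bary_combination_all hA (a := 0) (b := s) (c := t) (by linarith)).1
    rw [zero_smul, zero_add, heq, bary_combination hA (by linear_combination hsum)] at b1
    have k1 : 0 ≤ (1 - α) * c s(v, y) := mul_nonneg (by linarith [hα.2]) h4
    have k2 : 0 ≤ (1 - β) * c s(v, w) := mul_nonneg (by linarith [hβ.2]) h5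
    intro u hu
    simp only [Finset.mem_insert, Finset.mem_singleton] at hu
    rcases hu with rfl | rfl | rfl
    · linarith
    · have : (1 - α) * c s(v, u) = 0 := by linarith
      exact (mul_eq_zero.mp this).resolve_left (by linarith [hα.2])
    · have : (1 - β) * c s(v, u) = 0 := by linarith
      exact (mul_eq_zero.mp this).resolve_left (by linarith [hβ.2])
  have hin : ∀ u v, c s(u, v) ≠ 0 → u ∈ τ ∧ v ∈ τ := by
    intro u v huv
    have := hV.subset_sym2 (hsupp _ huv)
    rw [Finset.mk_mem_sym2_iff] at this
    constructor
    · by_contra hn; exact huv (hcτ u this.1 hn v this.2)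
    · by_contra hn; rw [Sym2.eq_swap] at huv; exact huv (hcτ v this.2 hn u this.1)
  rcases hV with rfl | ⟨x, hx, rfl⟩
  · refine ⟨knots τ, Or.inl rfl, isWeight_of_support hc fun l hl => ?_⟩
    obtain ⟨u, -, v, -, huv, rfl⟩ := mem_knots.mp (hsupp l hl)
    exact mem_knots.mpr ⟨u, (hin u v hl).1, v, (hin u v hl).2, huv, rfl⟩
  -- Without weight at the vertex `x` itself, only knots carry weight and the inner triangle will
  -- do.
  · by_cases h0 : c s(x, x) = 0
    · refine ⟨knots τ, Or.inl rfl, isWeight_of_support hc fun l hl => ?_⟩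
      obtain ⟨v, -, rfl⟩ := mem_corner.mp (hsupp l hl)
      exact mem_knots.mpr ⟨x, (hin x v hl).1, v, (hin x v hl).2, by rintro rfl; exact hl h0, rfl⟩
    · refine ⟨corner τ x, Or.inr ⟨x, (hin x x h0).1, rfl⟩, isWeight_of_support hc fun l hl => ?_⟩
      obtain ⟨v, -, rfl⟩ := mem_corner.mp (hsupp l hl)
      exact mem_corner.mpr ⟨v, (hin x v hl).2, rfl⟩

theorem RegularTriangulation.pos_mem_convexHull (hz : R.IsKnotChoice a z) (ha : 0 < a)
    {τ : Finset E2} (hτ : τ ∈ R.tris) {l : Sym2 E2} (hl : l ∈ τ.sym2) :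
    pos z l ∈ convexHull ℝ (τ : Set E2) := by
  classical
  induction l with
  | _ u v =>
    rw [Finset.mk_mem_sym2_iff] at hl
    have hu := subset_convexHull ℝ (τ : Set E2) (Finset.mem_coe.mpr hl.1)
    have hv := subset_convexHull ℝ (τ : Set E2) (Finset.mem_coe.mpr hl.2)
    by_cases huv : u = v
    · subst huv
      rw [pos_diag]; exact hu
    · obtain ⟨α, hα, e⟩ := hz.exists_param ha hτ hl.1 hl.2 huv
      rw [e]
      exact convex_convexHull ℝ _ hu hv (by linarith [hα.2]) hα.1.le (by ring)

/-- The four parts of a triangle cover it. -/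
theorem RegularTriangulation.convexHull_subset_cells (hz : R.IsKnotChoice a z) (ha : 0 < a)
    {τ : Finset E2} (hτ : τ ∈ R.tris) :
    convexHull ℝ (τ : Set E2) ⊆ ⋃ V ∈ R.cells, convexHull ℝ (pos z '' V) := by
  classical
  have hne : τ.Nonempty := by rw [← Finset.card_pos, R.card_eq τ hτ]; norm_num
  obtain ⟨x, hx⟩ := hne
  obtain ⟨y, w, hxy, hxw, hyw, rfl⟩ := R.exists_vertices hτ hx
  obtain ⟨α, ⟨hα0, hα1⟩, eα⟩ := hz.exists_param ha hτ (x := x) (y := y) (by simp) (by simp) hxy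
  obtain ⟨β, ⟨hβ0, hβ1⟩, eβ⟩ := hz.exists_param ha hτ (x := x) (y := w) (by simp) (by simp) hxw
  obtain ⟨γ, ⟨hγ0, hγ1⟩, eγ⟩ := hz.exists_param ha hτ (x := y) (y := w) (by simp) (by simp) hyw
  intro p hp
  rw [Finset.coe_insert, Finset.coe_insert, Finset.coe_singleton, mem_convexHull_triple] at hp
  obtain ⟨l1, l2, l3, h1, h2, h3, hs, rfl⟩ := hp
  simp only [mem_iUnion]
  -- In the corner at `u` the weights of the two knots are `m2 / μ` and `m3 / ν`, so the only
  -- condition is that their sum is at most one.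
  have cornerMem : ∀ {u v v' : E2}, ({x, y, w} : Finset E2) = {u, v, v'} → ∀ {μ ν m1 m2 m3 : ℝ},
      0 < μ → 0 < ν → 0 ≤ m1 → 0 ≤ m2 → 0 ≤ m3 → m1 + m2 + m3 = 1 →
      pos z s(u, v) = (1 - μ) • u + μ • v → pos z s(u, v') = (1 - ν) • u + ν • v' →
      m2 / μ + m3 / ν ≤ 1 →
      ∃ V, ∃ (_ : V ∈ R.cells), m1 • u + m2 • v + m3 • v' ∈ convexHull ℝ (pos z '' V) := by
    intro u v v' e μ ν m1 m2 m3 hμ hν hm1 hm2 hm3 hm eμ eν hle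
    refine ⟨corner {u, v, v'} u, mem_cells.mpr ⟨_, hτ, Or.inr ⟨u, ?_, ?_⟩⟩, ?_⟩
    · rw [e]; simp
    · rw [e]
    · rw [corner_triple, Finset.coe_insert, Finset.coe_insert, Finset.coe_singleton,
        image_insert_eq, image_insert_eq, image_singleton, mem_convexHull_triple]
      refine ⟨1 - m2 / μ - m3 / ν, m2 / μ, m3 / ν, by linarith, by positivity, by positivity,
        by ring, ?_⟩
      rw [pos_diag, eμ, eν]
      have k2 : m2 / μ * μ = m2 := div_mul_cancel₀ _ hμ.ne'
      have k3 : m3 / ν * ν = m3 := div_mul_cancel₀ _ hν.ne'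
      have k1 : 1 - m2 / μ * μ - m3 / ν * ν = m1 := by rw [k2, k3]; linarith
      trans (1 - m2 / μ * μ - m3 / ν * ν) • u + (m2 / μ * μ) • v + (m3 / ν * ν) • v'
      · module
      · rw [k1, k2, k3]
  have eα' : pos z s(y, x) = (1 - (1 - α)) • y + (1 - α) • x := by
    rw [Sym2.eq_swap, eα, sub_sub_cancel, add_comm]
  have eβ' : pos z s(w, x) = (1 - (1 - β)) • w + (1 - β) • x := by
    rw [Sym2.eq_swap, eβ, sub_sub_cancel, add_comm]
  have eγ' : pos z s(w, y) = (1 - (1 - γ)) • w + (1 - γ) • y := by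
    rw [Sym2.eq_swap, eγ, sub_sub_cancel, add_comm]
  by_cases hcx : l2 / α + l3 / β ≤ 1
  · exact cornerMem rfl hα0 hβ0 h1 h2 h3 hs eα eβ hcx
  by_cases hcy : l1 / (1 - α) + l3 / γ ≤ 1
  · have := cornerMem (u := y) (v := x) (v' := w)
      (by ext u; simp only [Finset.mem_insert, Finset.mem_singleton]; tauto)
      (by linarith : 0 < 1 - α) hγ0 h2 h1 h3 (by linarith) eα' eγ hcy
    rwa [add_comm (l2 • y)] at this
  by_cases hcw : l1 / (1 - β) + l2 / (1 - γ) ≤ 1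
  · have := cornerMem (u := w) (v := x) (v' := y)
      (by ext u; simp only [Finset.mem_insert, Finset.mem_singleton]; tauto)
      (by linarith : 0 < 1 - β) (by linarith : 0 < 1 - γ) h3 h1 h2 (by linarith) eβ' eγ' hcw
    rwa [add_assoc, add_comm (l3 • w)] at this
  have hα2 : 0 < 1 - α := by linarith
  have hβ2 : 0 < 1 - β := by linarith
  have hγ2 : 0 < 1 - γ := by linarith
  -- Outside the three corners these three expressions are nonnegative. Divided by `Δ`, they are by
  -- Cramer's rule the weights of the knots in the inner triangle.
  have gx : 0 ≤ β * l2 + α * l3 - α * β := by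
    have := not_le.mp hcx
    rw [div_add_div _ _ hα0.ne' hβ0.ne', lt_div_iff₀ (by positivity)] at this
    linarith
  have gy : 0 ≤ γ * l1 + (1 - α) * l3 - (1 - α) * γ := by
    have := not_le.mp hcy
    rw [div_add_div _ _ hα2.ne' hγ0.ne', lt_div_iff₀ (by positivity)] at this
    linarith
  have gw : 0 ≤ (1 - γ) * l1 + (1 - β) * l2 - (1 - β) * (1 - γ) := by
    have := not_le.mp hcw
    rw [div_add_div _ _ hβ2.ne' hγ2.ne', lt_div_iff₀ (by positivity)] at this
    linarith
  set Δ : ℝ := (1 - α) * β * (1 - γ) + α * (1 - β) * γ with hΔ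
  have hΔ0 : 0 < Δ := by positivity
  refine ⟨knots {x, y, w}, mem_cells.mpr ⟨_, hτ, Or.inl rfl⟩, ?_⟩
  rw [knots_triple hxy hxw hyw, Finset.coe_insert, Finset.coe_insert, Finset.coe_singleton,
    image_insert_eq, image_insert_eq, image_singleton, mem_convexHull_triple]
  set C1 := ((1 - γ) * l1 + (1 - β) * l2 - (1 - β) * (1 - γ)) / Δ with hC1
  set C2 := (γ * l1 + (1 - α) * l3 - (1 - α) * γ) / Δ with hC2
  set C3 := (β * l2 + α * l3 - α * β) / Δ with hC3
  have hl3 : l3 = 1 - l1 - l2 := by linarith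
  have e0 : C1 + C2 + C3 = 1 := by
    rw [← add_div, ← add_div, div_eq_one_iff_eq hΔ0.ne', hΔ]
    linear_combination hs
  have e1 : (1 - α) * C1 + (1 - β) * C2 = l1 := by
    rw [hC1, hC2, ← mul_div_assoc, ← mul_div_assoc, ← add_div, div_eq_iff hΔ0.ne', hΔ, hl3]
    ring
  have e2 : α * C1 + (1 - γ) * C3 = l2 := by
    rw [hC1, hC3, ← mul_div_assoc, ← mul_div_assoc, ← add_div, div_eq_iff hΔ0.ne', hΔ, hl3]
    ring
  have e3 : β * C2 + γ * C3 = l3 := by linarith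
  refine ⟨C1, C2, C3, div_nonneg gw hΔ0.le, div_nonneg gy hΔ0.le, div_nonneg gx hΔ0.le, e0, ?_⟩
  rw [eα, eβ, eγ]
  trans ((1 - α) * C1 + (1 - β) * C2) • x + (α * C1 + (1 - γ) * C3) • y + (β * C2 + γ * C3) • w
  · module
  · rw [e1, e2, e3]

theorem RegularTriangulation.card_eq_three_of_mem_cells {V : Finset (Sym2 E2)} (hV : V ∈ R.cells) :
    V.card = 3 := by
  classical
  obtain ⟨τ, hτ, hV⟩ := mem_cells.mp hV
  rcases hV with rfl | ⟨x, hx, rfl⟩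
  · have hne : τ.Nonempty := by rw [← Finset.card_pos, R.card_eq τ hτ]; norm_num
    obtain ⟨x, hx⟩ := hne
    obtain ⟨y, w, hxy, hxw, hyw, rfl⟩ := R.exists_vertices hτ hx
    rw [knots_triple hxy hxw hyw]
    refine Finset.card_eq_three.mpr ⟨_, _, _, ?_, ?_, ?_, rfl⟩ <;>
      simp [hxy, hxw, hyw]
  · obtain ⟨y, w, hxy, hxw, hyw, rfl⟩ := R.exists_vertices hτ hx
    rw [corner_triple]
    refine Finset.card_eq_three.mpr ⟨_, _, _, ?_, ?_, ?_, rfl⟩ <;>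
      simp [hxy, hxw, hyw]

/-- Adaptive triangulations are labelled triangulations. -/
theorem RegularTriangulation.isComplex (hΩ : interior (closure Ω) = Ω) (hz : R.IsKnotChoice a z)
    (ha : 0 < a) : IsComplex Ω R.cells (pos z) := by
  classical
  have hsub : ∀ {τ V}, τ ∈ R.tris → IsCellOf τ V →
      convexHull ℝ (pos z '' V) ⊆ convexHull ℝ (τ : Set E2) := by
    intro τ V hτ hV
    refine convexHull_min ?_ (convex_convexHull ℝ _)
    rintro _ ⟨l, hl, rfl⟩
    exact R.pos_mem_convexHull hz ha hτ (hV.subset_sym2 hl)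
  refine ⟨fun V hV => R.card_eq_three_of_mem_cells hV, ?_, ?_, hΩ⟩
  · intro V hV V' hV' c c' hc hc' heq
    obtain ⟨τ, hτ, hV⟩ := mem_cells.mp hV
    obtain ⟨σ, hσ, hV'⟩ := mem_cells.mp hV'
    have hV : IsCellOf τ V := hV
    have hmem : ∑ l ∈ V', c' l • pos z l ∈ convexHull ℝ (τ : Set E2) := by
      rw [← heq]
      exact hsub hτ hV (mem_convexHull_image_iff.mpr ⟨c, hc, rfl⟩)
    -- The two cells may belong to different triangles of `R`; the second weight is first
    -- transferred to a cell of the triangle `τ` of the first one.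
    obtain ⟨V'', hV'', hc''⟩ := R.exists_cellOf hz ha hτ hσ hV' hc' hmem
    rw [sum_smul_of_support hc' hc''] at heq
    have hne : τ.Nonempty := by rw [← Finset.card_pos, R.card_eq τ hτ]; norm_num
    obtain ⟨x, hx⟩ := hne
    obtain ⟨y, w, hxy, hxw, hyw, rfl⟩ := R.exists_vertices hτ hx
    obtain ⟨α, hα, eα⟩ := hz.exists_param ha hτ (x := x) (y := y) (by simp) (by simp) hxy
    obtain ⟨β, hβ, eβ⟩ := hz.exists_param ha hτ (x := x) (y := w) (by simp) (by simp) hxw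
    obtain ⟨γ, hγ, eγ⟩ := hz.exists_param ha hτ (x := y) (y := w) (by simp) (by simp) hyw
    have hA := R.area_ne_zero hτ hxy hxw hyw
    have w1 := isWeight_of_support hc fun l hl => hV.subset_sym2 (by
      by_contra hn; exact hl (hc.eq_zero l hn))
    have w2 := isWeight_of_support hc'' fun l hl => hV''.subset_sym2 (by
      by_contra hn; exact hl (hc''.eq_zero l hn))
    rw [sum_smul_of_support hc w1, sum_smul_of_support hc'' w2,
      sum_smul_pos hxy hxw hyw eα eβ eγ, sum_smul_pos hxy hxw hyw eα eβ eγ] at heq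
    have s1 := hc.isSubWeight hxy hxw hyw hV
    have s2 := hc''.isSubWeight hxy hxw hyw hV''
    obtain ⟨p1, p2, p3⟩ := bary_combination_all hA (a := c s(x, x) + (1 - α) * c s(x, y) +
      (1 - β) * c s(x, w)) (b := c s(y, y) + α * c s(x, y) + (1 - γ) * c s(y, w))
      (c := c s(w, w) + β * c s(x, w) + γ * c s(y, w)) (by linear_combination s1.2.1)
    obtain ⟨q1, q2, q3⟩ := bary_combination_all hA (a := c' s(x, x) + (1 - α) * c' s(x, y) +
      (1 - β) * c' s(x, w)) (b := c' s(y, y) + α * c' s(x, y) + (1 - γ) * c' s(y, w))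
      (c := c' s(w, w) + β * c' s(x, w) + γ * c' s(y, w)) (by linear_combination s2.2.1)
    rw [heq] at p1 p2 p3
    obtain ⟨r1, r2, r3, r4, r5, r6⟩ := s1.unique s2 hα hβ hγ (p1.symm.trans q1) (p2.symm.trans q2)
      (p3.symm.trans q3)
    funext l
    by_cases hl : l ∈ ({x, y, w} : Finset E2).sym2
    · induction l with
      | _ u v =>
        rw [Finset.mk_mem_sym2_iff] at hl
        simp only [Finset.mem_insert, Finset.mem_singleton] at hl
        obtain ⟨rfl | rfl | rfl, rfl | rfl | rfl⟩ := hl <;>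
          first | assumption | (rw [Sym2.eq_swap]; assumption)
    · rw [w1.eq_zero l hl, w2.eq_zero l hl]
  · rw [R.cover]
    refine Subset.antisymm (iUnion₂_subset fun τ hτ => R.convexHull_subset_cells hz ha hτ)
      (iUnion₂_subset fun V hV => ?_)
    obtain ⟨τ, hτ, hV⟩ := mem_cells.mp hV
    exact (hsub hτ hV).trans (subset_biUnion_of_mem (u := fun τ : Finset E2 =>
      convexHull ℝ (τ : Set E2)) hτ)

/-- This passes from sets of vertices, which move with the knots, to labels, which do not. -/
theorem RegularTriangulation.adaptive_eq :
    R.adaptive z = (fun V : Finset (Sym2 E2) => pos z '' V) '' R.cells := by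
  classical
  ext S
  constructor
  · rintro ⟨τ, hτ, x, hx, y, hy, w, hw, hxy, hxw, hyw, hS⟩
    have e : τ = {x, y, w} := by
      refine (Finset.eq_of_subset_of_card_le (fun u hu => ?_) ?_).symm
      · simp only [Finset.mem_insert, Finset.mem_singleton] at hu
        rcases hu with rfl | rfl | rfl <;> assumption
      · rw [R.card_eq τ hτ, Finset.card_eq_three.mpr ⟨x, y, w, hxy, hxw, hyw, rfl⟩]
    subst e
    rcases hS with rfl | rfl
    · refine ⟨corner {x, y, w} x, mem_cells.mpr ⟨_, hτ, Or.inr ⟨x, hx, rfl⟩⟩, ?_⟩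
      simp only [corner_triple, Finset.coe_insert, Finset.coe_singleton, image_insert_eq,
        image_singleton, pos_diag, pos_of_ne z hxy, pos_of_ne z hxw]
    · refine ⟨knots {x, y, w}, mem_cells.mpr ⟨_, hτ, Or.inl rfl⟩, ?_⟩
      simp only [knots_triple hxy hxw hyw, Finset.coe_insert, Finset.coe_singleton, image_insert_eq,
        image_singleton, pos_of_ne z hxy, pos_of_ne z hxw, pos_of_ne z hyw]
  · rintro ⟨V, hV, rfl⟩
    obtain ⟨τ, hτ, hV⟩ := mem_cells.mp (Finset.mem_coe.mp hV)
    rcases hV with rfl | ⟨x, hx, rfl⟩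
    · have hne : τ.Nonempty := by rw [← Finset.card_pos, R.card_eq τ hτ]; norm_num
      obtain ⟨x, hx⟩ := hne
      obtain ⟨y, w, hxy, hxw, hyw, rfl⟩ := R.exists_vertices hτ hx
      refine ⟨_, hτ, x, by simp, y, by simp, w, by simp, hxy, hxw, hyw, Or.inr ?_⟩
      simp only [knots_triple hxy hxw hyw, Finset.coe_insert, Finset.coe_singleton, image_insert_eq,
        image_singleton, pos_of_ne z hxy, pos_of_ne z hxw, pos_of_ne z hyw]
    · obtain ⟨y, w, hxy, hxw, hyw, rfl⟩ := R.exists_vertices hτ hx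
      refine ⟨_, hτ, x, by simp, y, by simp, w, by simp, hxy, hxw, hyw, Or.inl ?_⟩
      simp only [corner_triple, Finset.coe_insert, Finset.coe_singleton, image_insert_eq,
        image_singleton, pos_diag, pos_of_ne z hxy, pos_of_ne z hxw]

end

end CrackFE

namespace CrackFE

noncomputable section

/-! ### Integrands -/

section Integrand

variable {V : Type*} [NormedAddCommGroup V]

/-- A Carathéodory integrand that is dominated by integrable functions on bounded sets. -/
structure IsDominatedIntegrand (ν : Measure E2) (h : E2 → V → ℝ) : Prop where
  measurable : ∀ z, AEStronglyMeasurable (fun x => h x z) ν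
  continuous : ∀ᵐ x ∂ν, Continuous (h x)
  dominated : ∀ M : ℝ, ∃ B : E2 → ℝ, Integrable B ν ∧ ∀ᵐ x ∂ν, ∀ z, ‖z‖ ≤ M → |h x z| ≤ B x

theorem aestronglyMeasurable_comp_simpleFunc {V : Type*} {ν : Measure E2} {h : E2 → V → ℝ}
    (hm : ∀ z, AEStronglyMeasurable (fun x => h x z) ν) (s : SimpleFunc E2 V) :
    AEStronglyMeasurable (fun x => h x (s x)) ν := by
  classical
  have heq : (fun x => h x (s x)) =
      fun x => ∑ c ∈ s.range, (s ⁻¹' {c}).indicator (fun x => h x c) x := by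
    funext x
    rw [Finset.sum_eq_single_of_mem (s x) (s.mem_range_self x)]
    · simp
    · intro c _ hc
      exact indicator_of_notMem (by simpa using hc.symm) _
  rw [heq]
  exact Finset.aestronglyMeasurable_fun_sum _ fun c _ => (hm c).indicator (s.measurableSet_fiber c)

variable {ν : Measure E2} {h : E2 → V → ℝ}

theorem IsDominatedIntegrand.aestronglyMeasurable_comp (hh : IsDominatedIntegrand ν h) {w : E2 → V}
    (hw : AEStronglyMeasurable w ν) : AEStronglyMeasurable (fun x => h x (w x)) ν := by
  refine aestronglyMeasurable_of_tendsto_ae atTop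
    (f := fun n x => h x (hw.stronglyMeasurable_mk.approx n x))
    (fun n => aestronglyMeasurable_comp_simpleFunc hh.measurable _) ?_
  filter_upwards [hh.continuous, hw.ae_eq_mk] with x hx hwx
  rw [hwx]
  exact (hx.tendsto _).comp (hw.stronglyMeasurable_mk.tendsto_approx x)

theorem IsDominatedIntegrand.integrable_comp (hh : IsDominatedIntegrand ν h) {w : E2 → V}
    (hw : AEStronglyMeasurable w ν) {M : ℝ} (hM : ∀ᵐ x ∂ν, ‖w x‖ ≤ M) :
    Integrable (fun x => h x (w x)) ν := by
  obtain ⟨B, hB, hle⟩ := hh.dominated M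
  refine hB.mono' (hh.aestronglyMeasurable_comp hw) ?_
  filter_upwards [hM, hle] with x h1 h2 using h2 _ h1

theorem IsDominatedIntegrand.tendsto_integral (hh : IsDominatedIntegrand ν h) {w : ℕ → E2 → V}
    {w' : E2 → V} (hw : ∀ n, AEStronglyMeasurable (w n) ν) {M : ℝ}
    (hM : ∀ n, ∀ᵐ x ∂ν, ‖w n x‖ ≤ M) (hlim : ∀ᵐ x ∂ν, Tendsto (fun n => w n x) atTop (𝓝 (w' x))) :
    Tendsto (fun n => ∫ x, h x (w n x) ∂ν) atTop (𝓝 (∫ x, h x (w' x) ∂ν)) := by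
  obtain ⟨B, hB, hle⟩ := hh.dominated M
  refine tendsto_integral_of_dominated_convergence B
    (fun n => hh.aestronglyMeasurable_comp (hw n)) hB (fun n => ?_) ?_
  · filter_upwards [hM n, hle] with x h1 h2 using h2 _ h1
  · filter_upwards [hh.continuous, hlim] with x h1 h2 using (h1.tendsto _).comp h2

end Integrand

theorem IsBulkDensity.isDominatedIntegrand {Ω : Set E2} (hΩ : MeasurableSet Ω)
    (hfin : volume Ω ≠ ⊤) {p : ℝ} (hp : 0 ≤ p) {W : E2 → M22 → ℝ} (hW : IsBulkDensity Ω p W) :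
    IsDominatedIntegrand (volume.restrict Ω) W := by
  obtain ⟨a₀, a₁, b₀, b₁, -, ha₁, -, hb₁, -, -, hg⟩ := hW.growth
  refine ⟨hW.measurable, ?_, fun M => ⟨fun x => a₁ * |M| ^ p + b₁ x, ?_, ?_⟩⟩
  · filter_upwards [ae_restrict_mem hΩ] with x hx using (hW.contDiff x hx).continuous
  · exact (integrableOn_const hfin).add hb₁
  · filter_upwards [ae_restrict_mem hΩ] with x hx ξ hξ
    rw [abs_of_nonneg (hW.nonneg x hx ξ)]
    refine (hg x hx ξ).2.trans ?_
    gcongr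
    exact hξ.trans (le_abs_self M)

/-! ### Potentials at a fixed time. -/

section Potential

variable {T : ℝ} {X : Set E2} {μ : Measure E2} {s sd : ℝ} {H : ℝ → E2 → E2 → ℝ}

theorem IsContLp.integrable {b : ℝ → E2 → ℝ} (hb : IsContLp T μ 1 b) {t : ℝ} (ht : t ∈ Icc 0 T) :
    Integrable (b t) μ := memLp_one_iff_integrable.mp (hb.1 t ht)

/-- The potential is measurable in the space variable at every time. -/
theorem IsPotential.aestronglyMeasurable (hH : IsPotential T X μ s sd H) [SFinite (μ.restrict X)]
    (hT : 0 < T) {t : ℝ} (ht : t ∈ Icc 0 T) (z : E2) :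
    AEStronglyMeasurable (fun x => H t x z) (μ.restrict X) := by
  obtain ⟨Hd, hHd⟩ := hH.rate
  have hInt : ∀ t ∈ Icc 0 T,
      AEStronglyMeasurable (fun x => ∫ τ in (0 : ℝ)..t, Hd τ x z) (μ.restrict X) := by
    intro t ht
    simp only [intervalIntegral.integral_of_le ht.1]
    have hmono : (volume.restrict (Ioc 0 t)).prod (μ.restrict X) ≤
        (volume.restrict (Icc 0 T)).prod (μ.restrict X) :=
      Measure.prod_mono (Measure.restrict_mono
        (Ioc_subset_Icc_self.trans (Icc_subset_Icc_right ht.2)) le_rfl) le_rfl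
    exact ((hHd.measurable z).mono_measure hmono).prod_swap.integral_prod_right'
  have h0 : AEStronglyMeasurable (fun x => H 0 x z) (μ.restrict X) := by
    -- Joint measurability controls almost every time only. From one good time, the integral of the
    -- rate leads back to time zero, and from there to every other time.
    have hae : ∀ᵐ t ∂(volume.restrict (Icc 0 T)),
        AEStronglyMeasurable (fun x => H t x z) (μ.restrict X) := (hH.measurable z).prodMk_left
    have hne : (ae (volume.restrict (Icc 0 T))).NeBot := by
      rw [ae_neBot, Ne, Measure.restrict_eq_zero, Real.volume_Icc]
      simp [hT]
    obtain ⟨t, ht, htI⟩ := (hae.and (ae_restrict_mem measurableSet_Icc)).exists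
    refine (ht.sub (hInt t htI)).congr ?_
    filter_upwards [hHd.integral_eq t htI z] with x hx
    simp [hx]
  refine (h0.add (hInt t ht)).congr ?_
  filter_upwards [hHd.integral_eq t ht z] with x hx
  simp [hx]

end Potential

theorem IsBodyPotential.isDominatedIntegrand {T : ℝ} {Ω : Set E2} {q qd : ℝ}
    {F : ℝ → E2 → E2 → ℝ} (hF : IsBodyPotential T Ω q qd F) (hT : 0 < T) (hΩ : MeasurableSet Ω)
    (hfin : volume Ω ≠ ⊤) (hq : 0 ≤ q) {t : ℝ} (ht : t ∈ Icc 0 T) :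
    IsDominatedIntegrand (volume.restrict Ω) (F t) := by
  obtain ⟨a₀, b₀, ha₀, hb₀, hb₀n, hlow⟩ := hF.lower
  obtain ⟨a₁, b₁, ha₁, hb₁, hb₁n, hup⟩ := hF.upper
  refine ⟨fun z => hF.toIsPotential.aestronglyMeasurable hT ht z, ?_,
    fun M => ⟨fun x => a₁ * |M| ^ q + b₁ t x + b₀ t x, ?_, ?_⟩⟩
  · filter_upwards [ae_restrict_mem hΩ] with x hx using (hF.contDiff t ht x hx).continuous
  · exact ((integrableOn_const hfin).add (hb₁.integrable ht)).add (hb₀.integrable ht)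
  · filter_upwards [ae_restrict_mem hΩ] with x hx z hz
    have h1 := hlow t ht x hx z
    have h2 := hup t ht x hx z
    have h3 : a₁ * ‖z‖ ^ q ≤ a₁ * |M| ^ q := by
      gcongr
      exact hz.trans (le_abs_self M)
    have h4 : 0 ≤ a₀ * ‖z‖ ^ q := by positivity
    have h5 : 0 ≤ a₁ * |M| ^ q := by positivity
    have h6 := hb₀n t ht x hx
    have h7 := hb₁n t ht x hx
    rw [abs_le]
    constructor <;> linarith

theorem one_le_conjExp (s : ℝ) : 1 ≤ conjExp s := by
  unfold conjExp ENNReal.conjExponent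
  exact le_self_add

/-! ### Domination and linear growth of the work of the surface forces. -/

section Surface

variable {T : ℝ} {X : Set E2} {r : ℝ} {G : ℝ → E2 → E2 → ℝ}

/-- The coefficient `a₀` of the lower bound is controlled at almost every time only, so at the given
`t` that bound is used at `z = 0` alone. The mean value inequality and the growth of the derivative
carry it from `0` to `z`. -/
theorem IsSurfacePotential.isDominatedIntegrand [IsFiniteMeasure (H1.restrict X)]
    (hG : IsSurfacePotential T X r G) (hT : 0 < T) (hX : MeasurableSet X) (hr : 1 ≤ r) {t : ℝ}
    (ht : t ∈ Icc 0 T) : IsDominatedIntegrand (H1.restrict X) (G t) := by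
  obtain ⟨a₀, b₀, -, -, hb₀, hb₀n, hlow⟩ := hG.lower
  obtain ⟨a₁, b₁, ha₁, hb₁, hb₁n, hup⟩ := hG.upper
  obtain ⟨a₂, b₂, ha₂, hb₂, hb₂n, hder⟩ := hG.deriv_growth
  have hb₂i : Integrable (b₂ t) (H1.restrict X) := (hb₂.1 t ht).integrable (one_le_conjExp r)
  refine ⟨fun z => hG.toIsPotential.aestronglyMeasurable hT ht z, ?_,
    fun M => ⟨fun x => (a₁ * |M| ^ r + b₁ t x) + (b₀ t x + (a₂ * |M| ^ (r - 1) + b₂ t x) * |M|),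
      ?_, ?_⟩⟩
  · filter_upwards [ae_restrict_mem hX] with x hx using (hG.contDiff t ht x hx).continuous
  · exact ((integrable_const _).add (hb₁.integrable ht)).add
      ((hb₀.integrable ht).add (((integrable_const _).add hb₂i).mul_const _))
  · filter_upwards [ae_restrict_mem hX] with x hx z hz
    have hz' : ‖z‖ ≤ |M| := hz.trans (le_abs_self M)
    have h0 := hlow t ht x hx 0
    rw [norm_zero, mul_zero, neg_zero, zero_sub] at h0
    have h2 := hup t ht x hx z
    have h3 : a₁ * ‖z‖ ^ r ≤ a₁ * |M| ^ r := by gcongr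
    have h5 : 0 ≤ a₁ * |M| ^ r := by positivity
    have h6 := hb₀n t ht x hx
    have h7 := hb₁n t ht x hx
    have h8 := hb₂n t ht x hx
    have hlip : ‖G t x z - G t x 0‖ ≤ (a₂ * |M| ^ (r - 1) + b₂ t x) * ‖z - 0‖ := by
      refine (convex_closedBall (0 : E2) |M|).norm_image_sub_le_of_norm_fderiv_le
        (𝕜 := ℝ) (fun y _ => ((hG.contDiff t ht x hx).differentiable one_ne_zero) y)
        (fun y hy => ?_) (by simp) (by simpa using hz')
      refine (hder t ht x hx y).trans ?_
      have : ‖y‖ ≤ |M| := by simpa using hy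
      have : ‖y‖ ^ (r - 1) ≤ |M| ^ (r - 1) := Real.rpow_le_rpow (norm_nonneg _) this (by linarith)
      gcongr
    have h9 : 0 ≤ a₂ * |M| ^ (r - 1) + b₂ t x := by positivity
    have h10 : (a₂ * |M| ^ (r - 1) + b₂ t x) * ‖z - 0‖ ≤ (a₂ * |M| ^ (r - 1) + b₂ t x) * |M| := by
      rw [sub_zero]; gcongr
    have h11 : 0 ≤ (a₂ * |M| ^ (r - 1) + b₂ t x) * |M| := by positivity
    have h12 := (abs_le.mp (Real.norm_eq_abs _ ▸ hlip)).2
    rw [abs_le]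
    constructor <;> linarith

/-- Continuity in time of the work of the surface forces, for a fixed displacement. -/
theorem IsSurfacePotential.continuousOn_setIntegral [IsFiniteMeasure (H1.restrict X)]
    (hG : IsSurfacePotential T X r G) (hT : 0 < T) (hX : MeasurableSet X) (hr : 1 ≤ r)
    (A : Set E2) (z : E2) :
    ContinuousOn (fun t => ∫ x in A, G t x z ∂(H1.restrict X)) (Icc 0 T) := by
  obtain ⟨Gd, hGd⟩ := hG.rate
  set ν := H1.restrict X with hν
  obtain ⟨a₃, b₃, ha₃, ha₃n, hb₃, hb₃n, hgr⟩ := hGd.growth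
  have hb₃i : Integrable (fun y : ℝ × E2 => b₃ y.1 y.2) ((volume.restrict (Icc 0 T)).prod ν) := by
    refine (integrable_prod_iff hb₃.1).mpr ⟨?_, ?_⟩
    · filter_upwards [hb₃.2.1] with t ht using memLp_one_iff_integrable.mp ht
    · refine (memLp_one_iff_integrable.mp hb₃.2.2).congr ?_
      filter_upwards [hb₃.2.1] with t ht
      rw [eLpNorm_one_eq_lintegral_enorm, integral_norm_eq_lintegral_enorm ht.1]
  -- The growth of the rate makes it integrable on the product, so by Fubini the work is its initial
  -- value plus the primitive of an integrable function of time.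
  have hdom : Integrable (fun y : ℝ × E2 => Gd y.1 y.2 z) ((volume.restrict (Icc 0 T)).prod ν) := by
    have ha₃i : Integrable (fun y : ℝ × E2 => a₃ y.1 * ‖z‖ ^ r)
        ((volume.restrict (Icc 0 T)).prod ν) := (Integrable.comp_fst ha₃ ν).mul_const _
    refine (ha₃i.add hb₃i).mono' (hGd.measurable z) ?_
    have h1 : ∀ᵐ y ∂((volume.restrict (Icc 0 T)).prod ν), y.1 ∈ Icc 0 T :=
      Measure.quasiMeasurePreserving_fst.ae (ae_restrict_mem measurableSet_Icc)
    have h2 : ∀ᵐ y ∂((volume.restrict (Icc 0 T)).prod ν), y.2 ∈ X :=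
      Measure.quasiMeasurePreserving_snd.ae (ae_restrict_mem hX)
    filter_upwards [h1, h2] with y hy1 hy2
    exact hgr y.1 hy1 y.2 hy2 z
  have hdomA : Integrable (fun y : ℝ × E2 => Gd y.1 y.2 z)
      ((volume.restrict (Icc 0 T)).prod (ν.restrict A)) :=
    hdom.mono_measure (Measure.prod_mono le_rfl Measure.restrict_le_self)
  have hprim : ContinuousOn (fun t => ∫ τ in (0 : ℝ)..t, ∫ x in A, Gd τ x z ∂ν) (Icc 0 T) := by
    have := intervalIntegral.continuousOn_primitive_interval (a := 0) (b := T)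
      (f := fun τ => ∫ x in A, Gd τ x z ∂ν) (by
        rw [uIcc_of_le hT.le]; exact hdomA.integral_prod_left)
    rwa [uIcc_of_le hT.le] at this
  refine ((continuousOn_const (c := ∫ x in A, G 0 x z ∂ν)).add hprim).congr fun t ht => ?_
  have hdomt : Integrable (fun y : ℝ × E2 => Gd y.1 y.2 z)
      ((volume.restrict (Ioc 0 t)).prod (ν.restrict A)) :=
    hdomA.mono_measure (Measure.prod_mono (Measure.restrict_mono
        (Ioc_subset_Icc_self.trans (Icc_subset_Icc_right ht.2)) le_rfl) le_rfl)
  have hG0 : Integrable (fun x => G 0 x z) (ν.restrict A) :=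
    ((hG.isDominatedIntegrand hT hX hr (left_mem_Icc.mpr hT.le)).integrable_comp
      (w := fun _ => z) aestronglyMeasurable_const (M := ‖z‖) (by simp)).restrict
  have heq : ∫ x in A, G t x z ∂ν =
      ∫ x in A, (G 0 x z + ∫ τ in Ioc 0 t, Gd τ x z) ∂ν := by
    refine integral_congr_ae (ae_restrict_of_ae ?_)
    filter_upwards [hGd.integral_eq t ht z] with x hx
    rw [hx, intervalIntegral.integral_of_le ht.1]
  rw [heq, integral_add hG0 hdomt.integral_prod_right, Pi.add_apply, intervalIntegral.integral_of_le
    ht.1]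
  congr 1
  exact (integral_integral_swap (f := fun τ x => Gd τ x z) hdomt).symm

/-- A relative neighbourhood of any time in `[0,T]`, end points included, contains a non-empty open
part of `]0,T[`, which has positive measure. -/
theorem frequently_nhdsWithin_Icc_of_ae {T t : ℝ} (hT : 0 < T) (ht : t ∈ Icc 0 T) {p : ℝ → Prop}
    (hp : ∀ᵐ s ∂(volume.restrict (Icc 0 T)), p s) : ∃ᶠ s in 𝓝[Icc 0 T] t, p s := by
  intro hnot
  obtain ⟨U, hU, htU, hsub⟩ := mem_nhdsWithin.mp hnot
  have hne : (U ∩ Ioo 0 T).Nonempty := by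
    have : t ∈ closure (Ioo 0 T) := by rw [closure_Ioo hT.ne]; exact ht
    exact mem_closure_iff.mp this U hU htU
  have hpos := (hU.inter isOpen_Ioo).measure_pos volume hne
  have hzero : volume (U ∩ Ioo 0 T) = 0 := by
    rw [ae_iff, Measure.restrict_apply₀' measurableSet_Icc.nullMeasurableSet] at hp
    refine measure_mono_null ?_ hp
    intro s hs
    exact ⟨hsub ⟨hs.1, Ioo_subset_Icc_self hs.2⟩, Ioo_subset_Icc_self hs.2⟩
  exact hpos.ne' hzero

/-- The work of the surface forces grows at most linearly, at every time. -/
theorem IsSurfacePotential.exists_integral_le [IsFiniteMeasure (H1.restrict X)]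
    (hG : IsSurfacePotential T X r G) (hT : 0 < T) (hX : MeasurableSet X) (hr : 1 ≤ r) {t : ℝ}
    (ht : t ∈ Icc 0 T) : ∃ C C' : ℝ, 0 ≤ C ∧ ∀ (w : E2 → E2) (M : ℝ), 0 ≤ M →
      AEStronglyMeasurable w (H1.restrict X) → (∀ᵐ x ∂(H1.restrict X), ‖w x‖ ≤ M) →
      ∫ x, G t x (w x) ∂(H1.restrict X) ≤ C * M + C' := by
  obtain ⟨a₀, b₀, ha₀, ha₀n, hb₀, hb₀n, hlow⟩ := hG.lower
  set ν := H1.restrict X with hν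
  -- `C` is the essential supremum over time of the `L^{r'}` norms of `a₀`, times the constant of
  -- the embedding into `L¹` for the finite measure `ν`. The bound holds for almost every time only,
  -- hence the passage through nearby times below.
  obtain ⟨C, hC, hCa⟩ : ∃ C : ℝ, 0 ≤ C ∧ ∀ᵐ s ∂(volume.restrict (Icc 0 T)),
      Integrable (a₀ s) ν ∧ ∫ x, ‖a₀ s x‖ ∂ν ≤ C := by
    set N : ℝ → ℝ := fun s => (eLpNorm (a₀ s) (conjExp r) ν).toReal with hN
    set K : ℝ≥0∞ := ν univ ^ (1 / (1 : ℝ≥0∞).toReal - 1 / (conjExp r).toReal) with hK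
    have hbound := ae_le_eLpNormEssSup (f := N) (μ := volume.restrict (Icc 0 T))
    have hfin : eLpNormEssSup N (volume.restrict (Icc 0 T)) < ⊤ := by
      have := ha₀.2.2.2
      rwa [eLpNorm_exponent_top] at this
    refine ⟨(eLpNormEssSup N (volume.restrict (Icc 0 T))).toReal * K.toReal, by positivity, ?_⟩
    filter_upwards [hbound, ha₀.2.1] with s hs hmem
    refine ⟨hmem.integrable (one_le_conjExp r), ?_⟩
    have hle := eLpNorm_le_eLpNorm_mul_rpow_measure_univ (one_le_conjExp r) hmem.1
    have hKtop : K ≠ ⊤ := by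
      refine ENNReal.rpow_ne_top_of_nonneg ?_ (measure_ne_top _ _)
      rw [sub_nonneg]
      by_cases htop : conjExp r = ⊤
      · simp [htop]
      · refine one_div_le_one_div_of_le (by simp) ?_
        exact (ENNReal.toReal_le_toReal ENNReal.one_ne_top htop).mpr (one_le_conjExp r)
    rw [integral_norm_eq_lintegral_enorm hmem.1, ← eLpNorm_one_eq_lintegral_enorm]
    refine (ENNReal.toReal_mono (ENNReal.mul_ne_top hmem.2.ne hKtop) hle).trans ?_
    rw [ENNReal.toReal_mul]
    refine mul_le_mul_of_nonneg_right ?_ ENNReal.toReal_nonneg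
    have := ENNReal.toReal_mono hfin.ne hs
    rwa [toReal_enorm, Real.norm_of_nonneg ENNReal.toReal_nonneg] at this
  -- By continuity in `L¹`, the integral of `b₀` grows by at most one near `t`; this is the `+ 1` in
  -- the constant.
  have hb₀lim : ∀ᶠ s in 𝓝[Icc 0 T] t, ∫ x, b₀ s x ∂ν ≤ ∫ x, b₀ t x ∂ν + 1 := by
    have h1 := hb₀.2 t ht
    have h2 : ∀ᶠ s in 𝓝[Icc 0 T] t, eLpNorm (b₀ s - b₀ t) 1 ν < 1 := h1.eventually_lt_const one_pos
    filter_upwards [h2, self_mem_nhdsWithin] with s hs hsI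
    have hi := (hb₀.integrable hsI).sub (hb₀.integrable ht)
    have h3 : ∫ x, ‖(b₀ s - b₀ t) x‖ ∂ν ≤ 1 := by
      rw [integral_norm_eq_lintegral_enorm hi.1, ← eLpNorm_one_eq_lintegral_enorm]
      exact ENNReal.toReal_le_of_le_ofReal zero_le_one (by simpa using hs.le)
    have h4 : ∫ x, (b₀ s - b₀ t) x ∂ν ≤ ∫ x, ‖(b₀ s - b₀ t) x‖ ∂ν :=
      integral_mono hi hi.norm fun x => le_abs_self _
    have h5 : ∫ x, (b₀ s - b₀ t) x ∂ν = ∫ x, b₀ s x ∂ν - ∫ x, b₀ t x ∂ν :=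
      integral_sub (hb₀.integrable hsI) (hb₀.integrable ht)
    linarith
  refine ⟨C, ∫ x, b₀ t x ∂ν + 1, hC, fun w M hM hw hwM => ?_⟩
  -- For a simple function the work is a finite sum of works of constants on sets, hence continuous
  -- in time. The bound holds at times arbitrarily close to `t` and so passes to `t`.
  have hsimple : ∀ f : SimpleFunc E2 E2, (∀ x, ‖f x‖ ≤ M) →
      ∫ x, G t x (f x) ∂ν ≤ C * M + (∫ x, b₀ t x ∂ν + 1) := by
    intro f hf
    have hcont : ContinuousOn (fun s => ∫ x, G s x (f x) ∂ν) (Icc 0 T) := by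
      have hc : ContinuousOn
          (fun s => ∑ c ∈ f.range, ∫ x in f ⁻¹' {c}, G s x c ∂ν) (Icc 0 T) :=
        continuousOn_finsetSum _ fun c _ =>
          hG.continuousOn_setIntegral hT hX hr (f ⁻¹' {c}) c
      refine hc.congr fun s hs => ?_
      have hInt := (hG.isDominatedIntegrand hT hX hr hs).integrable_comp (w := f)
        f.stronglyMeasurable.aestronglyMeasurable (ae_of_all _ hf)
      have hU : ⋃ c ∈ f.range, f ⁻¹' {c} = univ := by
        ext x; simp
      have h1 := integral_biUnion_finset (μ := ν) (f := fun x => G s x (f x)) f.range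
        (s := fun c => f ⁻¹' {c}) (fun c _ => f.measurableSet_fiber c)
        (fun c _ c' _ hcc => by
          refine Set.disjoint_left.mpr fun x hx hx' => hcc ?_
          rw [← mem_singleton_iff.mp hx, ← mem_singleton_iff.mp hx'])
        (fun c _ => hInt.integrableOn)
      rw [hU, setIntegral_univ] at h1
      simp only
      rw [h1]
      refine Finset.sum_congr rfl fun c _ => ?_
      refine setIntegral_congr_fun (f.measurableSet_fiber c) fun x hx => ?_
      rw [mem_singleton_iff.mp hx]
    refine le_of_tendsto_of_frequently (hcont t ht) ?_
    refine ((frequently_nhdsWithin_Icc_of_ae hT ht hCa).and_eventually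
      (hb₀lim.and self_mem_nhdsWithin)).mono ?_
    rintro s ⟨⟨hai, haC⟩, hbs, hsI⟩
    have hInt := (hG.isDominatedIntegrand hT hX hr hsI).integrable_comp (w := f)
      f.stronglyMeasurable.aestronglyMeasurable (ae_of_all _ hf)
    have hle : ∫ x, G s x (f x) ∂ν ≤ ∫ x, (‖a₀ s x‖ * M + b₀ s x) ∂ν := by
      refine integral_mono_ae hInt ((hai.norm.mul_const M).add (hb₀.integrable hsI)) ?_
      filter_upwards [ae_restrict_mem hX] with x hx
      have h1 := hlow s hsI x hx (f x)
      have h2 : a₀ s x * ‖f x‖ ≤ ‖a₀ s x‖ * M :=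
        mul_le_mul (le_abs_self _) (hf x) (norm_nonneg _) (norm_nonneg _)
      linarith
    rw [integral_add (hai.norm.mul_const M) (hb₀.integrable hsI), integral_mul_const] at hle
    have := mul_le_mul_of_nonneg_right haC hM
    linarith
  -- General `w` are reached by simple functions that obey the same bound `M`.
  have hlim := (hG.isDominatedIntegrand hT hX hr ht).tendsto_integral (ν := ν)
    (w := fun n => hw.stronglyMeasurable_mk.approxBounded M n) (w' := w)
    (fun n => (SimpleFunc.stronglyMeasurable _).aestronglyMeasurable) (M := M)
    (fun n => ae_of_all _ fun x => hw.stronglyMeasurable_mk.norm_approxBounded_le hM n x) (by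
      filter_upwards [hw.ae_eq_mk, hwM] with x hx hxM
      rw [hx] at hxM ⊢
      exact hw.stronglyMeasurable_mk.tendsto_approxBounded_of_norm_le hxM)
  exact le_of_tendsto' hlim fun n => hsimple _ fun x =>
    hw.stronglyMeasurable_mk.norm_approxBounded_le hM n x

end Surface

end

end CrackFE

namespace CrackFE

noncomputable section

/-! ### Surface energy of subsets of lines -/

instance : NullSingletonClass H1 := Measure.nullSingletonClass_hausdorff E2 one_pos

/-- The isolated points of a set are countable. -/
theorem countable_isolated {α : Type*} [TopologicalSpace α] [SecondCountableTopology α]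
    (S : Set α) : {x ∈ S | ∃ U ∈ 𝓝 x, U ∩ S ⊆ {x}}.Countable := by
  have hB := TopologicalSpace.isBasis_countableBasis α
  have hsub : {x ∈ S | ∃ U ∈ 𝓝 x, U ∩ S ⊆ {x}} ⊆
      ⋃ b ∈ {b ∈ TopologicalSpace.countableBasis α | (b ∩ S).Subsingleton}, b ∩ S := by
    rintro x ⟨hx, U, hU, hUS⟩
    obtain ⟨b, hb, hxb, hbU⟩ := hB.mem_nhds_iff.mp hU
    simp only [mem_iUnion]
    exact ⟨b, ⟨hb, subsingleton_singleton.anti ((inter_subset_inter_left _ hbU).trans hUS)⟩, hxb,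
      hx⟩
  refine Countable.mono hsub (Countable.biUnion ?_ fun b hb => hb.2.countable)
  exact (TopologicalSpace.countable_countableBasis α).mono fun b hb => hb.1

/-- Rotation by a right angle. -/
def rot (v : E2) : E2 := !₂[-v 1, v 0]

theorem inner_eq (v w : E2) : inner ℝ v w = v 0 * w 0 + v 1 * w 1 := by
  simp [PiLp.inner_apply, Fin.sum_univ_two, mul_comm]

theorem norm_sq_eq (v : E2) : ‖v‖ ^ 2 = v 0 ^ 2 + v 1 ^ 2 := by
  rw [EuclideanSpace.norm_sq_eq, Fin.sum_univ_two]; simp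

theorem norm_rot (v : E2) : ‖rot v‖ = ‖v‖ := by
  have : ‖rot v‖ ^ 2 = ‖v‖ ^ 2 := by
    rw [norm_sq_eq, norm_sq_eq]; simp [rot]; ring
  exact (sq_eq_sq₀ (norm_nonneg _) (norm_nonneg _)).mp this

@[fun_prop]
theorem continuous_rot : Continuous rot := by
  unfold rot
  fun_prop

/-- The line through `p` with the normal vector `n`. -/
def line (p n : E2) : Set E2 := {x | inner ℝ n (x - p) = 0}

theorem isClosed_line (p n : E2) : IsClosed (line p n) :=
  isClosed_eq (by fun_prop) continuous_const

theorem isLocalEquation_line {p n : E2} (hn : ‖n‖ = 1) {x : E2} (_hx : x ∈ line p n) :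
    IsLocalEquation (line p n) x (fun y => inner ℝ n (y - p)) ∧
      ∀ w, fderiv ℝ (fun y => inner ℝ n (y - p)) x w = inner ℝ n w := by
  have hd : HasFDerivAt (fun y : E2 => inner ℝ n (y - p)) (innerSL ℝ n) x := by
    have := (innerSL ℝ n).hasFDerivAt.comp x ((hasFDerivAt_id x).sub_const p)
    exact this
  have hw : ∀ w, fderiv ℝ (fun y => inner ℝ n (y - p)) x w = inner ℝ n w := by
    intro w; rw [hd.fderiv]; rfl
  refine ⟨⟨?_, univ, isOpen_univ, mem_univ _, ?_, ?_⟩, hw⟩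
  · intro h0
    have := hw n
    rw [h0, real_inner_self_eq_norm_sq, hn] at this
    norm_num at this
  · exact (contDiff_const.inner ℝ (contDiff_id.sub contDiff_const)).contDiffOn
  · simp [line]

theorem isC1Curve_line {p n : E2} (hn : ‖n‖ = 1) : IsC1Curve (line p n) :=
  fun _ hx => ⟨_, (isLocalEquation_line hn hx).1⟩

theorem isUnitNormal_line {p n : E2} (hn : ‖n‖ = 1) {x : E2} (hx : x ∈ line p n) :
    IsUnitNormal (line p n) x n :=
  ⟨hn, _, (isLocalEquation_line hn hx).1, fun w hw => by rw [(isLocalEquation_line hn hx).2, hw]⟩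

theorem eq_smul_rot_of_inner_eq_zero {n v : E2} (hn : ‖n‖ = 1) (h : inner ℝ n v = 0) :
    v = inner ℝ (rot n) v • rot n := by
  have h1 : n 0 ^ 2 + n 1 ^ 2 = 1 := by rw [← norm_sq_eq, hn]; norm_num
  rw [inner_eq] at h
  ext i
  fin_cases i
  · simp only [inner_eq, rot]; simp
    linear_combination n 0 * h - v 0 * h1
  · simp only [inner_eq, rot]; simp
    linear_combination n 1 * h - v 1 * h1

/-- At an accumulation point of its intersection with a line, a curve has the normal of the line. -/
theorem IsUnitNormal.eq_or_eq_neg {M : Set E2} {p n x n' : E2} (hn : ‖n‖ = 1)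
    (h : IsUnitNormal M x n') {S : Set E2} (hSM : S ⊆ M) (hSL : S ⊆ line p n) (hx : x ∈ S)
    (hacc : ∀ U ∈ 𝓝 x, ¬U ∩ S ⊆ {x}) : n' = n ∨ n' = -n := by
  obtain ⟨hn', f, ⟨hf0, U, hU, hxU, hfU, hMU⟩, hker⟩ := h
  have hfz : ∀ y ∈ S, y ∈ U → f y = 0 := fun y hy hyU => by
    have : y ∈ M ∩ U := ⟨hSM hy, hyU⟩
    rw [hMU] at this
    exact this.2
  have hd : HasFDerivAt f (fderiv ℝ f x) x :=
    (((hfU x hxU).contDiffAt (hU.mem_nhds hxU)).differentiableAt one_ne_zero).hasFDerivAt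
  -- `f` vanishes at `x` and at points of the line that accumulate at `x`, so its derivative
  -- vanishes in the direction of the line.
  have hrot : fderiv ℝ f x (rot n) = 0 := by
    rw [← norm_eq_zero]
    refine le_antisymm (le_of_forall_pos_le_add fun c hc => ?_) (norm_nonneg _)
    have hlit := hd.isLittleO.bound hc
    obtain ⟨y, ⟨⟨hyb, hyU⟩, hyS⟩, hyx⟩ := not_subset.mp
      (hacc _ (inter_mem hlit (hU.mem_nhds hxU)))
    have hyx' : y - x ≠ 0 := sub_ne_zero.mpr hyx
    have hin : inner ℝ n (y - x) = 0 := by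
      have h1 : inner ℝ n (y - p) = 0 := hSL hyS
      have h2 : inner ℝ n (x - p) = 0 := hSL hx
      rw [← sub_sub_sub_cancel_right y x p, inner_sub_right, h1, h2, sub_zero]
    have hv := eq_smul_rot_of_inner_eq_zero hn hin
    set s := inner ℝ (rot n) (y - x) with hs
    have hs0 : s ≠ 0 := by
      intro h0
      rw [h0, zero_smul] at hv
      exact hyx' hv
    have hyb : ‖f y - f x - fderiv ℝ f x (y - x)‖ ≤ c * ‖y - x‖ := hyb
    rw [hfz y hyS hyU, hfz x hx hxU, sub_zero, zero_sub, norm_neg, hv, map_smul, norm_smul,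
      norm_smul, norm_rot, hn, mul_one, mul_comm c] at hyb
    rw [zero_add]
    exact le_of_mul_le_mul_left hyb (norm_pos_iff.mpr hs0)
  -- The derivative vanishes on the vectors orthogonal to `n'`. If `rot n` were not one of them,
  -- they would span the plane together with it, and the derivative would be zero.
  have hperp : inner ℝ n' (rot n) = 0 := by
    by_contra hκ
    apply hf0
    ext w
    have h1 : inner ℝ n' (w - (inner ℝ n' w / inner ℝ n' (rot n)) • rot n) = 0 := by
      rw [inner_sub_right, inner_smul_right, div_mul_cancel₀ _ hκ, sub_self]
    have h2 := hker _ h1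
    rw [map_sub, map_smul, hrot, smul_zero, sub_zero] at h2
    simpa using h2
  have h1 : n 0 ^ 2 + n 1 ^ 2 = 1 := by rw [← norm_sq_eq, hn]; norm_num
  have h2 : n' 0 ^ 2 + n' 1 ^ 2 = 1 := by rw [← norm_sq_eq, hn']; norm_num
  rw [inner_eq] at hperp
  simp [rot] at hperp
  set c := n 0 * n' 0 + n 1 * n' 1 with hc
  have e0 : n' 0 = c * n 0 := by rw [hc]; linear_combination -n 1 * hperp - n' 0 * h1
  have e1 : n' 1 = c * n 1 := by rw [hc]; linear_combination n 0 * hperp - n' 1 * h1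
  have hc2 : c ^ 2 = 1 := by
    rw [e0, e1] at h2
    linear_combination h2 - c ^ 2 * h1
  rcases sq_eq_sq_iff_eq_or_eq_neg.mp (hc2.trans (one_pow 2).symm) with h | h
  · left; ext i; fin_cases i
    · simp [e0, h]
    · simp [e1, h]
  · right; ext i; fin_cases i
    · simp [e0, h]
    · simp [e1, h]

/-- A unit normal field on `Γ` is normal to every line `H¹`-almost everywhere on its intersection
with `Γ`. -/
theorem IsUnitNormalField.measure_line_eq_zero {Γ : Set E2} {ν : E2 → E2}
    (h : IsUnitNormalField Γ ν) {p n : E2} (hn : ‖n‖ = 1) :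
    H1 {x ∈ Γ ∩ line p n | ¬(ν x = n ∨ ν x = -n)} = 0 := by
  obtain ⟨M, P, hM, rfl, -, hPM, hν⟩ := h
  -- An exceptional point lies outside its curve `M i`, which happens on a null set, or is an
  -- isolated point of the part of `P i ∩ M i` on the line, and there are countably many of those.
  have hsub : {x ∈ (⋃ i, P i) ∩ line p n | ¬(ν x = n ∨ ν x = -n)} ⊆
      ⋃ i, ((P i \ M i) ∪ {x ∈ P i ∩ M i ∩ line p n | ∃ U ∈ 𝓝 x, U ∩ (P i ∩ M i ∩ line p n) ⊆ {x}}) := by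
    rintro x ⟨⟨hx, hxL⟩, hne⟩
    obtain ⟨i, hi⟩ := mem_iUnion.mp hx
    refine mem_iUnion.mpr ⟨i, ?_⟩
    by_cases hxM : x ∈ M i
    · right
      refine ⟨⟨⟨hi, hxM⟩, hxL⟩, ?_⟩
      by_contra hacc
      push Not at hacc
      exact hne ((hν i x ⟨hi, hxM⟩).eq_or_eq_neg hn (S := P i ∩ M i ∩ line p n)
        (fun y hy => hy.1.2) (fun y hy => hy.2) ⟨⟨hi, hxM⟩, hxL⟩ hacc)
    · exact Or.inl ⟨hi, hxM⟩
  refine measure_mono_null hsub (measure_iUnion_null fun i => measure_union_null (hPM i) ?_)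
  exact (countable_isolated _).measure_zero _

/-- A measurable unit normal field for all subsets of the union of countably many lines. -/
theorem exists_isUnitNormalField {κ : Type*} [Countable κ] {p n : κ → E2} (hn : ∀ i, ‖n i‖ = 1) :
    ∃ ν : E2 → E2, Measurable ν ∧
      ∀ Γ ⊆ ⋃ i, line (p i) (n i), IsUnitNormalField Γ ν := by
  classical
  rcases isEmpty_or_nonempty κ with hκ | hκ
  · refine ⟨0, measurable_zero, fun Γ hΓ => ?_⟩
    have : Γ = ∅ := by simpa using hΓ
    subst this
    refine ⟨fun _ => ∅, fun _ => ∅, ?_, ?_, ?_, ?_, ?_⟩ <;> simp [IsC1Curve, Pairwise]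
  obtain ⟨e, he⟩ := exists_surjective_nat κ
  set L : ℕ → Set E2 := fun i => line (p (e i)) (n (e i)) with hL
  -- `Nat.find` selects the first line through `x`. The second alternative only makes the selection
  -- total; it never occurs on `Γ`.
  set q : ℕ → E2 → Prop := fun i x => x ∈ L i ∨ ∀ j, x ∉ L j with hq
  have hex : ∀ x, ∃ i, q i x := by
    intro x
    by_cases h : ∃ i, x ∈ L i
    · exact ⟨h.choose, Or.inl h.choose_spec⟩
    · exact ⟨0, Or.inr (not_exists.mp h)⟩
  have hLm : ∀ i, MeasurableSet (L i) := fun i => (isClosed_line _ _).measurableSet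
  refine ⟨fun x => n (e (Nat.find (hex x))), ?_, fun Γ hΓ => ?_⟩
  · refine Measurable.find (f := fun i _ => n (e i)) (fun i => measurable_const) (fun i => ?_) hex
    have : {x | q i x} = L i ∪ ⋂ j, (L j)ᶜ := by ext x; simp [hq]
    rw [this]
    exact (hLm i).union (MeasurableSet.iInter fun j => (hLm j).compl)
  · refine ⟨L, fun i => {x ∈ Γ | Nat.find (hex x) = i}, fun i => isC1Curve_line (hn _), ?_, ?_, ?_,
      ?_⟩
    · ext x; simp
    · intro i j hij
      exact Set.disjoint_left.mpr fun x hx hx' => hij (hx.2.symm.trans hx'.2)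
    · intro i
      have : {x ∈ Γ | Nat.find (hex x) = i} \ L i = ∅ := by
        ext x
        simp only [Set.mem_sdiff, mem_ofPred_eq, mem_empty_iff_false, iff_false, not_and, not_not]
        rintro ⟨hx, rfl⟩
        rcases Nat.find_spec (hex x) with h | h
        · exact h
        · obtain ⟨k, hk⟩ := mem_iUnion.mp (hΓ hx)
          obtain ⟨j, rfl⟩ := he k
          exact absurd hk (h j)
      rw [this, measure_empty]
    · rintro i x ⟨⟨hx, hi⟩, hxL⟩
      simp only [hi]
      exact isUnitNormal_line (hn _) hxL

variable {X : Set E2} {k : E2 → E2 → ℝ}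

theorem IsSurfaceDensity.extDensity_neg (hk : IsSurfaceDensity X k) (x n : E2) :
    extDensity X k x (-n) = extDensity X k x n := by
  unfold extDensity
  split_ifs with hx
  · have := hk.smul x hx (-1) n
    rw [neg_one_smul, abs_neg, abs_one, one_mul] at this
    rw [this]
  · rfl

theorem IsSurfaceDensity.measurable_extDensity (hk : IsSurfaceDensity X k) (hX : IsClosed X)
    {ν : E2 → E2} (hν : Measurable ν) : Measurable fun x => extDensity X k x (ν x) := by
  classical
  have hcont : ContinuousOn (fun y : E2 × E2 => ENNReal.ofReal (k y.1 y.2)) (X ×ˢ univ) :=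
    ENNReal.continuous_ofReal.comp_continuousOn hk.continuousOn
  have hm := hcont.measurable_piecewise (g := fun _ => ⊤) continuousOn_const
    (hX.measurableSet.prod MeasurableSet.univ)
  have := hm.comp (measurable_id.prodMk hν)
  convert this using 1
  funext x
  simp [extDensity, Set.piecewise]

/-- The surface energy of a subset of countably many lines can be computed with any unit normal
field. -/
theorem surfaceEnergy_eq (hk : IsSurfaceDensity X k) {κ : Type*} [Countable κ] {p n : κ → E2}
    (hn : ∀ i, ‖n i‖ = 1) {Γ : Set E2} (hΓ : Γ ⊆ ⋃ i, line (p i) (n i))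
    (hΓm : NullMeasurableSet Γ H1) {ν : E2 → E2} (hν : IsUnitNormalField Γ ν) :
    surfaceEnergy X k Γ = ∫⁻ x in Γ, extDensity X k x (ν x) ∂H1 := by
  refine le_antisymm (iInf₂_le ν hν) (le_iInf₂ fun ν' hν' => le_of_eq ?_)
  refine lintegral_congr_ae ?_
  have key : H1 (⋃ i, ({x ∈ Γ ∩ line (p i) (n i) | ¬(ν x = n i ∨ ν x = -n i)} ∪
      {x ∈ Γ ∩ line (p i) (n i) | ¬(ν' x = n i ∨ ν' x = -n i)})) = 0 :=
    measure_iUnion_null fun i => measure_union_null (hν.measure_line_eq_zero (hn i))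
      (hν'.measure_line_eq_zero (hn i))
  rw [EventuallyEq, ae_restrict_iff'₀ hΓm]
  filter_upwards [compl_mem_ae_iff.mpr key] with x hx hxΓ
  obtain ⟨i, hi⟩ := mem_iUnion.mp (hΓ hxΓ)
  have hx' := fun h => hx (mem_iUnion.mpr ⟨i, h⟩)
  simp only [mem_union, mem_ofPred_eq, mem_inter_iff, hxΓ, hi, true_and, not_or] at hx'
  have h1 : ν x = n i ∨ ν x = -n i := by
    by_contra h; exact hx' (Or.inl (not_or.mp h))
  have h2 : ν' x = n i ∨ ν' x = -n i := by
    by_contra h; exact hx' (Or.inr (not_or.mp h))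
  rcases h1 with h1 | h1 <;> rcases h2 with h2 | h2 <;> simp only [h1, h2, hk.extDensity_neg]

/-- Arc length parametrization of a segment. -/
theorem setLIntegral_openSegment {p q : E2} (hpq : p ≠ q) (f : E2 → ℝ≥0∞) :
    ∫⁻ x in openSegment ℝ p q, f x ∂H1 =
      ∫⁻ s in Ioo (0 : ℝ) 1, ENNReal.ofReal ‖q - p‖ * f (AffineMap.lineMap p q s) := by
  set γ : ℝ → E2 := fun s => AffineMap.lineMap p q s with hγ
  have hcont : Continuous γ := AffineMap.lineMap_continuous
  have hinj : Function.Injective γ := AffineMap.lineMap_injective ℝ hpq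
  have hemb : MeasurableEmbedding γ := hcont.measurableEmbedding hinj
  have himg : γ '' Ioo (0 : ℝ) 1 = openSegment ℝ p q := (openSegment_eq_image_lineMap ℝ p q).symm
  have hmeas : H1.restrict (openSegment ℝ p q) =
      ENNReal.ofReal ‖q - p‖ • (volume.restrict (Ioo (0 : ℝ) 1)).map γ := by
    ext A hA
    rw [Measure.restrict_apply hA, Measure.smul_apply, Measure.map_apply hcont.measurable hA,
      Measure.restrict_apply (hcont.measurable hA), ← himg, inter_comm, ← image_inter_preimage,
      inter_comm, hausdorffMeasure_lineMap_image, hausdorffMeasure_real, smul_eq_mul]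
    rw [ENNReal.smul_def, smul_eq_mul, ← dist_eq_norm, dist_comm, ← coe_nndist,
      ENNReal.ofReal_coe_nnreal]
  rw [hmeas, lintegral_smul_measure, hemb.lintegral_map, smul_eq_mul, lintegral_const_mul']
  exact ENNReal.ofReal_ne_top

end

end CrackFE

namespace CrackFE

noncomputable section

/-! ### Piecewise affine functions -/

/-- The affine function with the coefficients `A`. -/
def evalAff (A : M22 × E2) (x : E2) : E2 := A.1 x + A.2

theorem continuous_evalAff : Continuous fun y : (M22 × E2) × E2 => evalAff y.1 y.2 := by
  unfold evalAff
  fun_prop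

theorem continuous_evalAff_right (A : M22 × E2) : Continuous (evalAff A) := by
  unfold evalAff
  fun_prop

theorem hasFDerivAt_evalAff (A : M22 × E2) (x : E2) : HasFDerivAt (evalAff A) A.1 x :=
  A.1.hasFDerivAt.add_const _

theorem norm_evalAff_le (A : M22 × E2) {x : E2} {ρ : ℝ} (hx : ‖x‖ ≤ ρ) :
    ‖evalAff A x‖ ≤ ‖A‖ * (ρ + 1) := by
  have h1 : ‖A.1 x‖ ≤ ‖A‖ * ρ := (A.1.le_opNorm x).trans
    (mul_le_mul (norm_fst_le A) hx (norm_nonneg _) (norm_nonneg _))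
  have h2 := norm_snd_le A
  exact (norm_add_le _ _).trans (by linarith)

variable {Ω : Set E2} {c₁ c₂ ε a : ℝ} {R : RegularTriangulation Ω c₁ c₂ ε}

namespace FEFun

variable {u : FEFun R a} {A : Finset (Sym2 E2) → M22 × E2}

/-- The closed triangle of `T(u)` with the label `V`. -/
abbrev tri (u : FEFun R a) (V : Finset (Sym2 E2)) : Set E2 := convexHull ℝ (pos u.knot '' V)

/-- `A` gives the coefficients of `u` on the triangles of `T(u)`. -/
def IsCoef (u : FEFun R a) (A : Finset (Sym2 E2) → M22 × E2) : Prop :=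
  ∀ V ∈ R.cells, EqOn u.toFun (evalAff (A V)) (interior (u.tri V))

theorem exists_isCoef (u : FEFun R a) : ∃ A, u.IsCoef A := by
  have : ∀ V, ∃ A : M22 × E2, V ∈ R.cells → EqOn u.toFun (evalAff A) (interior (u.tri V)) := by
    intro V
    by_cases hV : V ∈ R.cells
    · obtain ⟨f, hf⟩ := u.affine (pos u.knot '' V) (by
        rw [RegularTriangulation.adaptive_eq]; exact ⟨V, hV, rfl⟩)
      refine ⟨(LinearMap.toContinuousLinearMap f.linear, f 0), fun _ x hx => ?_⟩
      rw [hf hx, f.decomp]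
      simp [evalAff]
    · exact ⟨0, fun h => absurd h hV⟩
  choose A hA using this
  exact ⟨A, fun V hV => hA V hV⟩

theorem isComplex (u : FEFun R a) (hΩ : interior (closure Ω) = Ω) (ha : 0 < a) :
    IsComplex Ω R.cells (pos u.knot) := R.isComplex hΩ u.isKnotChoice ha

theorem extendFrom_eq (hΩ : interior (closure Ω) = Ω) (ha : 0 < a) (hA : u.IsCoef A)
    {V : Finset (Sym2 E2)} (hV : V ∈ R.cells) {b : E2} (hb : b ∈ u.tri V) :
    extendFrom (interior (u.tri V)) u.toFun b = evalAff (A V) b := by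
  refine _root_.extendFrom_eq ?_ ?_
  · rwa [(u.isComplex hΩ ha).closure_interior_convexHull hV]
  · refine Tendsto.congr' ?_ ((continuous_evalAff_right (A V)).continuousAt.mono_left
      nhdsWithin_le_nhds)
    filter_upwards [self_mem_nhdsWithin] with x hx using (hA V hV hx).symm

/-- The vertices of `T(u)`. -/
def vertices (u : FEFun R a) : Set E2 := ⋃ V ∈ R.cells, pos u.knot '' V

theorem finite_vertices (u : FEFun R a) : u.vertices.Finite :=
  R.cells.finite_toSet.biUnion fun V _ => V.finite_toSet.image _

theorem exists_unique_of_mem_frontier (u : FEFun R a) (hΩ : interior (closure Ω) = Ω) (ha : 0 < a)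
    {x : E2} (hx : x ∈ frontier Ω) (hxv : x ∉ u.vertices) :
    ∃ V ∈ R.cells, (∃ i ∈ V, ∃ j ∈ V, i ≠ j ∧ x ∈ openSegment ℝ (pos u.knot i) (pos u.knot j)) ∧
      ∀ V' ∈ R.cells, x ∈ u.tri V' → V' = V :=
  (u.isComplex hΩ ha).exists_unique_of_mem_frontier hx fun V hV hxV =>
    hxv (mem_biUnion (x := V) hV hxV)

/-- Near a boundary point that is not a vertex, `Ω` coincides with the interior of the only triangle
that contains the point, and there `u` is affine. -/
theorem trace_eq (hΩ : interior (closure Ω) = Ω) (ha : 0 < a) (hA : u.IsCoef A)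
    {x : E2} (hx : x ∈ frontier Ω) (hxv : x ∉ u.vertices) {V : Finset (Sym2 E2)} (hV : V ∈ R.cells)
    (hxV : x ∈ u.tri V) : u.trace x = evalAff (A V) x := by
  obtain ⟨V', hV', -, huniq⟩ := u.exists_unique_of_mem_frontier hΩ ha hx hxv
  obtain rfl := huniq V hV hxV
  have h := (u.isComplex hΩ ha).nhdsWithin_eq_of_unique hV huniq
  rw [← extendFrom_eq hΩ ha hA hV hxV]
  unfold trace extendFrom
  rw [h]

theorem ae_mem_interior_tri (u : FEFun R a) (hΩ : interior (closure Ω) = Ω) (ha : 0 < a) :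
    ∀ᵐ x ∂(volume.restrict Ω), ∃ V ∈ R.cells, x ∈ interior (u.tri V) := by
  have hOpen : IsOpen Ω := by rw [← hΩ]; exact isOpen_interior
  have hnull : volume (⋃ V ∈ R.cells, frontier (u.tri V)) = 0 :=
    (measure_biUnion_null_iff R.cells.finite_toSet.countable).mpr fun V _ =>
      (convex_convexHull ℝ _).addHaar_frontier volume
  rw [ae_restrict_iff' hOpen.measurableSet]
  filter_upwards [compl_mem_ae_iff.mpr hnull] with x hx hxΩ
  have hxc := subset_closure hxΩ
  rw [(u.isComplex hΩ ha).cover] at hxc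
  simp only [mem_iUnion] at hxc
  obtain ⟨V, hV, hxV⟩ := hxc
  refine ⟨V, hV, ?_⟩
  by_contra hn
  exact hx (mem_biUnion (x := V) hV ⟨subset_closure hxV, hn⟩)

theorem restrict_eq_iUnion (u : FEFun R a) (hΩ : interior (closure Ω) = Ω) (ha : 0 < a) :
    volume.restrict Ω = volume.restrict (⋃ V : R.cells, interior (u.tri V)) := by
  have hOpen : IsOpen Ω := by rw [← hΩ]; exact isOpen_interior
  refine Measure.restrict_congr_set ?_
  have h := u.ae_mem_interior_tri hΩ ha
  rw [ae_restrict_iff' hOpen.measurableSet] at h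
  filter_upwards [h] with x hx
  refine propext ⟨fun hxΩ => ?_, fun hxU => ?_⟩
  · obtain ⟨V, hV, hxV⟩ := hx hxΩ
    exact mem_iUnion.mpr ⟨⟨V, hV⟩, hxV⟩
  · obtain ⟨V, hxV⟩ := mem_iUnion.mp hxU
    exact (u.isComplex hΩ ha).interior_convexHull_subset V.2 hxV

theorem fderiv_eq (hA : u.IsCoef A) {V : Finset (Sym2 E2)} (hV : V ∈ R.cells) {x : E2}
    (hx : x ∈ interior (u.tri V)) : fderiv ℝ u.toFun x = (A V).1 := by
  have h : u.toFun =ᶠ[𝓝 x] evalAff (A V) := by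
    filter_upwards [isOpen_interior.mem_nhds hx] with y hy using hA V hV hy
  rw [h.fderiv_eq, (hasFDerivAt_evalAff _ _).fderiv]

theorem aestronglyMeasurable_toFun (u : FEFun R a) (hΩ : interior (closure Ω) = Ω) (ha : 0 < a) :
    AEStronglyMeasurable u.toFun (volume.restrict Ω) := by
  obtain ⟨A, hA⟩ := u.exists_isCoef
  rw [u.restrict_eq_iUnion hΩ ha, aestronglyMeasurable_iUnion_iff]
  rintro ⟨V, hV⟩
  refine (continuous_evalAff_right (A V)).aestronglyMeasurable.congr ?_
  filter_upwards [ae_restrict_mem isOpen_interior.measurableSet] with x hx using (hA V hV hx).symm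

theorem aestronglyMeasurable_fderiv (u : FEFun R a) (hΩ : interior (closure Ω) = Ω) (ha : 0 < a) :
    AEStronglyMeasurable (fderiv ℝ u.toFun) (volume.restrict Ω) := by
  obtain ⟨A, hA⟩ := u.exists_isCoef
  rw [u.restrict_eq_iUnion hΩ ha, aestronglyMeasurable_iUnion_iff]
  rintro ⟨V, hV⟩
  refine (aestronglyMeasurable_const (b := (A V).1)).congr ?_
  filter_upwards [ae_restrict_mem isOpen_interior.measurableSet] with x hx
  exact (fderiv_eq hA hV hx).symm

theorem isClosed_tri (u : FEFun R a) (V : Finset (Sym2 E2)) : IsClosed (u.tri V) :=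
  (V.finite_toSet.image _).isClosed_convexHull (𝕜 := ℝ)

theorem ae_notMem_vertices (u : FEFun R a) (S : Set E2) :
    ∀ᵐ x ∂(H1.restrict S), x ∉ u.vertices :=
  ae_restrict_of_ae (compl_mem_ae_iff.mpr (u.finite_vertices.measure_zero _))

theorem exists_mem_tri (u : FEFun R a) (hΩ : interior (closure Ω) = Ω) (ha : 0 < a) {x : E2}
    (hx : x ∈ frontier Ω) : ∃ V ∈ R.cells, x ∈ u.tri V := by
  have hxc := frontier_subset_closure hx
  rw [(u.isComplex hΩ ha).cover] at hxc
  simpa only [mem_iUnion, exists_prop] using hxc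

theorem aestronglyMeasurable_trace (u : FEFun R a) (hΩ : interior (closure Ω) = Ω) (ha : 0 < a)
    {S : Set E2} (hS : MeasurableSet S) (hSf : S ⊆ frontier Ω) :
    AEStronglyMeasurable u.trace (H1.restrict S) := by
  obtain ⟨A, hA⟩ := u.exists_isCoef
  have hcov : S = ⋃ V : R.cells, u.tri V ∩ S := by
    ext x
    simp only [mem_iUnion, mem_inter_iff, Subtype.exists, exists_prop]
    constructor
    · intro hx
      obtain ⟨V, hV, hxV⟩ := u.exists_mem_tri hΩ ha (hSf hx)
      exact ⟨V, hV, hxV, hx⟩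
    · rintro ⟨V, hV, -, hx⟩; exact hx
  rw [hcov, aestronglyMeasurable_iUnion_iff]
  rintro ⟨V, hV⟩
  refine (continuous_evalAff_right (A V)).aestronglyMeasurable.congr ?_
  filter_upwards [ae_restrict_mem ((u.isClosed_tri V).measurableSet.inter hS),
    u.ae_notMem_vertices _] with x hx hxv
  exact (trace_eq hΩ ha hA (hSf hx.2) hxv hV hx.1).symm

/-! ### The jump set -/

end FEFun

/-- The relative interior of the edge with the label `e`. -/
def openEdge {ι : Type*} (P : ι → E2) (e : Sym2 ι) : Set E2 :=
  e.lift ⟨fun i j => openSegment ℝ (P i) (P j), fun _ _ => openSegment_symm ℝ _ _⟩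

/-- The edge with the label `e`. -/
def closedEdge {ι : Type*} (P : ι → E2) (e : Sym2 ι) : Set E2 :=
  e.lift ⟨fun i j => segment ℝ (P i) (P j), fun _ _ => segment_symm ℝ _ _⟩

theorem openEdge_mk {ι : Type*} (P : ι → E2) (i j : ι) :
    openEdge P s(i, j) = openSegment ℝ (P i) (P j) := rfl

theorem closedEdge_mk {ι : Type*} (P : ι → E2) (i j : ι) :
    closedEdge P s(i, j) = segment ℝ (P i) (P j) := rfl

theorem segment_eq_image_Icc_lineMap (p q : E2) :
    segment ℝ p q = (fun s : ℝ => AffineMap.lineMap p q s) '' Icc 0 1 :=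
  segment_eq_image_lineMap ℝ p q

theorem isCompact_segment (p q : E2) : IsCompact (segment ℝ p q) := by
  rw [segment_eq_image_Icc_lineMap]
  exact isCompact_Icc.image AffineMap.lineMap_continuous

theorem measurableSet_openSegment (p q : E2) : MeasurableSet (openSegment ℝ p q) := by
  by_cases hpq : p = q
  · subst hpq
    rw [openSegment_same]
    exact measurableSet_singleton _
  · have : openSegment ℝ p q = segment ℝ p q \ {p, q} := by
      ext x
      constructor
      · intro hx
        refine ⟨openSegment_subset_segment _ _ _ hx, ?_⟩
        rintro (rfl | rfl)
        · exact hpq (left_mem_openSegment_iff.mp hx)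
        · exact hpq (right_mem_openSegment_iff.mp hx)
      · rintro ⟨hx, hne⟩
        simp only [mem_insert_iff, mem_singleton_iff, not_or] at hne
        exact mem_openSegment_of_ne_left_right (Ne.symm hne.1) (Ne.symm hne.2) hx
    rw [this]
    exact (isCompact_segment p q).isClosed.measurableSet.diff (by simp)

namespace FEFun

variable {u : FEFun R a} {A : Finset (Sym2 E2) → M22 × E2}

/-- The labels of the edges across which `u` jumps. -/
def jumpEdges (u : FEFun R a) (A : Finset (Sym2 E2) → M22 × E2) : Set (Sym2 (Sym2 E2)) :=
  {e | ∃ V ∈ R.cells, ∃ V' ∈ R.cells, V ≠ V' ∧ ∃ i j, i ∈ V ∧ j ∈ V ∧ i ∈ V' ∧ j ∈ V' ∧ i ≠ j ∧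
    e = s(i, j) ∧ ∃ b ∈ segment ℝ (pos u.knot i) (pos u.knot j),
      evalAff (A V) b ≠ evalAff (A V') b}

theorem finite_jumpEdges (u : FEFun R a) (A : Finset (Sym2 E2) → M22 × E2) :
    (u.jumpEdges A).Finite := by
  refine Finite.subset (s := ⋃ V ∈ R.cells, (V.sym2 : Set (Sym2 (Sym2 E2)))) ?_ ?_
  · exact R.cells.finite_toSet.biUnion fun V _ => V.sym2.finite_toSet
  · rintro _ ⟨V, hV, V', -, -, i, j, hi, hj, -, -, -, rfl, -⟩
    exact mem_biUnion (x := V) hV (by simp [hi, hj])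

theorem segment_subset_tri (u : FEFun R a) {V : Finset (Sym2 E2)} {i j : Sym2 E2} (hi : i ∈ V)
    (hj : j ∈ V) : segment ℝ (pos u.knot i) (pos u.knot j) ⊆ u.tri V :=
  segment_subset_convexHull (mem_image_of_mem _ hi) (mem_image_of_mem _ hj)

/-- The limits of `u` from two triangles are the two affine extensions, and `IsComplex.injOn` turns
common vertices into common labels. The jump set becomes a finite union of segments with labels. -/
theorem jumpSet_eq (hΩ : interior (closure Ω) = Ω) (ha : 0 < a) (hA : u.IsCoef A) :
    u.jumpSet = ⋃ e ∈ u.jumpEdges A, closedEdge (pos u.knot) e := by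
  have hC := u.isComplex hΩ ha
  ext s
  simp only [mem_iUnion]
  constructor
  · rintro ⟨S, hS, S', hS', hne, x, hx, y, hy, hxy, hs, b, hb, hjump⟩
    rw [RegularTriangulation.adaptive_eq] at hS hS'
    obtain ⟨V, hV, rfl⟩ := hS
    obtain ⟨V', hV', rfl⟩ := hS'
    obtain ⟨⟨i, hi, rfl⟩, ⟨i', hi', hii⟩⟩ := hx
    obtain ⟨⟨j, hj, rfl⟩, ⟨j', hj', hjj⟩⟩ := hy
    obtain rfl := hC.injOn hV' hV hi' hi hii
    obtain rfl := hC.injOn hV' hV hj' hj hjj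
    refine ⟨s(i', j'), ⟨V, hV, V', hV', fun h => hne (by rw [h]), i', j', hi, hj, hi', hj',
      fun h => hxy (by rw [h]), rfl, b, hb, ?_⟩, hs⟩
    have e1 := extendFrom_eq hΩ ha hA hV (u.segment_subset_tri hi hj hb)
    have e2 := extendFrom_eq hΩ ha hA hV' (u.segment_subset_tri hi' hj' hb)
    rw [← e1, ← e2]
    exact hjump
  · rintro ⟨e, ⟨V, hV, V', hV', hne, i, j, hi, hj, hi', hj', hij, rfl, b, hb, hjump⟩, hs⟩
    refine ⟨pos u.knot '' V, ?_, pos u.knot '' V', ?_, ?_, pos u.knot i,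
      ⟨mem_image_of_mem _ hi, mem_image_of_mem _ hi'⟩, pos u.knot j,
      ⟨mem_image_of_mem _ hj, mem_image_of_mem _ hj'⟩, ?_, hs, b, hb, ?_⟩
    · rw [RegularTriangulation.adaptive_eq]; exact ⟨V, hV, rfl⟩
    · rw [RegularTriangulation.adaptive_eq]; exact ⟨V', hV', rfl⟩
    · intro h
      apply hne
      have hsub : ∀ {V V'}, V ∈ R.cells → V' ∈ R.cells → pos u.knot '' V = pos u.knot '' V' →
          V ⊆ V' := by
        intro V V' hV hV' h l hl
        obtain ⟨l', hl', e⟩ := h.subset (mem_image_of_mem _ (Finset.mem_coe.mpr hl))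
        rw [← hC.injOn hV' hV hl' hl e]
        exact hl'
      exact Finset.Subset.antisymm (hsub hV hV' h) (hsub hV' hV h.symm)
    · intro h
      exact hij (hC.injOn hV hV hi hj h)
    · have e1 := extendFrom_eq hΩ ha hA hV (u.segment_subset_tri hi hj hb)
      have e2 := extendFrom_eq hΩ ha hA hV' (u.segment_subset_tri hi' hj' hb)
      rw [← e1, ← e2] at hjump
      exact hjump

theorem isClosed_jumpSet (u : FEFun R a) (hΩ : interior (closure Ω) = Ω) (ha : 0 < a) :
    IsClosed u.jumpSet := by
  obtain ⟨A, hA⟩ := u.exists_isCoef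
  rw [jumpSet_eq hΩ ha hA]
  refine (u.finite_jumpEdges A).isClosed_biUnion fun e _ => ?_
  induction e with
  | _ i j => exact (isCompact_segment _ _).isClosed

theorem measurableSet_trace_ne (u : FEFun R a) (hΩ : interior (closure Ω) = Ω) (ha : 0 < a)
    {D : Set E2} (hD : MeasurableSet D) (hDf : D ⊆ frontier Ω) {g : E2 → E2}
    (hg : ContinuousOn g (closure Ω)) : MeasurableSet {x ∈ D | u.trace x ≠ g x} := by
  obtain ⟨A, hA⟩ := u.exists_isCoef
  have hopen : ∀ V, MeasurableSet {x ∈ closure Ω | evalAff (A V) x ≠ g x} := by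
    intro V
    have hc : ContinuousOn (fun x => evalAff (A V) x - g x) (closure Ω) :=
      (continuous_evalAff_right (A V)).continuousOn.sub hg
    obtain ⟨O, hO, hOe⟩ := continuousOn_iff'.mp hc {0}ᶜ isOpen_compl_singleton
    have : {x ∈ closure Ω | evalAff (A V) x ≠ g x} =
        (fun x => evalAff (A V) x - g x) ⁻¹' {0}ᶜ ∩ closure Ω := by
      ext x; simp [sub_eq_zero, and_comm]
    rw [this, hOe]
    exact hO.measurableSet.inter isClosed_closure.measurableSet
  set E := {x ∈ D | u.trace x ≠ g x} with hE
  -- Apart from the finitely many vertices, the trace is affine on each triangle, and the set where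
  -- an affine function differs from `g` is relatively open in `closure Ω`.
  have hsplit : E = (E ∩ u.vertices) ∪ (⋃ V ∈ R.cells,
      (u.tri V ∩ {x ∈ closure Ω | evalAff (A V) x ≠ g x}) ∩ (D \ u.vertices)) := by
    ext x
    simp only [mem_union, mem_iUnion, mem_inter_iff, exists_prop, hE]
    constructor
    · rintro ⟨hxD, hne⟩
      by_cases hxv : x ∈ u.vertices
      · exact Or.inl ⟨⟨hxD, hne⟩, hxv⟩
      · obtain ⟨V, hV, hxV⟩ := u.exists_mem_tri hΩ ha (hDf hxD)
        refine Or.inr ⟨V, hV, ⟨hxV, frontier_subset_closure (hDf hxD), ?_⟩, hxD, hxv⟩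
        rwa [← trace_eq hΩ ha hA (hDf hxD) hxv hV hxV]
    · rintro (⟨h, -⟩ | ⟨V, hV, ⟨hxV, -, hne⟩, hxD, hxv⟩)
      · exact h
      · refine ⟨hxD, ?_⟩
        rwa [trace_eq hΩ ha hA (hDf hxD) hxv hV hxV]
  rw [hsplit]
  refine ((u.finite_vertices.subset inter_subset_right).measurableSet).union ?_
  refine R.cells.measurableSet_biUnion fun V _ => ?_
  exact ((u.isClosed_tri V).measurableSet.inter (hopen V)).inter
    (hD.diff u.finite_vertices.measurableSet)

end FEFun

end

end CrackFE

namespace CrackFE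

noncomputable section

/-! ### Convergence of piecewise affine functions -/

theorem tendsto_evalAff {An : ℕ → M22 × E2} {A : M22 × E2} (h : Tendsto An atTop (𝓝 A))
    {x : ℕ → E2} {y : E2} (hx : Tendsto x atTop (𝓝 y)) :
    Tendsto (fun n => evalAff (An n) (x n)) atTop (𝓝 (evalAff A y)) := by
  have h1 : Tendsto (fun n => (An n).1 (x n)) atTop (𝓝 (A.1 y)) :=
    (isBoundedBilinearMap_apply (𝕜 := ℝ) (E := E2) (F := E2)).continuous.continuousAt.tendsto.comp
      (h.fst_nhds.prodMk_nhds hx)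
  exact h1.add h.snd_nhds

section Complex

variable {ι : Type*} {Ω : Set E2} {𝒞 : Finset (Finset ι)} {P : ι → E2} {Pn : ℕ → ι → E2}

theorem IsComplex.eventually_subset_interior (h : IsComplex Ω 𝒞 P) {V : Finset ι} (hV : V ∈ 𝒞)
    (hP : ∀ l ∈ V, Tendsto (fun n => Pn n l) atTop (𝓝 (P l))) {K : Set E2} (hK : IsCompact K)
    (hKV : K ⊆ interior (convexHull ℝ (P '' V))) :
    ∀ᶠ n in atTop, K ⊆ interior (convexHull ℝ (Pn n '' V)) := by
  classical
  obtain ⟨i, j, k, hij, hik, hjk, rfl⟩ := h.exists_triple hV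
  have hA := h.area_ne_zero hV hij hik hjk
  simp only [Finset.coe_insert, Finset.coe_singleton, image_insert_eq, image_singleton] at hKV ⊢
  exact eventually_mem_interior_convexHull (hP i (by simp)) (hP j (by simp)) (hP k (by simp)) hA
    hK hKV

/-- The weights of `x` in a nearby triangle, placed at the limit vertices, give points of the limit
triangle arbitrarily close to `x`; that triangle is closed. -/
theorem mem_convexHull_of_frequently {V : Finset ι}
    (hP : ∀ l ∈ V, Tendsto (fun n => Pn n l) atTop (𝓝 (P l))) {x : E2}
    (hx : ∃ᶠ n in atTop, x ∈ convexHull ℝ (Pn n '' V)) : x ∈ convexHull ℝ (P '' V) := by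
  rw [← ((V.finite_toSet.image P).isClosed_convexHull (𝕜 := ℝ)).closure_eq, Metric.mem_closure_iff]
  intro η hη
  have hev : ∀ᶠ n in atTop, ∀ l ∈ V, dist (Pn n l) (P l) < η / 2 :=
    (Finset.eventually_all V).mpr fun l hl => (Metric.tendsto_nhds.mp (hP l hl)) _ (half_pos hη)
  obtain ⟨n, hxn, hn⟩ := (hx.and_eventually hev).exists
  obtain ⟨c, hc, rfl⟩ := mem_convexHull_image_iff.mp hxn
  refine ⟨∑ l ∈ V, c l • P l, mem_convexHull_image_iff.mpr ⟨c, hc, rfl⟩, ?_⟩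
  rw [dist_eq_norm, ← Finset.sum_sub_distrib]
  refine lt_of_le_of_lt ?_ (half_lt_self hη)
  calc ‖∑ l ∈ V, (c l • Pn n l - c l • P l)‖ ≤ ∑ l ∈ V, c l * (η / 2) := by
        refine norm_sum_le_of_le V fun l hl => ?_
        rw [← smul_sub, norm_smul, Real.norm_of_nonneg (hc.nonneg l), ← dist_eq_norm]
        exact mul_le_mul_of_nonneg_left (hn l hl).le (hc.nonneg l)
    _ = η / 2 := by rw [← Finset.sum_mul, hc.sum_eq, one_mul]

/-- Otherwise `x` lies infinitely often in a triangle with another label. There are finitely many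
labels, so one of them recurs, and its limit triangle contains `x`, against uniqueness. -/
theorem IsComplex.eventually_mem_of_unique (hn : ∀ n, IsComplex Ω 𝒞 (Pn n))
    (hP : ∀ V ∈ 𝒞, ∀ l ∈ V, Tendsto (fun n => Pn n l) atTop (𝓝 (P l))) {V : Finset ι} {x : E2}
    (hx : x ∈ closure Ω) (huniq : ∀ V' ∈ 𝒞, x ∈ convexHull ℝ (P '' V') → V' = V) :
    ∀ᶠ n in atTop, x ∈ convexHull ℝ (Pn n '' V) := by
  by_contra hnot
  have hfreq : ∃ᶠ n in atTop, ∃ V' ∈ 𝒞, V' ≠ V ∧ x ∈ convexHull ℝ (Pn n '' V') := by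
    refine (not_eventually.mp hnot).mono fun n hxn => ?_
    have := hx
    rw [(hn n).cover] at this
    simp only [mem_iUnion] at this
    obtain ⟨V', hV', hxV'⟩ := this
    exact ⟨V', hV', by rintro rfl; exact hxn hxV', hxV'⟩
  obtain ⟨V', hV', hV'f⟩ : ∃ V' ∈ 𝒞, ∃ᶠ n in atTop, V' ≠ V ∧ x ∈ convexHull ℝ (Pn n '' V') := by
    by_contra hall
    push Not at hall
    have hev : ∀ᶠ n in atTop, ∀ V' ∈ 𝒞, ¬(V' ≠ V ∧ x ∈ convexHull ℝ (Pn n '' V')) :=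
      (Finset.eventually_all 𝒞).mpr fun V' hV' => by
        have := hall V' hV'
        filter_upwards [this] with n hn hcon
        exact hn hcon.1 hcon.2
    obtain ⟨n, ⟨V', hV', h1⟩, h2⟩ := (hfreq.and_eventually hev).exists
    exact h2 V' hV' h1
  obtain ⟨n, hne, -⟩ := hV'f.exists
  exact hne (huniq V' hV' (mem_convexHull_of_frequently (hP V' hV') (hV'f.mono fun n h => h.2)))

end Complex

variable {Ω : Set E2} {c₁ c₂ ε a : ℝ} {R : RegularTriangulation Ω c₁ c₂ ε}

/-- Convergence of the knots and of the coefficients. -/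
structure FEConverges (un : ℕ → FEFun R a) (An : ℕ → Finset (Sym2 E2) → M22 × E2) (u : FEFun R a)
    (A : Finset (Sym2 E2) → M22 × E2) : Prop where
  coef_seq : ∀ n, (un n).IsCoef (An n)
  coef : u.IsCoef A
  tendsto_pos : ∀ V ∈ R.cells, ∀ l ∈ V,
    Tendsto (fun n => pos (un n).knot l) atTop (𝓝 (pos u.knot l))
  tendsto_coef : ∀ V ∈ R.cells, Tendsto (fun n => An n V) atTop (𝓝 (A V))

namespace FEFun

variable {u : FEFun R a} {A : Finset (Sym2 E2) → M22 × E2}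

theorem ae_norm_toFun_le (hΩ : interior (closure Ω) = Ω) (ha : 0 < a) (hA : u.IsCoef A) {K ρ : ℝ}
    (hK : ∀ V ∈ R.cells, ‖A V‖ ≤ K) (hρ : ∀ x ∈ closure Ω, ‖x‖ ≤ ρ) :
    ∀ᵐ x ∂(volume.restrict Ω), ‖u.toFun x‖ ≤ K * (ρ + 1) := by
  filter_upwards [u.ae_mem_interior_tri hΩ ha] with x ⟨V, hV, hx⟩
  have hxΩ : ‖x‖ ≤ ρ := hρ x ((u.isComplex hΩ ha).convexHull_subset hV (interior_subset hx))
  rw [hA V hV hx]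
  exact (norm_evalAff_le _ hxΩ).trans
    (mul_le_mul_of_nonneg_right (hK V hV) (by linarith [norm_nonneg x]))

theorem ae_norm_fderiv_le (hΩ : interior (closure Ω) = Ω) (ha : 0 < a) (hA : u.IsCoef A) {K : ℝ}
    (hK : ∀ V ∈ R.cells, ‖A V‖ ≤ K) :
    ∀ᵐ x ∂(volume.restrict Ω), ‖fderiv ℝ u.toFun x‖ ≤ K := by
  filter_upwards [u.ae_mem_interior_tri hΩ ha] with x ⟨V, hV, hx⟩
  rw [fderiv_eq hA hV hx]
  exact (norm_fst_le _).trans (hK V hV)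

theorem ae_norm_trace_le (hΩ : interior (closure Ω) = Ω) (ha : 0 < a) (hA : u.IsCoef A) {K ρ : ℝ}
    (hK : ∀ V ∈ R.cells, ‖A V‖ ≤ K) (hρ : ∀ x ∈ closure Ω, ‖x‖ ≤ ρ) {S : Set E2}
    (hS : MeasurableSet S) (hSf : S ⊆ frontier Ω) :
    ∀ᵐ x ∂(H1.restrict S), ‖u.trace x‖ ≤ K * (ρ + 1) := by
  filter_upwards [ae_restrict_mem hS, u.ae_notMem_vertices S] with x hx hxv
  have hxΩ : ‖x‖ ≤ ρ := hρ x (frontier_subset_closure (hSf hx))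
  obtain ⟨V, hV, hxV⟩ := u.exists_mem_tri hΩ ha (hSf hx)
  rw [trace_eq hΩ ha hA (hSf hx) hxv hV hxV]
  exact (norm_evalAff_le _ hxΩ).trans
    (mul_le_mul_of_nonneg_right (hK V hV) (by linarith [norm_nonneg x]))

end FEFun

/-! ### Limits of functions, gradients, traces and jump edges. -/

namespace FEConverges

variable {un : ℕ → FEFun R a} {An : ℕ → Finset (Sym2 E2) → M22 × E2} {u : FEFun R a}
  {A : Finset (Sym2 E2) → M22 × E2}

theorem exists_bound (h : FEConverges un An u A) : ∃ K, ∀ n, ∀ V ∈ R.cells, ‖An n V‖ ≤ K := by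
  have : ∀ V, ∃ K, 0 ≤ K ∧ (V ∈ R.cells → ∀ n, ‖An n V‖ ≤ K) := by
    intro V
    by_cases hV : V ∈ R.cells
    · obtain ⟨K, hK⟩ := (h.tendsto_coef V hV).norm.bddAbove_range
      exact ⟨K, (norm_nonneg _).trans (hK ⟨0, rfl⟩), fun _ n => hK ⟨n, rfl⟩⟩
    · exact ⟨0, le_rfl, fun hV' => absurd hV' hV⟩
  choose K hK0 hK using this
  exact ⟨∑ V ∈ R.cells, K V, fun n V hV => (hK V hV n).trans
    (Finset.single_le_sum (fun V _ => hK0 V) hV)⟩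

theorem tendsto_evalAff (h : FEConverges un An u A) {V : Finset (Sym2 E2)} (hV : V ∈ R.cells)
    {x : ℕ → E2} {y : E2} (hx : Tendsto x atTop (𝓝 y)) :
    Tendsto (fun n => evalAff (An n V) (x n)) atTop (𝓝 (evalAff (A V) y)) :=
  _root_.CrackFE.tendsto_evalAff (h.tendsto_coef V hV) hx

theorem eventually_mem_interior_tri (h : FEConverges un An u A) (hΩ : interior (closure Ω) = Ω)
    (ha : 0 < a) {V : Finset (Sym2 E2)} (hV : V ∈ R.cells) {x : E2}
    (hx : x ∈ interior (u.tri V)) : ∀ᶠ n in atTop, x ∈ interior ((un n).tri V) := by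
  have := (u.isComplex hΩ ha).eventually_subset_interior hV (h.tendsto_pos V hV)
    isCompact_singleton (singleton_subset_iff.mpr hx)
  filter_upwards [this] with n hn using hn rfl

/-- Almost every point is interior to a triangle of the limit and therefore, eventually, to the
moving triangle with the same label, where only the coefficients matter. -/
theorem ae_tendsto_toFun (h : FEConverges un An u A) (hΩ : interior (closure Ω) = Ω) (ha : 0 < a) :
    ∀ᵐ x ∂(volume.restrict Ω), Tendsto (fun n => (un n).toFun x) atTop (𝓝 (u.toFun x)) := by
  filter_upwards [u.ae_mem_interior_tri hΩ ha] with x ⟨V, hV, hx⟩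
  rw [h.coef V hV hx]
  refine (h.tendsto_evalAff hV tendsto_const_nhds).congr' ?_
  filter_upwards [h.eventually_mem_interior_tri hΩ ha hV hx] with n hn
  exact (h.coef_seq n V hV hn).symm

theorem ae_tendsto_fderiv (h : FEConverges un An u A) (hΩ : interior (closure Ω) = Ω)
    (ha : 0 < a) : ∀ᵐ x ∂(volume.restrict Ω),
      Tendsto (fun n => fderiv ℝ (un n).toFun x) atTop (𝓝 (fderiv ℝ u.toFun x)) := by
  filter_upwards [u.ae_mem_interior_tri hΩ ha] with x ⟨V, hV, hx⟩
  rw [FEFun.fderiv_eq h.coef hV hx]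
  refine ((continuous_fst.tendsto _).comp (h.tendsto_coef V hV)).congr' ?_
  filter_upwards [h.eventually_mem_interior_tri hΩ ha hV hx] with n hn
  exact (FEFun.fderiv_eq (h.coef_seq n) hV hn).symm

/-- The only triangle of the limit at `x` determines the label of a triangle that contains `x`
eventually; the traces are then given by the coefficients of this one label. -/
theorem tendsto_trace (h : FEConverges un An u A) (hΩ : interior (closure Ω) = Ω) (ha : 0 < a)
    {x : E2} (hx : x ∈ frontier Ω) (hxv : x ∉ u.vertices) (hxvn : ∀ n, x ∉ (un n).vertices) :
    Tendsto (fun n => (un n).trace x) atTop (𝓝 (u.trace x)) := by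
  obtain ⟨V, hV, -, huniq⟩ := u.exists_unique_of_mem_frontier hΩ ha hx hxv
  have hxV : x ∈ u.tri V := by
    obtain ⟨V', hV', hxV'⟩ := u.exists_mem_tri hΩ ha hx
    rwa [← huniq V' hV' hxV']
  rw [FEFun.trace_eq hΩ ha h.coef hx hxv hV hxV]
  refine (h.tendsto_evalAff hV tendsto_const_nhds).congr' ?_
  filter_upwards [IsComplex.eventually_mem_of_unique (fun n => (un n).isComplex hΩ ha)
    h.tendsto_pos (frontier_subset_closure hx) huniq] with n hn
  exact (FEFun.trace_eq hΩ ha (h.coef_seq n) hx (hxvn n) hV hn).symm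

theorem ae_tendsto_trace (h : FEConverges un An u A) (hΩ : interior (closure Ω) = Ω) (ha : 0 < a)
    {S : Set E2} (hS : MeasurableSet S) (hSf : S ⊆ frontier Ω) :
    ∀ᵐ x ∂(H1.restrict S), Tendsto (fun n => (un n).trace x) atTop (𝓝 (u.trace x)) := by
  filter_upwards [ae_restrict_mem hS, u.ae_notMem_vertices S,
    ae_all_iff.mpr fun n => (un n).ae_notMem_vertices S] with x hx h1 h2
  exact h.tendsto_trace hΩ ha (hSf hx) h1 h2

/-- Convergent coefficients are bounded and `Ω` is bounded, so the arguments of all three integrands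
stay in a bounded set, on which the integrands are dominated. -/
theorem tendsto_elasticEnergy (h : FEConverges un An u A) (hΩ : interior (closure Ω) = Ω)
    (ha : 0 < a) {S : Set E2} (hS : MeasurableSet S) (hSf : S ⊆ frontier Ω) {W : E2 → M22 → ℝ}
    {F G : ℝ → E2 → E2 → ℝ} {t : ℝ} (hW : IsDominatedIntegrand (volume.restrict Ω) W)
    (hF : IsDominatedIntegrand (volume.restrict Ω) (F t))
    (hG : IsDominatedIntegrand (H1.restrict S) (G t)) :
    Tendsto (fun n => (un n).elasticEnergy S W F G t) atTop (𝓝 (u.elasticEnergy S W F G t)) := by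
  obtain ⟨K, hK⟩ := h.exists_bound
  obtain ⟨ρ, hρ⟩ := (u.isComplex hΩ ha).isCompact_closure.isBounded.exists_norm_le
  refine Tendsto.sub (Tendsto.sub ?_ ?_) ?_
  · exact hW.tendsto_integral (fun n => (un n).aestronglyMeasurable_fderiv hΩ ha)
      (fun n => FEFun.ae_norm_fderiv_le hΩ ha (h.coef_seq n) (hK n)) (h.ae_tendsto_fderiv hΩ ha)
  · exact hF.tendsto_integral (fun n => (un n).aestronglyMeasurable_toFun hΩ ha)
      (fun n => FEFun.ae_norm_toFun_le hΩ ha (h.coef_seq n) (hK n) hρ) (h.ae_tendsto_toFun hΩ ha)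
  · exact hG.tendsto_integral (fun n => (un n).aestronglyMeasurable_trace hΩ ha hS hSf)
      (fun n => FEFun.ae_norm_trace_le hΩ ha (h.coef_seq n) (hK n) hρ hS hSf)
      (h.ae_tendsto_trace hΩ ha hS hSf)

/-- The edges across which the limit jumps are jump edges of the sequence eventually. -/
theorem eventually_mem_jumpEdges (h : FEConverges un An u A) {e : Sym2 (Sym2 E2)}
    (he : e ∈ u.jumpEdges A) : ∀ᶠ n in atTop, e ∈ (un n).jumpEdges (An n) := by
  obtain ⟨V, hV, V', hV', hne, i, j, hi, hj, hi', hj', hij, rfl, b, hb, hjump⟩ := he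
  obtain ⟨s, t, hs, ht, hst, rfl⟩ := hb
  -- The point of the moving edge with the same parameters `s`, `t` as `b` is a witness of the jump,
  -- since the jump there converges to a non-zero vector.
  have hbn : Tendsto (fun n => s • pos (un n).knot i + t • pos (un n).knot j) atTop
      (𝓝 (s • pos u.knot i + t • pos u.knot j)) :=
    ((h.tendsto_pos V hV i hi).const_smul s).add ((h.tendsto_pos V hV j hj).const_smul t)
  have hsub := (h.tendsto_evalAff hV hbn).sub (h.tendsto_evalAff hV' hbn)
  have hev := hsub.eventually_ne (sub_ne_zero.mpr hjump)
  filter_upwards [hev] with n hn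
  exact ⟨V, hV, V', hV', hne, i, j, hi, hj, hi', hj', hij, rfl, _, ⟨s, t, hs, ht, hst, rfl⟩,
    sub_ne_zero.mp hn⟩

theorem tendsto_lineMap (h : FEConverges un An u A) {V : Finset (Sym2 E2)} (hV : V ∈ R.cells)
    {i j : Sym2 E2} (hi : i ∈ V) (hj : j ∈ V) (s : ℝ) :
    Tendsto (fun n => (AffineMap.lineMap (pos (un n).knot i) (pos (un n).knot j) s : E2)) atTop
      (𝓝 (AffineMap.lineMap (pos u.knot i) (pos u.knot j) s)) := by
  simp only [AffineMap.lineMap_apply_module]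
  exact ((h.tendsto_pos V hV i hi).const_smul _).add ((h.tendsto_pos V hV j hj).const_smul _)

/-- A point of a jump edge of the limit is the limit of the points with the same parameter on jump
edges of the sequence, so closed constraints on the jump set persist. -/
theorem jumpSet_subset (h : FEConverges un An u A) (hΩ : interior (closure Ω) = Ω) (ha : 0 < a)
    {C : Set E2} (hC : IsClosed C) (hn : ∀ n, (un n).jumpSet ⊆ C) : u.jumpSet ⊆ C := by
  rw [FEFun.jumpSet_eq hΩ ha h.coef]
  refine iUnion₂_subset fun e he => ?_
  have hev := h.eventually_mem_jumpEdges he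
  obtain ⟨V, hV, V', hV', hne, i, j, hi, hj, hi', hj', hij, rfl, -⟩ := he
  rw [closedEdge_mk, segment_eq_image_Icc_lineMap]
  rintro _ ⟨s, hs, rfl⟩
  refine hC.mem_of_tendsto (h.tendsto_lineMap hV hi hj s) ?_
  filter_upwards [hev] with n hen
  refine hn n ?_
  rw [FEFun.jumpSet_eq hΩ ha (h.coef_seq n)]
  refine mem_biUnion hen ?_
  rw [closedEdge_mk, segment_eq_image_Icc_lineMap]
  exact ⟨s, hs, rfl⟩

end FEConverges

end

end CrackFE

namespace CrackFE

noncomputable section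

/-! ### Lower semicontinuity of the surface energy -/

/-- A unit vector that is orthogonal to `q - p`. -/
def unitNormal (p q : E2) : E2 := ‖q - p‖⁻¹ • rot (q - p)

theorem norm_unitNormal {p q : E2} (h : p ≠ q) : ‖unitNormal p q‖ = 1 := by
  have : ‖q - p‖ ≠ 0 := norm_ne_zero_iff.mpr (sub_ne_zero.mpr h.symm)
  rw [unitNormal, norm_smul, norm_rot, norm_inv, norm_norm, inv_mul_cancel₀ this]

theorem segment_subset_line (p q : E2) : segment ℝ p q ⊆ line p (unitNormal p q) := by
  rw [segment_eq_image_Icc_lineMap]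
  rintro _ ⟨s, -, rfl⟩
  have hrot : ∀ v : E2, inner ℝ (rot v) v = 0 := fun v => by
    rw [inner_eq]; simp [rot]; ring
  change inner ℝ (unitNormal p q) (AffineMap.lineMap p q s - p) = 0
  rw [AffineMap.lineMap_apply, vsub_eq_sub, vadd_eq_add, add_sub_cancel_right, unitNormal,
    inner_smul_left, inner_smul_right, hrot]
  simp

theorem tendsto_unitNormal {p q : E2} (h : p ≠ q) {pn qn : ℕ → E2} (hp : Tendsto pn atTop (𝓝 p))
    (hq : Tendsto qn atTop (𝓝 q)) :
    Tendsto (fun n => unitNormal (pn n) (qn n)) atTop (𝓝 (unitNormal p q)) := by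
  have h0 : ‖q - p‖ ≠ 0 := norm_ne_zero_iff.mpr (sub_ne_zero.mpr h.symm)
  have hd := hq.sub hp
  exact (hd.norm.inv₀ h0).smul ((continuous_rot.tendsto _).comp hd)

variable {X : Set E2} {k : E2 → E2 → ℝ}

/-- On a segment any normal field is the constant normal up to the sign, almost everywhere, and the
density is even. Arc length moves the integral to the fixed interval `]0,1[`, where Fatou's lemma
can compare different segments. -/
theorem setLIntegral_openSegment_diff (hk : IsSurfaceDensity X k) {Γ : Set E2}
    (hΓ : MeasurableSet Γ) {p q : E2} (hpq : p ≠ q) {ν : E2 → E2}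
    (hν : IsUnitNormalField (openSegment ℝ p q) ν) :
    ∫⁻ x in openSegment ℝ p q \ Γ, extDensity X k x (ν x) ∂H1 =
      ∫⁻ s in Ioo (0 : ℝ) 1, ENNReal.ofReal ‖q - p‖ *
        Γᶜ.indicator (fun x => extDensity X k x (unitNormal p q)) (AffineMap.lineMap p q s) := by
  rw [← setLIntegral_openSegment hpq, sdiff_eq, inter_comm, ← Measure.restrict_restrict hΓ.compl,
    ← lintegral_indicator hΓ.compl]
  refine lintegral_congr_ae ?_
  rw [EventuallyEq, ae_restrict_iff' (measurableSet_openSegment p q)]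
  filter_upwards [compl_mem_ae_iff.mpr (hν.measure_line_eq_zero (p := p)
    (norm_unitNormal hpq))] with x hx hxO
  have hxL : x ∈ line p (unitNormal p q) :=
    segment_subset_line p q (openSegment_subset_segment ℝ p q hxO)
  have hor : ν x = unitNormal p q ∨ ν x = -unitNormal p q := by
    by_contra hn
    exact hx ⟨⟨hxO, hxL⟩, hn⟩
  by_cases hxΓ : x ∈ Γᶜ
  · rw [indicator_of_mem hxΓ, indicator_of_mem hxΓ]
    rcases hor with h | h
    · rw [h]
    · rw [h, hk.extDensity_neg]
  · rw [indicator_of_notMem hxΓ, indicator_of_notMem hxΓ]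

/-- A union of a closed set and of a part of the boundary of `Ω`. -/
def IsCrackSet (Ω Γ : Set E2) : Prop :=
  ∃ K D : Set E2, IsClosed K ∧ MeasurableSet D ∧ D ⊆ frontier Ω ∧ Γ = K ∪ D

theorem IsCrackSet.measurableSet {Ω Γ : Set E2} (h : IsCrackSet Ω Γ) : MeasurableSet Γ := by
  obtain ⟨K, D, hK, hD, -, rfl⟩ := h
  exact hK.measurableSet.union hD

theorem IsCrackSet.union {Ω Γ Γ' : Set E2} (h : IsCrackSet Ω Γ) (h' : IsCrackSet Ω Γ') :
    IsCrackSet Ω (Γ ∪ Γ') := by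
  obtain ⟨K, D, hK, hD, hDf, rfl⟩ := h
  obtain ⟨K', D', hK', hD', hDf', rfl⟩ := h'
  exact ⟨K ∪ K', D ∪ D', hK.union hK', hD.union hD', union_subset hDf hDf', union_union_union_comm _
    _ _ _⟩

/-- Points of `Ω` outside a crack have a neighbourhood that does not meet the crack. -/
theorem IsCrackSet.eventually_notMem {Ω Γ : Set E2} (h : IsCrackSet Ω Γ) (hΩ : IsOpen Ω) {x : E2}
    (hx : x ∈ Ω) (hxΓ : x ∉ Γ) : ∀ᶠ y in 𝓝 x, y ∉ Γ := by
  obtain ⟨K, D, hK, hD, hDf, rfl⟩ := h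
  filter_upwards [hK.isOpen_compl.mem_nhds (fun hxK => hxΓ (Or.inl hxK)), hΩ.mem_nhds hx] with y hy1
    hy2
  rintro (hyK | hyD)
  · exact hy1 hyK
  · have := hDf hyD
    rw [hΩ.frontier_eq] at this
    exact this.2 hy2

variable {Ω : Set E2} {c₁ c₂ ε a : ℝ} {R : RegularTriangulation Ω c₁ c₂ ε}

open Classical in
/-- The pairs of labels of the ends of an edge. -/
def RegularTriangulation.labelPairs (R : RegularTriangulation Ω c₁ c₂ ε) :
    Finset (Sym2 E2 × Sym2 E2) := R.cells.biUnion fun V => V.offDiag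

theorem RegularTriangulation.mem_labelPairs {i j : Sym2 E2} :
    (i, j) ∈ R.labelPairs ↔ ∃ V ∈ R.cells, i ∈ V ∧ j ∈ V ∧ i ≠ j := by
  simp [RegularTriangulation.labelPairs]

namespace FEFun

variable {u : FEFun R a} {A : Finset (Sym2 E2) → M22 × E2}

theorem isCrackSet_jumpSetBC (u : FEFun R a) (hΩ : interior (closure Ω) = Ω) (ha : 0 < a)
    {D : Set E2} (hD : MeasurableSet D) (hDf : D ⊆ frontier Ω) {g : E2 → E2}
    (hg : ContinuousOn g (closure Ω)) : IsCrackSet Ω (u.jumpSetBC D g) :=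
  ⟨_, _, u.isClosed_jumpSet hΩ ha, u.measurableSet_trace_ne hΩ ha hD hDf hg,
    fun _ hx => hDf hx.1, rfl⟩

theorem pos_ne (u : FEFun R a) (hΩ : interior (closure Ω) = Ω) (ha : 0 < a) {i j : Sym2 E2}
    (hij : (i, j) ∈ R.labelPairs) : pos u.knot i ≠ pos u.knot j := by
  obtain ⟨V, hV, hi, hj, hne⟩ := RegularTriangulation.mem_labelPairs.mp hij
  exact fun h => hne ((u.isComplex hΩ ha).injOn hV hV hi hj h)

/-- The boundary of `Ω` is covered by the edges. -/
theorem frontier_subset_iUnion (u : FEFun R a) (hΩ : interior (closure Ω) = Ω) (ha : 0 < a) :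
    frontier Ω ⊆ ⋃ ij : R.labelPairs, segment ℝ (pos u.knot ij.1.1) (pos u.knot ij.1.2) := by
  classical
  intro x hx
  by_cases hxv : x ∈ u.vertices
  · simp only [vertices, mem_iUnion] at hxv
    obtain ⟨V, hV, i, hi, rfl⟩ := hxv
    have hc := (u.isComplex hΩ ha).card_eq V hV
    obtain ⟨j, hj, hji⟩ := Finset.exists_mem_ne (by rw [hc]; norm_num) i
    exact mem_iUnion.mpr ⟨⟨(i, j), RegularTriangulation.mem_labelPairs.mpr ⟨V, hV, hi, hj,
      hji.symm⟩⟩,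
      left_mem_segment ℝ _ _⟩
  · obtain ⟨V, hV, ⟨i, hi, j, hj, hij, hxs⟩, -⟩ := u.exists_unique_of_mem_frontier hΩ ha hx hxv
    exact mem_iUnion.mpr ⟨⟨(i, j), RegularTriangulation.mem_labelPairs.mpr ⟨V, hV, hi, hj, hij⟩⟩,
      openSegment_subset_segment ℝ _ _ hxs⟩

theorem jumpSetBC_subset_iUnion (u : FEFun R a) (hΩ : interior (closure Ω) = Ω) (ha : 0 < a)
    {D : Set E2} (hDf : D ⊆ frontier Ω) (g : E2 → E2) : u.jumpSetBC D g ⊆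
      ⋃ ij : R.labelPairs, segment ℝ (pos u.knot ij.1.1) (pos u.knot ij.1.2) := by
  obtain ⟨A, hA⟩ := u.exists_isCoef
  refine union_subset ?_ fun x hx => u.frontier_subset_iUnion hΩ ha (hDf hx.1)
  rw [jumpSet_eq hΩ ha hA]
  refine iUnion₂_subset fun e he => ?_
  obtain ⟨V, hV, V', hV', hne, i, j, hi, hj, hi', hj', hij, rfl, -⟩ := he
  exact subset_iUnion_of_subset ⟨(i, j), RegularTriangulation.mem_labelPairs.mpr ⟨V, hV, hi, hj,
    hij⟩⟩
    subset_rfl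

theorem measure_frontier_lt_top (u : FEFun R a) (hΩ : interior (closure Ω) = Ω) (ha : 0 < a) :
    H1 (frontier Ω) < ⊤ := by
  refine (measure_mono (u.frontier_subset_iUnion hΩ ha)).trans_lt ?_
  refine (measure_iUnion_le _).trans_lt ?_
  rw [tsum_fintype]
  refine ENNReal.sum_lt_top.mpr fun ij _ => ?_
  rw [hausdorffMeasure_segment]
  exact edist_lt_top _ _

end FEFun

namespace FEConverges

variable {un : ℕ → FEFun R a} {An : ℕ → Finset (Sym2 E2) → M22 × E2} {u : FEFun R a}
  {A : Finset (Sym2 E2) → M22 × E2}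

/-- Lower semicontinuity of the energy of one edge. -/
theorem setLIntegral_openEdge_le_liminf (h : FEConverges un An u A)
    (hΩ : interior (closure Ω) = Ω) (ha : 0 < a) (hX : IsClosed X) (hk : IsSurfaceDensity X k)
    (hn : ∀ n, (un n).jumpSet ⊆ X) {Γ : Set E2} (hΓ : IsCrackSet Ω Γ) {ν : E2 → E2}
    {e : Sym2 (Sym2 E2)} (he : e ∈ u.jumpEdges A)
    (hν : IsUnitNormalField (openEdge (pos u.knot) e) ν)
    (hνn : ∀ n, IsUnitNormalField (openEdge (pos (un n).knot) e) ν) :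
    ∫⁻ x in openEdge (pos u.knot) e \ Γ, extDensity X k x (ν x) ∂H1 ≤
      liminf (fun n => ∫⁻ x in openEdge (pos (un n).knot) e \ Γ, extDensity X k x (ν x) ∂H1)
        atTop := by
  have hOpen : IsOpen Ω := by rw [← hΩ]; exact isOpen_interior
  have hev := h.eventually_mem_jumpEdges he
  have huX := h.jumpSet_subset hΩ ha hX hn
  have heX : closedEdge (pos u.knot) e ⊆ X := by
    rw [FEFun.jumpSet_eq hΩ ha h.coef] at huX
    exact (subset_biUnion_of_mem (u := fun e => closedEdge (pos u.knot) e) he).trans huX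
  have henX : ∀ᶠ n in atTop, closedEdge (pos (un n).knot) e ⊆ X := by
    filter_upwards [hev] with n hen
    have := hn n
    rw [FEFun.jumpSet_eq hΩ ha (h.coef_seq n)] at this
    exact (subset_biUnion_of_mem (u := fun e => closedEdge (pos (un n).knot) e) hen).trans this
  obtain ⟨V, hV, V', hV', hne, i, j, hi, hj, hi', hj', hij, rfl, -⟩ := he
  have hpair : (i, j) ∈ R.labelPairs := RegularTriangulation.mem_labelPairs.mpr ⟨V, hV, hi, hj, hij⟩
  have hsubΩ := (u.isComplex hΩ ha).openSegment_subset hV hV' hne hi hj hi' hj' hij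
  simp only [openEdge_mk, closedEdge_mk] at *
  have hne0 := u.pos_ne hΩ ha hpair
  rw [setLIntegral_openSegment_diff hk hΓ.measurableSet hne0 hν]
  simp only [fun n => setLIntegral_openSegment_diff hk hΓ.measurableSet
    ((un n).pos_ne hΩ ha hpair) (hνn n)]
  refine le_trans ?_ (lintegral_liminf_le fun n => ?_)
  · refine lintegral_mono_ae ?_
    filter_upwards [ae_restrict_mem measurableSet_Ioo] with s hs
    set x : E2 := AffineMap.lineMap (pos u.knot i) (pos u.knot j) s with hx
    -- On `Γ` the integrand of the limit vanishes. Off `Γ`, the point is in `Ω`, because a jump edge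
    -- is common to two triangles; there `Γ` is relatively closed, so the moving points avoid it
    -- eventually and the integrands converge.
    by_cases hxΓ : x ∈ Γ
    · simp [hxΓ]
    have hxO : x ∈ openSegment ℝ (pos u.knot i) (pos u.knot j) := by
      rw [openSegment_eq_image_lineMap]; exact ⟨s, hs, rfl⟩
    have hxX : x ∈ X := heX (openSegment_subset_segment ℝ _ _ hxO)
    have hxn := h.tendsto_lineMap hV hi hj s
    rw [← hx] at hxn
    have hev1 := hxn.eventually (hΓ.eventually_notMem hOpen (hsubΩ hxO) hxΓ)
    have hev2 : ∀ᶠ n in atTop,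
        (AffineMap.lineMap (pos (un n).knot i) (pos (un n).knot j) s : E2) ∈ X := by
      filter_upwards [henX] with n hnX
      refine hnX ?_
      rw [segment_eq_image_Icc_lineMap]
      exact ⟨s, Ioo_subset_Icc_self hs, rfl⟩
    have hnorm := tendsto_unitNormal hne0 (h.tendsto_pos V hV i hi) (h.tendsto_pos V hV j hj)
    have hkt : Tendsto (fun n => k (AffineMap.lineMap (pos (un n).knot i) (pos (un n).knot j) s)
        (unitNormal (pos (un n).knot i) (pos (un n).knot j))) atTop
        (𝓝 (k x (unitNormal (pos u.knot i) (pos u.knot j)))) := by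
      have hc : Tendsto (fun y : E2 × E2 => k y.1 y.2)
          (𝓝[X ×ˢ univ] (x, unitNormal (pos u.knot i) (pos u.knot j)))
          (𝓝 (k x (unitNormal (pos u.knot i) (pos u.knot j)))) :=
        hk.continuousOn _ ⟨hxX, mem_univ _⟩
      refine hc.comp (tendsto_nhdsWithin_iff.mpr ⟨hxn.prodMk_nhds hnorm, ?_⟩)
      filter_upwards [hev2] with n hn2 using ⟨hn2, mem_univ _⟩
    have hlen : Tendsto (fun n => ‖pos (un n).knot j - pos (un n).knot i‖) atTop
        (𝓝 ‖pos u.knot j - pos u.knot i‖) :=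
      ((h.tendsto_pos V hV j hj).sub (h.tendsto_pos V hV i hi)).norm
    have hlim : Tendsto (fun n => ENNReal.ofReal ‖pos (un n).knot j - pos (un n).knot i‖ *
        Γᶜ.indicator (fun y => extDensity X k y (unitNormal (pos (un n).knot i) (pos (un n).knot
          j)))
          (AffineMap.lineMap (pos (un n).knot i) (pos (un n).knot j) s)) atTop
        (𝓝 (ENNReal.ofReal ‖pos u.knot j - pos u.knot i‖ *
          Γᶜ.indicator (fun y => extDensity X k y (unitNormal (pos u.knot i) (pos u.knot j))) x)) :=
            by
      rw [indicator_of_mem (by exact hxΓ)]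
      have e1 : extDensity X k x (unitNormal (pos u.knot i) (pos u.knot j)) =
          ENNReal.ofReal (k x (unitNormal (pos u.knot i) (pos u.knot j))) := if_pos hxX
      rw [e1]
      refine (ENNReal.Tendsto.mul (ENNReal.tendsto_ofReal hlen) (Or.inr ENNReal.ofReal_ne_top)
        (ENNReal.tendsto_ofReal hkt) (Or.inr ENNReal.ofReal_ne_top)).congr' ?_
      filter_upwards [hev1, hev2] with n hn1 hn2
      rw [indicator_of_mem (by exact hn1)]
      congr 1
      exact (if_pos hn2).symm
    rw [hlim.liminf_eq]
  · have hm := (hk.measurable_extDensity hX (measurable_const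
      (a := unitNormal (pos (un n).knot i) (pos (un n).knot j)))).indicator hΓ.measurableSet.compl
    have hl : Continuous fun s : ℝ =>
      (AffineMap.lineMap (pos (un n).knot i) (pos (un n).knot j) s : E2) :=
        AffineMap.lineMap_continuous
    exact measurable_const.mul (hm.comp hl.measurable)

/-- Lower semicontinuity of the energy of the part of the boundary where the boundary condition is
violated. -/
theorem setLIntegral_trace_ne_le_liminf (h : FEConverges un An u A)
    (hΩ : interior (closure Ω) = Ω) (ha : 0 < a) {D : Set E2} (hD : MeasurableSet D)
    (hDf : D ⊆ frontier Ω) {g : E2 → E2} (hg : ContinuousOn g (closure Ω)) {Γ : Set E2}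
    (hΓ : MeasurableSet Γ) {f : E2 → ℝ≥0∞} (hf : Measurable f) :
    ∫⁻ x in {x ∈ D | u.trace x ≠ g x} \ Γ, f x ∂H1 ≤
      liminf (fun n => ∫⁻ x in {x ∈ D | (un n).trace x ≠ g x} \ Γ, f x ∂H1) atTop := by
  have hm := (u.measurableSet_trace_ne hΩ ha hD hDf hg).diff hΓ
  have hmn := fun n => ((un n).measurableSet_trace_ne hΩ ha hD hDf hg).diff hΓ
  rw [← lintegral_indicator hm]
  simp only [fun n => (lintegral_indicator (μ := H1) (hmn n) f).symm]
  refine le_trans ?_ (lintegral_liminf_le fun n => hf.indicator (hmn n))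
  refine lintegral_mono_ae ?_
  have h1 : ∀ᵐ x ∂H1, x ∉ u.vertices := compl_mem_ae_iff.mpr (u.finite_vertices.measure_zero _)
  have h2 : ∀ᵐ x ∂H1, ∀ n, x ∉ (un n).vertices :=
    ae_all_iff.mpr fun n => compl_mem_ae_iff.mpr ((un n).finite_vertices.measure_zero _)
  filter_upwards [h1, h2] with x hx hxn
  by_cases hxE : x ∈ {x ∈ D | u.trace x ≠ g x} \ Γ
  -- Where the trace of the limit differs from `g`, those of the sequence differ from `g`
  -- eventually, so `x` belongs to the sets of the sequence. Elsewhere the left side is zero.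
  · have hlim := h.tendsto_trace hΩ ha (hDf hxE.1.1) hx hxn
    refine le_liminf_of_le (by isBoundedDefault) ?_
    filter_upwards [hlim.eventually_ne hxE.1.2] with n hne
    rw [indicator_of_mem hxE, indicator_of_mem]
    exact ⟨⟨hxE.1.1, hne⟩, hxE.2⟩
  · rw [indicator_of_notMem hxE]
    exact zero_le

/-- Lower semicontinuity of the surface energy. -/
theorem surfaceEnergy_le_liminf (h : FEConverges un An u A) (hΩ : interior (closure Ω) = Ω)
    (ha : 0 < a) {D : Set E2} (hD : MeasurableSet D) (hDf : D ⊆ frontier Ω) {g : E2 → E2}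
    (hg : ContinuousOn g (closure Ω)) (hX : IsClosed X) (hk : IsSurfaceDensity X k)
    (hn : ∀ n, (un n).jumpSet ⊆ X) {Γ : Set E2} (hΓ : IsCrackSet Ω Γ) :
    surfaceEnergy X k (u.jumpSetBC D g \ Γ) ≤
      liminf (fun n => surfaceEnergy X k ((un n).jumpSetBC D g \ Γ)) atTop := by
  classical
  have hOpen : IsOpen Ω := by rw [← hΩ]; exact isOpen_interior
  -- `none` stands for the limit and `some n` for the sequence. All their edges lie on countably
  -- many lines, so a single measurable normal field computes every surface energy.
  set U : Option ℕ → FEFun R a := fun o => o.elim u un with hU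
  have hnorm : ∀ i : Option ℕ × R.labelPairs,
      ‖unitNormal (pos (U i.1).knot i.2.1.1) (pos (U i.1).knot i.2.1.2)‖ = 1 := fun i =>
    norm_unitNormal ((U i.1).pos_ne hΩ ha i.2.2)
  obtain ⟨ν, hνm, hν⟩ := exists_isUnitNormalField (p := fun i : Option ℕ × R.labelPairs =>
    pos (U i.1).knot i.2.1.1) hnorm
  have hseg : ∀ (o : Option ℕ), (⋃ ij : R.labelPairs, segment ℝ (pos (U o).knot ij.1.1)
      (pos (U o).knot ij.1.2)) ⊆ ⋃ i : Option ℕ × R.labelPairs, line (pos (U i.1).knot i.2.1.1)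
        (unitNormal (pos (U i.1).knot i.2.1.1) (pos (U i.1).knot i.2.1.2)) := fun o =>
    iUnion_subset fun ij => subset_iUnion_of_subset (o, ij) (segment_subset_line _ _)
  have hsub : ∀ o, (U o).jumpSetBC D g \ Γ ⊆ ⋃ i : Option ℕ × R.labelPairs,
      line (pos (U i.1).knot i.2.1.1)
        (unitNormal (pos (U i.1).knot i.2.1.1) (pos (U i.1).knot i.2.1.2)) := fun o =>
    sdiff_subset.trans (((U o).jumpSetBC_subset_iUnion hΩ ha hDf g).trans (hseg o))
  have hEq : ∀ o, surfaceEnergy X k ((U o).jumpSetBC D g \ Γ) =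
      ∫⁻ x in (U o).jumpSetBC D g \ Γ, extDensity X k x (ν x) ∂H1 := fun o =>
    surfaceEnergy_eq hk hnorm (hsub o)
      (((U o).isCrackSet_jumpSetBC hΩ ha hD hDf hg).measurableSet.diff
        hΓ.measurableSet).nullMeasurableSet (hν _ (hsub o))
  have hfield : ∀ o, ∀ e ∈ u.jumpEdges A, IsUnitNormalField (openEdge (pos (U o).knot) e) ν := by
    rintro o e ⟨V, hV, V', hV', hne, i, j, hi, hj, hi', hj', hij, rfl, -⟩
    refine hν _ (Subset.trans ?_ (hseg o))
    exact subset_iUnion_of_subset ⟨(i, j), RegularTriangulation.mem_labelPairs.mpr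
      ⟨V, hV, hi, hj, hij⟩⟩ (openSegment_subset_segment ℝ _ _)
  set f : E2 → ℝ≥0∞ := fun x => extDensity X k x (ν x) with hf
  have hfm : Measurable f := hk.measurable_extDensity hX hνm
  have hfinJ := u.finite_jumpEdges A
  set J : Finset (Sym2 (Sym2 E2)) := hfinJ.toFinset with hJ
  have hJmem : ∀ e : J, e.1 ∈ u.jumpEdges A := fun e => hfinJ.mem_toFinset.mp e.2
  -- The pieces to be compared: `none` is the part of the boundary where the condition is violated,
  -- `some e` the open edge `e`. Only jump edges of the limit are listed; further jumps of the
  -- sequence can only increase its energy.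
  set S : Option ℕ → Option J → Set E2 := fun o e => e.elim ({x ∈ D | (U o).trace x ≠ g x} \ Γ)
    (fun e => openEdge (pos (U o).knot) e.1 \ Γ) with hS
  have hSm : ∀ o e, MeasurableSet (S o e) := by
    rintro o (_ | ⟨e, he⟩)
    · exact ((U o).measurableSet_trace_ne hΩ ha hD hDf hg).diff hΓ.measurableSet
    · refine MeasurableSet.diff ?_ hΓ.measurableSet
      induction e with
      | _ i j => exact measurableSet_openSegment _ _
  -- Up to vertices, which are null, the pieces cover the crack of the limit, so subadditivity gives
  -- the upper bound.
  have upper : surfaceEnergy X k (u.jumpSetBC D g \ Γ) ≤ ∑ e, ∫⁻ x in S none e, f x ∂H1 := by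
    have hcov : u.jumpSetBC D g \ Γ ⊆ (⋃ e, S none e) ∪ u.vertices := by
      rintro x ⟨hx | hx, hxΓ⟩
      · rw [FEFun.jumpSet_eq hΩ ha h.coef] at hx
        simp only [mem_iUnion] at hx
        obtain ⟨e, he, hxe⟩ := hx
        have he' := he
        obtain ⟨V, hV, V', hV', hne, i, j, hi, hj, hi', hj', hij, rfl, -⟩ := he
        by_cases h1 : pos u.knot i = x
        · exact Or.inr (mem_biUnion (x := V) hV ⟨i, hi, h1⟩)
        by_cases h2 : pos u.knot j = x
        · exact Or.inr (mem_biUnion (x := V) hV ⟨j, hj, h2⟩)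
        refine Or.inl (mem_iUnion.mpr ⟨some ⟨s(i, j), hfinJ.mem_toFinset.mpr he'⟩, ?_, hxΓ⟩)
        exact mem_openSegment_of_ne_left_right h1 h2 hxe
      · exact Or.inl (mem_iUnion.mpr ⟨none, hx, hxΓ⟩)
    have h0 := hEq none
    simp only [hU, Option.elim_none] at h0
    rw [h0]
    calc ∫⁻ x in u.jumpSetBC D g \ Γ, f x ∂H1
        ≤ ∫⁻ x in (⋃ e, S none e) ∪ u.vertices, f x ∂H1 := lintegral_mono_set hcov
      _ ≤ ∫⁻ x in ⋃ e, S none e, f x ∂H1 + ∫⁻ x in u.vertices, f x ∂H1 := lintegral_union_le _ _ _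
      _ = ∫⁻ x in ⋃ e, S none e, f x ∂H1 := by
          rw [setLIntegral_measure_zero _ _ (u.finite_vertices.measure_zero _), add_zero]
      _ ≤ ∑' e, ∫⁻ x in S none e, f x ∂H1 := lintegral_iUnion_le _ _
      _ = ∑ e, ∫⁻ x in S none e, f x ∂H1 := tsum_fintype _
  -- For the sequence the pieces must be disjoint to add up: different open edges do not meet, and
  -- jump edges are inside `Ω` while the other piece is on its boundary.
  have lower : ∀ᶠ n in atTop, ∑ e, ∫⁻ x in S (some n) e, f x ∂H1 ≤
      surfaceEnergy X k ((un n).jumpSetBC D g \ Γ) := by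
    have hev : ∀ᶠ n in atTop, ∀ e ∈ J, e ∈ (un n).jumpEdges (An n) :=
      (Finset.eventually_all J).mpr fun e he =>
        h.eventually_mem_jumpEdges (hfinJ.mem_toFinset.mp he)
    filter_upwards [hev] with n hen
    have hC := (un n).isComplex hΩ ha
    have hinΩ : ∀ e ∈ J, openEdge (pos (un n).knot) e ⊆ Ω := by
      intro e he
      obtain ⟨V, hV, V', hV', hne, i, j, hi, hj, hi', hj', hij, rfl, -⟩ := hen e he
      exact hC.openSegment_subset hV hV' hne hi hj hi' hj' hij
    have hbd : ∀ e : J, Disjoint (S (some n) none) (S (some n) (some e)) := by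
      intro e
      refine Set.disjoint_left.mpr fun x hx hx' => ?_
      have h1 := hDf hx.1.1
      rw [hOpen.frontier_eq] at h1
      exact h1.2 (hinΩ e.1 e.2 hx'.1)
    have hdisj : Pairwise (Function.onFun Disjoint (S (some n))) := by
      rintro (_ | e) (_ | e') hee
      · exact absurd rfl hee
      · exact hbd e'
      · exact (hbd e).symm
      · refine Set.disjoint_left.mpr fun x hx hx' => hee ?_
        obtain ⟨e, he⟩ := e
        obtain ⟨e', he'⟩ := e'
        obtain ⟨V, hV, -, -, -, i, j, hi, hj, -, -, hij, rfl, -⟩ := hen e he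
        obtain ⟨V', hV', -, -, -, i', j', hi', hj', -, -, hij', rfl, -⟩ := hen e' he'
        have := hC.openSegment_eq_of_mem hV hV' hi hj hij hi' hj' hij' hx.1 hx'.1
        simp only [this]
    have h0 := hEq (some n)
    simp only [hU, Option.elim_some] at h0
    rw [h0, ← tsum_fintype (L := .unconditional _), ← lintegral_iUnion (hSm (some n)) hdisj]
    refine lintegral_mono_set (iUnion_subset ?_)
    rintro (_ | e)
    · exact sdiff_subset_sdiff_left subset_union_right
    · refine sdiff_subset_sdiff_left (Subset.trans ?_ subset_union_left)
      rw [FEFun.jumpSet_eq hΩ ha (h.coef_seq n)]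
      refine Subset.trans ?_ (subset_biUnion_of_mem
        (u := fun e => closedEdge (pos (un n).knot) e) (hen e.1 e.2))
      obtain ⟨e, he⟩ := e
      induction e with
      | _ i j => exact openSegment_subset_segment ℝ _ _
  have hterm : ∀ e, ∫⁻ x in S none e, f x ∂H1 ≤
      liminf (fun n => ∫⁻ x in S (some n) e, f x ∂H1) atTop := by
    rintro (_ | e)
    · exact h.setLIntegral_trace_ne_le_liminf hΩ ha hD hDf hg hΓ.measurableSet hfm
    · exact h.setLIntegral_openEdge_le_liminf hΩ ha hX hk hn hΓ (hJmem e)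
        (hfield none _ (hJmem e)) fun n => hfield (some n) _ (hJmem e)
  refine upper.trans (le_trans ?_ (liminf_le_liminf lower))
  let : MeasurableSpace (Option J) := ⊤
  -- Superadditivity of the lower limit for a finite sum is Fatou's lemma for the counting measure.
  have hcount : ∀ φ : Option J → ℝ≥0∞, ∑ e, φ e = ∫⁻ e, φ e ∂Measure.count := fun φ => by
    rw [lintegral_count, tsum_fintype]
  calc ∑ e, ∫⁻ x in S none e, f x ∂H1
      ≤ ∑ e, liminf (fun n => ∫⁻ x in S (some n) e, f x ∂H1) atTop :=
        Finset.sum_le_sum fun e _ => hterm e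
    _ = ∫⁻ e, liminf (fun n => ∫⁻ x in S (some n) e, f x ∂H1) atTop ∂Measure.count := hcount _
    _ ≤ liminf (fun n => ∫⁻ e, ∫⁻ x in S (some n) e, f x ∂H1 ∂Measure.count) atTop :=
        lintegral_liminf_le fun n => measurable_from_top
    _ = liminf (fun n => ∑ e, ∫⁻ x in S (some n) e, f x ∂H1) atTop := by
        simp only [hcount]

end FEConverges

end

end CrackFE

namespace CrackFE

noncomputable section

/-! ### Coercivity -/

/-- Affine functions are controlled by their integrals over a ball. -/
theorem exists_mul_norm_rpow_le_integral (x₀ : E2) {ρ q : ℝ} (hρ : 0 < ρ) (hq : 0 < q) :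
    ∃ c, 0 < c ∧ ∀ A : M22 × E2,
      c * ‖A‖ ^ q ≤ ∫ x in Metric.closedBall x₀ ρ, ‖evalAff A x‖ ^ q := by
  have hK : IsCompact (Metric.closedBall x₀ ρ) := isCompact_closedBall _ _
  have : ProperSpace (M22 × E2) := FiniteDimensional.proper_real _
  have hcont : Continuous (Function.uncurry fun (A : M22 × E2) (x : E2) => ‖evalAff A x‖ ^ q) :=
    continuous_evalAff.norm.rpow_const fun _ => Or.inr hq.le
  have hcontA : ∀ A : M22 × E2, Continuous fun x => ‖evalAff A x‖ ^ q := fun A =>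
    (continuous_evalAff_right A).norm.rpow_const fun _ => Or.inr hq.le
  have hΦ := continuous_parametric_integral_of_continuous (μ := volume) hcont hK
  -- An affine function that vanishes on a ball has zero coefficients, so the integral is positive
  -- on the unit sphere of coefficients. It is continuous and homogeneous of degree `q`, so its
  -- minimum on the sphere is the constant.
  have hpos : ∀ A : M22 × E2, A ≠ 0 →
      0 < ∫ x in Metric.closedBall x₀ ρ, ‖evalAff A x‖ ^ q := by
    intro A hA
    rw [setIntegral_pos_iff_support_of_nonneg_ae
      (Eventually.of_forall fun x => Real.rpow_nonneg (norm_nonneg _) _)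
      ((hcontA A).continuousOn.integrableOn_compact hK)]
    have hne : ∃ x ∈ Metric.ball x₀ ρ, evalAff A x ≠ 0 := by
      by_contra hall
      push Not at hall
      have hev : evalAff A =ᶠ[𝓝 x₀] fun _ => 0 := by
        filter_upwards [Metric.ball_mem_nhds x₀ hρ] with x hx using hall x hx
      have h1 : A.1 = 0 := by
        rw [← (hasFDerivAt_evalAff A x₀).fderiv, hev.fderiv_eq]
        simp
      have h2 : A.2 = 0 := by
        have := hev.self_of_nhds
        rwa [evalAff, h1, zero_apply, zero_add] at this
      exact hA (Prod.ext h1 h2)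
    obtain ⟨x, hx, hxA⟩ := hne
    have hopen : IsOpen ({x | evalAff A x ≠ 0} ∩ Metric.ball x₀ ρ) :=
      ((continuous_evalAff_right A).isOpen_preimage _ isOpen_compl_singleton).inter
        Metric.isOpen_ball
    refine (hopen.measure_pos volume ⟨x, hxA, hx⟩).trans_le (measure_mono ?_)
    rintro y ⟨hy, hyb⟩
    exact ⟨(Real.rpow_pos_of_pos (norm_pos_iff.mpr hy) q).ne', Metric.ball_subset_closedBall hyb⟩
  obtain ⟨A₀, hA₀, hmin⟩ := (isCompact_sphere (0 : M22 × E2) 1).exists_isMinOn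
    (NormedSpace.sphere_nonempty.mpr zero_le_one) hΦ.continuousOn
  have hA₀1 : ‖A₀‖ = 1 := by simpa using hA₀
  refine ⟨_, hpos A₀ (by rintro rfl; simp at hA₀1), fun A => ?_⟩
  by_cases hA : A = 0
  · subst hA
    rw [norm_zero, Real.zero_rpow hq.ne', mul_zero]
    exact integral_nonneg fun x => Real.rpow_nonneg (norm_nonneg _) _
  have hA' : ‖A‖ ≠ 0 := norm_ne_zero_iff.mpr hA
  have hle : ∫ x in Metric.closedBall x₀ ρ, ‖evalAff A₀ x‖ ^ q ≤
      ∫ x in Metric.closedBall x₀ ρ, ‖evalAff (‖A‖⁻¹ • A) x‖ ^ q :=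
    hmin (by simp [norm_smul, hA'])
  have heq : ∫ x in Metric.closedBall x₀ ρ, ‖evalAff (‖A‖⁻¹ • A) x‖ ^ q =
      (‖A‖ ^ q)⁻¹ * ∫ x in Metric.closedBall x₀ ρ, ‖evalAff A x‖ ^ q := by
    rw [← integral_const_mul]
    congr 1 with x
    have : evalAff (‖A‖⁻¹ • A) x = ‖A‖⁻¹ • evalAff A x := by simp [evalAff]
    rw [this, norm_smul, norm_inv, norm_norm,
      Real.mul_rpow (inv_nonneg.mpr (norm_nonneg _)) (norm_nonneg _),
      Real.inv_rpow (norm_nonneg _)]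
  rw [heq] at hle
  have hq' : 0 < ‖A‖ ^ q := Real.rpow_pos_of_pos (norm_pos_iff.mpr hA) q
  calc _ ≤ ((‖A‖ ^ q)⁻¹ * ∫ x in Metric.closedBall x₀ ρ, ‖evalAff A x‖ ^ q) * ‖A‖ ^ q :=
        mul_le_mul_of_nonneg_right hle hq'.le
    _ = _ := by field_simp

/-- Beyond some `M` the factor `m ^ (q - 1)` exceeds `(|β| + |γ|) / α`, so superlinear growth beats
the affine right side. -/
theorem exists_bound_of_rpow_le {α β γ q : ℝ} (hα : 0 < α) (hq : 1 < q) :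
    ∃ M, ∀ m : ℝ, 0 ≤ m → α * m ^ q ≤ β * m + γ → m ≤ M := by
  have h := tendsto_rpow_atTop (sub_pos.mpr hq)
  obtain ⟨M, hM⟩ := (h.eventually_gt_atTop ((|β| + |γ|) / α)).exists_forall_of_atTop
  refine ⟨max M 1, fun m hm hle => ?_⟩
  by_contra! hlt
  obtain ⟨h1, h2⟩ := max_lt_iff.mp hlt
  have h3 := hM m h1.le
  rw [div_lt_iff₀ hα] at h3
  have h4 : m ^ q = m ^ (q - 1) * m := by
    rw [← Real.rpow_add_one (by linarith), sub_add_cancel]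
  have h5 : (|β| + |γ|) * m < α * m ^ q := by
    rw [h4, ← mul_assoc, mul_comm α]
    exact mul_lt_mul_of_pos_right h3 (by linarith)
  nlinarith [le_abs_self β, le_abs_self γ, abs_nonneg γ]

variable {Ω : Set E2} {c₁ c₂ ε a : ℝ} {R : RegularTriangulation Ω c₁ c₂ ε}

theorem isOpen_of_interior_closure_eq (hΩ : interior (closure Ω) = Ω) : IsOpen Ω := by
  rw [← hΩ]; exact isOpen_interior

/-- The bulk energy is nonnegative, `-F` controls the integral of `|u|^q`, and the work of the
surface forces costs a term linear in the bound `M` of the coefficients. That term is absorbed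
later, as the left side will grow like `M ^ q`. -/
theorem exists_le_elasticEnergy (R : RegularTriangulation Ω c₁ c₂ ε)
    (hΩ : interior (closure Ω) = Ω) (ha : 0 < a) (hbd : IsCompact (closure Ω))
    {S : Set E2} (hS : MeasurableSet S) (hSf : S ⊆ frontier Ω) [IsFiniteMeasure (H1.restrict S)]
    {T p q qd r t : ℝ} (hT : 0 < T) (hq : 0 ≤ q) (hr : 1 ≤ r) (ht : t ∈ Icc 0 T)
    {W : E2 → M22 → ℝ} (hW : IsBulkDensity Ω p W) {F G : ℝ → E2 → E2 → ℝ}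
    (hF : IsBodyPotential T Ω q qd F) (hG : IsSurfacePotential T S r G) :
    ∃ α β γ : ℝ, 0 < α ∧ ∀ (u : FEFun R a) (A : Finset (Sym2 E2) → M22 × E2) (M : ℝ),
      u.IsCoef A → 0 ≤ M → (∀ V ∈ R.cells, ‖A V‖ ≤ M) →
      IntegrableOn (fun x => ‖u.toFun x‖ ^ q) Ω ∧
      α * (∫ x in Ω, ‖u.toFun x‖ ^ q) ≤ u.elasticEnergy S W F G t + (β * M + γ) := by
  have hΩm : MeasurableSet Ω := (isOpen_of_interior_closure_eq hΩ).measurableSet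
  have hfin : volume Ω ≠ ⊤ := ((measure_mono subset_closure).trans_lt hbd.measure_lt_top).ne
  obtain ⟨ρ, hρ0, hρ⟩ := hbd.isBounded.exists_pos_norm_le
  obtain ⟨a₀, b₀, ha₀, hb₀, hb₀n, hlow⟩ := hF.lower
  obtain ⟨C, C', hC, hGle⟩ := hG.exists_integral_le hT hS hr ht
  refine ⟨a₀, C * (ρ + 1), C' + ∫ x in Ω, b₀ t x, ha₀, fun u A M hA hM hAM => ?_⟩
  have hbound := FEFun.ae_norm_toFun_le hΩ ha hA hAM hρ
  have hmeas := u.aestronglyMeasurable_toFun hΩ ha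
  have hInt : IntegrableOn (fun x => ‖u.toFun x‖ ^ q) Ω := by
    refine Integrable.mono' (integrableOn_const (C := (M * (ρ + 1)) ^ q) hfin)
      ((Real.continuous_rpow_const hq).comp_aestronglyMeasurable hmeas.norm) ?_
    filter_upwards [hbound] with x hx
    rw [Real.norm_of_nonneg (Real.rpow_nonneg (norm_nonneg _) _)]
    exact Real.rpow_le_rpow (norm_nonneg _) hx hq
  refine ⟨hInt, ?_⟩
  have h1 : 0 ≤ ∫ x in Ω, W x (fderiv ℝ u.toFun x) :=
    setIntegral_nonneg hΩm fun x hx => hW.nonneg x hx _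
  have hFi := (hF.isDominatedIntegrand hT hΩm hfin hq ht).integrable_comp hmeas hbound
  have h2 : a₀ * (∫ x in Ω, ‖u.toFun x‖ ^ q) - ∫ x in Ω, b₀ t x ≤
      -∫ x in Ω, F t x (u.toFun x) := by
    rw [← integral_const_mul, ← integral_sub (hInt.const_mul a₀) (hb₀.integrable ht),
      ← integral_neg]
    exact setIntegral_mono_on ((hInt.const_mul a₀).sub (hb₀.integrable ht)) hFi.neg hΩm
      fun x hx => hlow t ht x hx _
  have h3 := hGle u.trace (M * (ρ + 1)) (by positivity)
    (u.aestronglyMeasurable_trace hΩ ha hS hSf)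
    (FEFun.ae_norm_trace_le hΩ ha hA hAM hρ hS hSf)
  have h4 : C * (M * (ρ + 1)) = C * (ρ + 1) * M := by ring
  unfold FEFun.elasticEnergy
  linarith

/-! ### Compactness -/

/-- All vertices stay in the compact set `closure Ω`. A knot stays in the image of `[a, 1 - a]`,
which is closed, so the limits are admissible knots. -/
theorem exists_subseq_tendsto_pos (hΩ : interior (closure Ω) = Ω) (ha : 0 < a)
    (un : ℕ → FEFun R a) : ∃ (z : Sym2 E2 → E2) (φ : ℕ → ℕ), R.IsKnotChoice a z ∧ StrictMono φ ∧
      ∀ V ∈ R.cells, ∀ l ∈ V, Tendsto (fun n => pos (un (φ n)).knot l) atTop (𝓝 (pos z l)) := by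
  classical
  set L := R.cells.biUnion id with hL
  have hmemL : ∀ V ∈ R.cells, ∀ l ∈ V, l ∈ L := fun V hV l hl =>
    Finset.mem_biUnion.mpr ⟨V, hV, hl⟩
  obtain ⟨ρ, hρ0, hρ⟩ := ((un 0).isComplex hΩ ha).isCompact_closure.isBounded.exists_pos_norm_le
  have hbd : ∀ n, (fun l : L => pos (un n).knot l) ∈ Metric.closedBall (0 : L → E2) ρ := by
    intro n
    rw [mem_closedBall_zero_iff, pi_norm_le_iff_of_nonneg hρ0.le]
    rintro ⟨l, hl⟩
    obtain ⟨V, hV, hlV⟩ := Finset.mem_biUnion.mp hl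
    exact hρ _ (((un n).isComplex hΩ ha).convexHull_subset hV
      (subset_convexHull ℝ _ (mem_image_of_mem _ hlV)))
  obtain ⟨f, -, φ, hφ, hf⟩ := tendsto_subseq_of_bounded Metric.isBounded_closedBall hbd
  have hfl : ∀ l : L, Tendsto (fun n => pos (un (φ n)).knot l) atTop (𝓝 (f l)) := fun l =>
    (tendsto_pi_nhds.mp hf) l
  set z : Sym2 E2 → E2 := fun l => if h : l ∈ L then f ⟨l, h⟩ else 0 with hz
  refine ⟨z, φ, ?_, hφ, ?_⟩
  · intro τ hτ x hx y hy hxy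
    have hl : s(x, y) ∈ L := hmemL (knots τ)
      (RegularTriangulation.mem_cells.mpr ⟨τ, hτ, Or.inl rfl⟩) _ (mem_knots.mpr ⟨x, hx, y, hy, hxy,
        rfl⟩)
    have hclosed : IsClosed ((fun t : ℝ => t • x + (1 - t) • y) '' Icc a (1 - a)) :=
      (isCompact_Icc.image (by fun_prop)).isClosed
    have hmem := hclosed.mem_of_tendsto (hfl ⟨s(x, y), hl⟩) (Eventually.of_forall fun n => by
      obtain ⟨t, ht, h⟩ := (un (φ n)).isKnotChoice τ hτ x hx y hy hxy
      refine ⟨t, ht, ?_⟩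
      change _ = pos (un (φ n)).knot s(x, y)
      rw [pos_of_ne _ hxy, h])
    obtain ⟨t, ht, h⟩ := hmem
    exact ⟨t, ht, by rw [hz]; simp only [hl, dite_true]; exact h.symm⟩
  · intro V hV l hl
    have hlL := hmemL V hV l hl
    have hlim := hfl ⟨l, hlL⟩
    induction l with
    | _ x y =>
      by_cases hxy : x = y
      · subst hxy
        simp only [pos_diag]
        exact tendsto_const_nhds
      · have : pos z s(x, y) = f ⟨s(x, y), hlL⟩ := by
          rw [pos_of_ne _ hxy, hz]; simp only [hlL, dite_true]
        rw [this]
        exact hlim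

/-- A sequence whose knots converge and whose coefficients are bounded has a convergent
subsequence. -/
theorem exists_feConverges (hΩ : interior (closure Ω) = Ω) (ha : 0 < a) {un : ℕ → FEFun R a}
    {An : ℕ → Finset (Sym2 E2) → M22 × E2} (hAn : ∀ n, (un n).IsCoef (An n)) {z : Sym2 E2 → E2}
    (hz : R.IsKnotChoice a z) (hpos : ∀ V ∈ R.cells, ∀ l ∈ V,
      Tendsto (fun n => pos (un n).knot l) atTop (𝓝 (pos z l))) {M : ℝ}
    (hM : ∃ᶠ n in atTop, ∀ V ∈ R.cells, ‖An n V‖ ≤ M) :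
    ∃ (φ : ℕ → ℕ) (u : FEFun R a) (A : Finset (Sym2 E2) → M22 × E2), StrictMono φ ∧
      FEConverges (un ∘ φ) (An ∘ φ) u A := by
  classical
  have : ProperSpace (M22 × E2) := FiniteDimensional.proper_real _
  have hM' : ∃ᶠ n in atTop,
      (fun V : R.cells => An n V) ∈ Metric.closedBall (0 : R.cells → M22 × E2) (max M 0) := by
    refine hM.mono fun n hn => ?_
    rw [mem_closedBall_zero_iff, pi_norm_le_iff_of_nonneg (le_max_right _ _)]
    exact fun V => (hn V V.2).trans (le_max_left _ _)
  obtain ⟨A₀, -, φ, hφ, hA₀⟩ :=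
    tendsto_subseq_of_frequently_bounded Metric.isBounded_closedBall hM'
  set A : Finset (Sym2 E2) → M22 × E2 := fun V => if h : V ∈ R.cells then A₀ ⟨V, h⟩ else 0 with hA
  have hAlim : ∀ V ∈ R.cells, Tendsto (fun n => An (φ n) V) atTop (𝓝 (A V)) := by
    intro V hV
    have := (tendsto_pi_nhds.mp hA₀) ⟨V, hV⟩
    rw [hA]
    simp only [hV, dite_true]
    exact this
  -- The limit function is the pointwise limit of the sequence. It exists inside the limit
  -- triangles; the default value of `limUnder` elsewhere does not matter.
  have hcoef : ∀ V ∈ R.cells, EqOn (fun x => limUnder atTop fun n => (un (φ n)).toFun x)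
      (evalAff (A V)) (interior (convexHull ℝ (pos z '' V))) := by
    intro V hV x hx
    refine Tendsto.limUnder_eq
      ((tendsto_evalAff (hAlim V hV) (tendsto_const_nhds (x := x))).congr' ?_)
    have hev := (R.isComplex hΩ hz ha).eventually_subset_interior hV
      (fun l hl => (hpos V hV l hl).comp hφ.tendsto_atTop) isCompact_singleton
      (singleton_subset_iff.mpr hx)
    filter_upwards [hev] with n hn
    exact (hAn (φ n) V hV (hn rfl)).symm
  refine ⟨φ, ⟨z, hz, fun x => limUnder atTop fun n => (un (φ n)).toFun x, ?_⟩, A, hφ, ?_⟩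
  · intro S hS
    rw [RegularTriangulation.adaptive_eq] at hS
    obtain ⟨V, hV, rfl⟩ := hS
    exact ⟨(A V).1.toLinearMap.toAffineMap + AffineMap.const ℝ E2 (A V).2, hcoef V hV⟩
  · exact ⟨fun n => hAn _, hcoef, fun V hV l hl => (hpos V hV l hl).comp hφ.tendsto_atTop, hAlim⟩

/-- The knots are made to converge before the coefficients are estimated: then a ball inside a limit
triangle lies in all later triangles with the same label, and the constant of the estimate on that
ball does not depend on `n`. -/
theorem exists_feConverges_of_elasticEnergy_le (hΩ : interior (closure Ω) = Ω) (ha : 0 < a)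
    {S : Set E2} (hS : MeasurableSet S) (hSf : S ⊆ frontier Ω) [IsFiniteMeasure (H1.restrict S)]
    {T p q qd r t : ℝ} (hT : 0 < T) (hq : 1 < q) (hr : 1 ≤ r) (ht : t ∈ Icc 0 T)
    {W : E2 → M22 → ℝ} (hW : IsBulkDensity Ω p W) {F G : ℝ → E2 → E2 → ℝ}
    (hF : IsBodyPotential T Ω q qd F) (hG : IsSurfacePotential T S r G) {un : ℕ → FEFun R a} {C : ℝ}
    (hC : ∀ n, (un n).elasticEnergy S W F G t ≤ C) :
    ∃ (φ : ℕ → ℕ) (An : ℕ → Finset (Sym2 E2) → M22 × E2) (u : FEFun R a)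
      (A : Finset (Sym2 E2) → M22 × E2), StrictMono φ ∧ FEConverges (un ∘ φ) An u A := by
  obtain ⟨z, φ, hz, hφ, hpos⟩ := exists_subseq_tendsto_pos hΩ ha un
  have hcx := R.isComplex hΩ hz ha
  have hq0 : 0 < q := by linarith
  obtain ⟨α, β, γ, hα, hle⟩ := exists_le_elasticEnergy (a := a) R hΩ ha hcx.isCompact_closure hS hSf
    hT hq0.le hr ht hW hF hG
  choose A hA using fun n => (un (φ n)).exists_isCoef
  have hΩm : MeasurableSet Ω := (isOpen_of_interior_closure_eq hΩ).measurableSet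
  have hball : ∀ V, ∃ c, 0 < c ∧ (V ∈ R.cells → ∀ᶠ n in atTop,
      IntegrableOn (fun x => ‖(un (φ n)).toFun x‖ ^ q) Ω →
      c * ‖A n V‖ ^ q ≤ ∫ x in Ω, ‖(un (φ n)).toFun x‖ ^ q) := by
    intro V
    by_cases hV : V ∈ R.cells
    · obtain ⟨x₀, hx₀⟩ := hcx.convexHull_image_nonempty_interior hV
      obtain ⟨ρ, hρ, hball⟩ := Metric.nhds_basis_closedBall.mem_iff.mp
        (isOpen_interior.mem_nhds hx₀)
      obtain ⟨c, hc, hcA⟩ := exists_mul_norm_rpow_le_integral x₀ hρ hq0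
      refine ⟨c, hc, fun _ => ?_⟩
      filter_upwards [hcx.eventually_subset_interior hV (hpos V hV) (isCompact_closedBall x₀ ρ)
        hball] with n hn hInt
      have heq : ∫ x in Metric.closedBall x₀ ρ, ‖evalAff (A n V) x‖ ^ q =
          ∫ x in Metric.closedBall x₀ ρ, ‖(un (φ n)).toFun x‖ ^ q :=
        setIntegral_congr_fun measurableSet_closedBall fun x hx => by
          simp only [hA n V hV (hn hx)]
      refine (hcA (A n V)).trans (heq.trans_le ?_)
      exact setIntegral_mono_set hInt
        (Eventually.of_forall fun x => Real.rpow_nonneg (norm_nonneg _) _)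
        (LE.le.eventuallyLE
          (hn.trans (((un (φ n)).isComplex hΩ ha).interior_convexHull_subset hV)))
    · exact ⟨1, one_pos, fun h => absurd h hV⟩
  choose c hc hcle using hball
  obtain ⟨c₀, hc₀, hc₀le⟩ : ∃ c₀, 0 < c₀ ∧ ∀ V ∈ R.cells, c₀ ≤ c V := by
    rcases R.cells.eq_empty_or_nonempty with h | h
    · exact ⟨1, one_pos, by simp [h]⟩
    · obtain ⟨V, hV, hmin⟩ := R.cells.exists_min_image c h
      exact ⟨c V, hc V, hmin⟩
  obtain ⟨M, hM⟩ := exists_bound_of_rpow_le (β := β) (γ := C + γ) (mul_pos hα hc₀) hq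
  have hev : ∀ᶠ n in atTop, ∀ V ∈ R.cells, ‖A n V‖ ≤ M := by
    filter_upwards [(Finset.eventually_all R.cells).mpr hcle] with n hn V hV
    -- The largest coefficient appears on both sides of the energy estimate: to the power `q` on the
    -- left, linearly on the right.
    obtain ⟨V', hV', hmax⟩ := R.cells.exists_max_image (fun V => ‖A n V‖) ⟨V, hV⟩
    refine (hmax V hV).trans (hM _ (norm_nonneg _) ?_)
    obtain ⟨hInt, h1⟩ := hle _ _ _ (hA n) (norm_nonneg (A n V')) hmax
    have h2 := hn V' hV' hInt
    have h3 : c₀ * ‖A n V'‖ ^ q ≤ c V' * ‖A n V'‖ ^ q :=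
      mul_le_mul_of_nonneg_right (hc₀le V' hV') (Real.rpow_nonneg (norm_nonneg _) _)
    have h4 := mul_le_mul_of_nonneg_left (h3.trans h2) hα.le
    rw [← mul_assoc] at h4
    linarith [hC (φ n)]
  obtain ⟨ψ, u, A', hψ, hconv⟩ := exists_feConverges hΩ ha hA hz hpos hev.frequently
  exact ⟨φ ∘ ψ, _, u, A', hφ.comp hψ, hconv⟩

end

end CrackFE

namespace CrackFE

noncomputable section

/-! ### Existence of minimizers -/

theorem Body.measurableSet_bdryD (B : Body) : MeasurableSet B.bdryD :=
  isClosed_frontier.measurableSet.diff B.isClosed_bdryN.measurableSet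

theorem Body.bdryD_subset (B : Body) : B.bdryD ⊆ frontier B.Ω := sdiff_subset

theorem Body.bdryS_subset_frontier (B : Body) : B.bdryS ⊆ frontier B.Ω :=
  B.bdryS_subset.trans B.bdryN_subset

variable {B : Body} {c₁ c₂ ε a : ℝ} {R : RegularTriangulation B.Ω c₁ c₂ ε} {W : E2 → M22 → ℝ}
  {F G : ℝ → E2 → E2 → ℝ} {X : Set E2} {k : E2 → E2 → ℝ} {g : E2 → E2} {Γ : Set E2}

/-- The elastic part converges and the surface part is lower semicontinuous. Admissibility of the
jump sets in `X` keeps the density finite on the interior edges. -/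
theorem FEConverges.stepEnergy_le {un : ℕ → FEFun R a} {An : ℕ → Finset (Sym2 E2) → M22 × E2}
    {u : FEFun R a} {A : Finset (Sym2 E2) → M22 × E2} (h : FEConverges un An u A) (ha : 0 < a)
    {t : ℝ} (hW : IsDominatedIntegrand (volume.restrict B.Ω) W)
    (hF : IsDominatedIntegrand (volume.restrict B.Ω) (F t))
    (hG : IsDominatedIntegrand (H1.restrict B.bdryS) (G t)) (hX : IsClosed X)
    (hk : IsSurfaceDensity X k) (hn : ∀ n, (un n).jumpSet ⊆ X)
    (hg : ContinuousOn g (closure B.Ω)) (hΓ : IsCrackSet B.Ω Γ) {m : EReal}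
    (hm : Tendsto (fun n => (un n).stepEnergy B W F G X k t g Γ) atTop (𝓝 m)) :
    u.stepEnergy B W F G X k t g Γ ≤ m := by
  have hel := (continuous_coe_real_ereal.tendsto _).comp (h.tendsto_elasticEnergy
    B.interior_closure_Ω ha B.isClosed_bdryS.measurableSet B.bdryS_subset_frontier hW hF hG)
  have hs := h.surfaceEnergy_le_liminf B.interior_closure_Ω ha B.measurableSet_bdryD
    B.bdryD_subset hg hX hk hn hΓ
  have hmono : Monotone ((↑) : ℝ≥0∞ → EReal) := fun x y hxy =>
    EReal.coe_ennreal_le_coe_ennreal_iff.mpr hxy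
  have hs' := hmono hs
  rw [hmono.map_liminf_of_continuousAt _ continuous_coe_ennreal_ereal.continuousAt] at hs'
  unfold FEFun.stepEnergy
  rw [← hel.liminf_eq, ← hm.liminf_eq]
  exact (add_le_add le_rfl hs').trans EReal.le_liminf_add

theorem exists_isMinOn_stepEnergy (ha : 0 < a) {T p q qd r t : ℝ} (hT : 0 < T) (hp : 0 ≤ p)
    (hq : 1 < q) (hr : 1 ≤ r) (ht : t ∈ Icc 0 T) (hW : IsBulkDensity B.Ω p W)
    (hF : IsBodyPotential T B.Ω q qd F) (hG : IsSurfacePotential T B.bdryS r G) (hX : IsClosed X)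
    (hBX : closure B.ΩB ⊆ X) (hk : IsSurfaceDensity X k) (hg : ContinuousOn g (closure B.Ω))
    (hΓ : IsCrackSet B.Ω Γ) (hne : (brittleFE R a B.ΩB).Nonempty) :
    ∃ u ∈ brittleFE R a B.ΩB,
      IsMinOn (fun v : FEFun R a => v.stepEnergy B W F G X k t g Γ) (brittleFE R a B.ΩB) u := by
  set E : FEFun R a → EReal := fun v => v.stepEnergy B W F G X k t g Γ with hE
  obtain ⟨e, he, hlim, hmem⟩ := exists_seq_tendsto_sInf (hne.image E) (OrderBot.bddBelow _)
  choose v hv hve using hmem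
  have hle : ∀ w ∈ brittleFE R a B.ΩB, sInf (E '' brittleFE R a B.ΩB) ≤ E w := fun w hw =>
    sInf_le ⟨w, hw, rfl⟩
  -- If the infimum is `⊤`, every admissible function is a minimizer.
  by_cases htop : sInf (E '' brittleFE R a B.ΩB) = ⊤
  · obtain ⟨u, hu⟩ := hne
    refine ⟨u, hu, fun w hw => ?_⟩
    have := hle w hw
    rw [htop] at this
    exact le_top.trans this
  -- Otherwise the tail of a minimizing sequence has energies below a real `C`; the surface energy
  -- is nonnegative, so the elastic energies are bounded by `C` as well.
  obtain ⟨C, hC, -⟩ := EReal.lt_iff_exists_real_btwn.mp (lt_top_iff_ne_top.mpr htop)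
  obtain ⟨n₀, hn₀⟩ := (hlim.eventually_lt_const hC).exists_forall_of_atTop
  have hel : ∀ n, (v (n + n₀)).elasticEnergy B.bdryS W F G t ≤ C := by
    intro n
    have h1 : E (v (n + n₀)) < C := by rw [hve]; exact hn₀ _ (Nat.le_add_left _ _)
    have h2 : (((v (n + n₀)).elasticEnergy B.bdryS W F G t : ℝ) : EReal) ≤ E (v (n + n₀)) :=
      le_add_of_nonneg_right (EReal.coe_ennreal_nonneg _)
    exact_mod_cast h2.trans h1.le
  have hΩ := B.interior_closure_Ω
  have hSm := B.isClosed_bdryS.measurableSet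
  have : IsFiniteMeasure (H1.restrict B.bdryS) := isFiniteMeasure_restrict.mpr
    ((measure_mono B.bdryS_subset_frontier).trans_lt ((v 0).measure_frontier_lt_top hΩ ha)).ne
  have hΩm := B.isOpen_Ω.measurableSet
  have hfin : volume B.Ω ≠ ⊤ := ((measure_mono subset_closure).trans_lt
    ((v 0).isComplex hΩ ha).isCompact_closure.measure_lt_top).ne
  obtain ⟨φ, An, u, A, hφ, hconv⟩ := exists_feConverges_of_elasticEnergy_le hΩ ha hSm
    B.bdryS_subset_frontier hT hq hr ht hW hF hG hel
  refine ⟨u, hconv.jumpSet_subset hΩ ha isClosed_closure fun n => hv _, fun w hw => ?_⟩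
  refine le_trans (hconv.stepEnergy_le ha (hW.isDominatedIntegrand hΩm hfin hp)
    (hF.isDominatedIntegrand hT hΩm hfin (by linarith) ht)
    (hG.isDominatedIntegrand hT hSm hr ht) hX hk (fun n => (hv _).trans hBX) hg hΓ ?_) (hle w hw)
  have := hlim.comp ((tendsto_add_atTop_nat n₀).comp hφ.tendsto_atTop)
  exact this.congr fun n => (hve _).symm

/-! ### Discrete evolutions -/

theorem crack_zero (D Γ₀ : Set E2) (g : ℕ → E2 → E2) (u : ℕ → FEFun R a) :
    crack D Γ₀ g u 0 = Γ₀ ∪ (u 0).jumpSetBC D (g 0) := by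
  simp [crack]

theorem crack_succ (D Γ₀ : Set E2) (g : ℕ → E2 → E2) (u : ℕ → FEFun R a) (i : ℕ) :
    crack D Γ₀ g u (i + 1) = crack D Γ₀ g u i ∪ (u (i + 1)).jumpSetBC D (g (i + 1)) := by
  simp only [crack, ← Nat.lt_succ_iff, biUnion_lt_succ _ (i + 1), union_assoc, Nat.succ_eq_add_one]

theorem subset_crack (D Γ₀ : Set E2) (g : ℕ → E2 → E2) (u : ℕ → FEFun R a) (i : ℕ) :
    Γ₀ ⊆ crack D Γ₀ g u i := subset_union_left

theorem crack_mono (D Γ₀ : Set E2) (g : ℕ → E2 → E2) (u : ℕ → FEFun R a) :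
    Monotone (crack D Γ₀ g u) := fun _ _ hij =>
  union_subset_union_right _ (biUnion_subset_biUnion_left fun _ hr => le_trans hr hij)

/-- A step can be solved only for cracks with the property `C`, so the recursion produces cracks
bundled with a proof of `C`. -/
theorem exists_evolution {D Γ₀ : Set E2} {g : ℕ → E2 → E2} {C : Set E2 → Prop} (hΓ₀ : C Γ₀)
    (hC : ∀ Γ i (v : FEFun R a), C Γ → C (Γ ∪ v.jumpSetBC D (g i)))
    {P : ℕ → Set E2 → FEFun R a → Prop} (hP : ∀ i Γ, C Γ → ∃ v, P i Γ v) :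
    ∃ u : ℕ → FEFun R a, P 0 Γ₀ (u 0) ∧ ∀ i, P (i + 1) (crack D Γ₀ g u i) (u (i + 1)) := by
  choose f hf using hP
  -- `Γ i` is the crack before step `i`; the crack after step `i` is therefore `Γ (i + 1)`.
  let Γ : ℕ → {Γ : Set E2 // C Γ} := Nat.rec ⟨Γ₀, hΓ₀⟩ fun i Γ =>
    ⟨Γ.1 ∪ (f i Γ.1 Γ.2).jumpSetBC D (g i), hC _ _ _ Γ.2⟩
  let u : ℕ → FEFun R a := fun i => f i (Γ i).1 (Γ i).2
  have hcrack : ∀ i, crack D Γ₀ g u i = (Γ (i + 1)).1 := by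
    intro i
    induction i with
    | zero => exact crack_zero _ _ _ _
    | succ i ih => rw [crack_succ, ih]
  refine ⟨u, hf 0 _ _, fun i => ?_⟩
  rw [hcrack]
  exact hf (i + 1) _ _

theorem timeNode_mem_Icc {T δ : ℝ} (hT : 0 < T) (hδ : 0 < δ) {N : ℕ}
    (hN : δ * ((N : ℝ) - 1) < T) (i : ℕ) : timeNode T δ N i ∈ Icc 0 T := by
  unfold timeNode
  split_ifs with h
  · refine ⟨by positivity, ?_⟩
    have : (i : ℝ) ≤ N - 1 := by
      have : (i : ℝ) + 1 ≤ N := by exact_mod_cast h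
      linarith
    nlinarith
  · exact ⟨hT.le, le_rfl⟩

theorem timeNode_zero {T δ : ℝ} {N : ℕ} (hN : 0 < N) : timeNode T δ N 0 = 0 := by
  simp [timeNode, hN]

end

end CrackFE

/-! ### The discrete evolution. -/

theorem proposition5p2
    (B : Body)
    {c₁ c₂ ε a δ T p q qd r : ℝ}
    (hc₁ : 0 < c₁) (hc : c₁ < c₂) (hε : 0 < ε) (ha : 0 < a) (ha' : a < 1 / 2) (hδ : 0 < δ)
    (hT : 0 < T) (hp : 1 < p) (hq : 1 < q) (hqd : 1 ≤ qd) (hqdq : qd < q)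
    (hpr : p ≤ r) (hr : p < 2 → r ≤ p / (2 - p))
    (R : RegularTriangulation B.Ω c₁ c₂ ε)
    (hRB : R.ComposedOfTriangles B.ΩB)
    (hRD : R.ComposedOfEdges B.bdryD)
    (hRS : R.ComposedOfEdges B.bdryS)
    {W : E2 → M22 → ℝ} (hW : IsBulkDensity B.Ω p W)
    {F : ℝ → E2 → E2 → ℝ} (hF : IsBodyPotential T B.Ω q qd F)
    {G : ℝ → E2 → E2 → ℝ} (hG : IsSurfacePotential T B.bdryS r G)
    {X : Set E2} (hX : IsClosed X) (hBX : closure B.ΩB ⊆ X) (hXΩ : X ⊆ closure B.Ω)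
    {k : E2 → E2 → ℝ} (hk : IsSurfaceDensity X k)
    {g : ℝ → E2 → E2} (hg : ∀ t ∈ Set.Icc 0 T, g t ∈ R.affineFE)
    {N : ℕ} (hN : IsGreatest {n : ℕ | δ * ((n : ℝ) - 1) < T} N)
    {Γ₀ : Set E2} (hΓ₀ : Γ₀ ∈ initialCracks R a B.ΩB B.bdryD) :
    ∃ u : ℕ → FEFun R a, ∃ Γ : ℕ → Set E2,
      (∀ i ≤ N, u i ∈ brittleFE R a B.ΩB) ∧
      (∀ i ≤ N, Γ i = crack B.bdryD Γ₀ (fun j => g (timeNode T δ N j)) u i) ∧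
      (∀ i j, i ≤ j → j ≤ N → Γ₀ ⊆ Γ i ∧ Γ i ⊆ Γ j) ∧
      (∀ v ∈ brittleFE R a B.ΩB,
        (u 0).stepEnergy B W F G X k 0 (g (timeNode T δ N 0)) Γ₀
          ≤ v.stepEnergy B W F G X k 0 (g (timeNode T δ N 0)) Γ₀) ∧
      ∀ i, 1 ≤ i → i ≤ N → ∀ v ∈ brittleFE R a B.ΩB,
        (u i).stepEnergy B W F G X k (timeNode T δ N i) (g (timeNode T δ N i)) (Γ (i - 1))
          ≤ v.stepEnergy B W F G X k (timeNode T δ N i) (g (timeNode T δ N i)) (Γ (i - 1)) := by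
  obtain ⟨-, -, z, hz, rfl⟩ := hΓ₀
  -- Since `1` belongs to the set, `N` is positive, and the node with index zero is the time `0` and
  -- not `T`.
  have hN0 : 0 < N := hN.2 (show δ * (((1 : ℕ) : ℝ) - 1) < T by simpa using hT)
  have hcont : ∀ i, ContinuousOn (g (timeNode T δ N i)) (closure B.Ω) := fun i =>
    (hg _ (timeNode_mem_Icc hT hδ hN.1 i)).1
  obtain ⟨u, hu0, hu⟩ := exists_evolution (R := R) (a := a) (D := B.bdryD)
    (g := fun j => g (timeNode T δ N j)) (C := IsCrackSet B.Ω)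
    (P := fun i Γ v => v ∈ brittleFE R a B.ΩB ∧
      IsMinOn (fun v : FEFun R a => v.stepEnergy B W F G X k (timeNode T δ N i)
        (g (timeNode T δ N i)) Γ) (brittleFE R a B.ΩB) v)
    -- The preexisting crack is itself the set `S^0(z)`, so it is a crack set by the same lemma with
    -- boundary datum zero; `z` also shows that the class of competitors is not empty.
    (z.isCrackSet_jumpSetBC B.interior_closure_Ω ha B.measurableSet_bdryD B.bdryD_subset
      (g := 0) continuousOn_const)
    (fun Γ i v hΓ => hΓ.union (v.isCrackSet_jumpSetBC B.interior_closure_Ω ha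
      B.measurableSet_bdryD B.bdryD_subset (hcont i)))
    (fun i Γ hΓ => exists_isMinOn_stepEnergy ha hT (by linarith) hq (by linarith)
      (timeNode_mem_Icc hT hδ hN.1 i) hW hF hG hX hBX hk (hcont i) hΓ ⟨z, hz⟩)
  refine ⟨u, crack B.bdryD (z.jumpSetBC B.bdryD 0) (fun j => g (timeNode T δ N j)) u, ?_,
    fun _ _ => rfl, fun i j hij _ => ⟨subset_crack _ _ _ _ _, crack_mono _ _ _ _ hij⟩, ?_, ?_⟩
  · rintro (_ | i) -
    exacts [hu0.1, (hu i).1]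
  · intro v hv
    have := hu0.2 hv
    simpa only [mem_ofPred_eq, timeNode_zero hN0] using this
  · rintro (_ | i) hi - v hv
    · omega
    · exact (hu i).2 hv
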